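/- **Theorem 4.3.** Let $K$ be a field, let $W$ and $V$ be dual $K$-vector spaces of finite dimension $v$ with dual bases $x_1,\dots,x_v$ of $W$ and $e_1,\dots,e_v$ of $V$, and let $S=\mathrm{Sym}(W)$ and $E=\bigwedge V$, graded so that $W$ has degree $1$ and $V$ has degree $-1$. Complexes are written cohomologically, and $C\langle a\rangle$ denotes the complex with $C\langle a\rangle^k=C^{a+k}$. For a graded $S$-module $N$ let $\mathbf R(N)$ be the complex of graded free left $E$-modules with term $\mathrm{Hom}_K(E,N_n)$ in cohomological degree $n$ and differential $\alpha\mapsto[e\mapsto\sum_i x_i\,\alpha(e_ie)]$; here $(a\alpha)(e)=\alpha(ea)$, and $\alpha\in\mathrm{Hom}_K(E,N_n)$ has degree $t$ if it factors through the projection $E\to E_{n-t}$. If $N$ is regarded as a complex concentrated in cohomological degree $j$, then $\mathbf R(N)$ has $\mathrm{Hom}_K(E,N_n)$ in cohomological degree $n+j$. For a graded left $E$-module $P$ let $\mathbf L(P)$ be the complex with term $S\otimes_K P_n$ in cohomological degree $-n$ and differential $s\otimes p\mapsto\sum_i x_is\otimes e_ip$. For a minimal complex $\mathbf F$ of graded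 free $E$-modules with homogeneous bases, $\mathrm{lin}(\mathbf F)$ is the complex with the same terms, in which all terms of degree $>1$ (that is, lying in $\bigwedge^{j}V$ with $j>1$) are erased from the entries of the matrices of the differentials. Let $\mathfrak m=SW$, and let $H^j_{\mathfrak m}$ denote local cohomology of graded $S$-modules, with its natural grading. Let $M$ be a graded $S$-module generated in degree $d$, and let $P$ be a graded $E$-module such that $\mathbf L(P)$ is a (linear) graded free resolution $$\cdots\to S\otimes_KP_{d+1}\to S\otimes_KP_d\to M\to 0$$ of $M$ (in particular $P_j=0$ for $j<d$). Let $\mathbf F:\cdots\to F^{-1}\to F^0$ be the minimal graded free resolution of $P$. Then, for any choice of homogeneous bases of the $F^k$, there is an isomorphism of complexes of graded $E$-modules $$\mathrm{lin}(\mathbf F)\;\cong\;\Big(\bigoplus_j\mathbf R(H^j_{\mathfrak m}(M))\Big)\langle d\rangle ,$$ where $H^j_{\mathfrak m}(M)$ is regarded as a complex with one term, concentrated in cohomological degree $j$. In particular, for all $i\ge 0$, as graded $E$-modules, $$F^{-i}\;\cong\;\bigoplus_j\mathrm{Hom}_K\big(E,\,H^j_{\mathfrak m}(M)_{d-j-i}\big),$$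 where $H^j_{\mathfrak m}(M)_{d-j-i}$ is regarded as a vector space of degree $d-j-i$. For $d=0$ these read $\mathrm{lin}(\mathbf F)\cong\bigoplus_j\mathbf R(H^j_{\mathfrak m}(M))$ and $F^{-i}\cong\bigoplus_j\mathrm{Hom}_K(E,H^j_{\mathfrak m}(M)_{-j-i})$. -/

import Mathlib

open scoped TensorProduct DirectSum

/-!
Conventions.  `K` is a field, `W` has basis `x_0, …, x_{v-1}` in degree `1`, `V` is the dual space
with dual basis `e_0, …, e_{v-1}` in degree `-1`.  In these coordinates `S = Sym W` is the polynomial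
ring and `E = ⋀ V` is the exterior algebra on `Fin v → K`.
Graded modules are internally graded by `ℤ`, complexes are cohomological.
-/

noncomputable section

namespace BGG

universe u w

/-- The symmetric algebra `S = Sym W = K[x_0, …, x_{v-1}]`. -/
abbrev SymAlg (K : Type*) [Field K] (v : ℕ) := MvPolynomial (Fin v) K

/-- The exterior algebra `E = ⋀ V`. -/
abbrev ExtAlg (K : Type*) [Field K] (v : ℕ) := ExteriorAlgebra K (Fin v → K)

/-- The basis element `e_i` of `V`, as an element of `E`. -/
def extVar (K : Type*) [Field K] {v : ℕ} (i : Fin v) : ExtAlg K v :=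
  ExteriorAlgebra.ι K (Pi.single i 1)

/-- The grading of `S`: forms of degree `n` have degree `n`; nothing in negative degrees. -/
def symGrading (K : Type*) [Field K] (v : ℕ) (n : ℤ) : Submodule K (SymAlg K v) :=
  if 0 ≤ n then MvPolynomial.homogeneousSubmodule (Fin v) K n.toNat else ⊥

/-- The grading of `E`: the `j`-th exterior power has degree `-j`; nothing in positive degrees. -/
def extGrading (K : Type*) [Field K] (v : ℕ) (n : ℤ) : Submodule K (ExtAlg K v) :=
  if n ≤ 0 then ⋀[K]^((-n).toNat) (Fin v → K) else ⊥

theorem X_mem_symGrading (K : Type*) [Field K] {v : ℕ} (i : Fin v) :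
    (MvPolynomial.X i : SymAlg K v) ∈ symGrading K v 1 := by
  simpa [symGrading] using MvPolynomial.isHomogeneous_X K i

theorem extVar_mem_extGrading (K : Type*) [Field K] {v : ℕ} (i : Fin v) :
    extVar K i ∈ extGrading K v (-1) := by
  simp [extGrading, extVar]

/-! ### The functor `L` -/

section L

variable {K : Type*} [Field K] {v : ℕ} {P : Type*} [AddCommGroup P] [Module K P]
  [Module (ExtAlg K v) P] (𝒬 : ℤ → Submodule K P) [h𝒬 : SetLike.GradedSMul (extGrading K v) 𝒬]

theorem extVar_smul_mem (i : Fin v) {a b : ℤ} (h : a = b + 1) {p : P} (hp : p ∈ 𝒬 a) :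
    extVar K i • p ∈ 𝒬 b := by
  have := h𝒬.smul_mem (extVar_mem_extGrading K i) hp
  simpa [h] using this

variable [IsScalarTower K (ExtAlg K v) P]

/-- Multiplication by `e_i`, as a map `P_a → P_b` with `a = b + 1`. -/
def eMul (i : Fin v) {a b : ℤ} (h : a = b + 1) : 𝒬 a →ₗ[K] 𝒬 b where
  toFun p := ⟨extVar K i • (p : P), extVar_smul_mem 𝒬 i h p.2⟩
  map_add' p q := by ext; simp
  map_smul' c p := Subtype.ext (smul_comm _ c _)

/-- The differential `S ⊗ P_a → S ⊗ P_b`, `a = b + 1`, of `L(P)`; it sends `s ⊗ p` to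
`∑ i, x_i s ⊗ e_i p`.  The term `S ⊗ P_j` of `L(P)` has cohomological degree `-j`. -/
def LDiff {a b : ℤ} (h : a = b + 1) :
    (SymAlg K v ⊗[K] 𝒬 a) →ₗ[SymAlg K v] (SymAlg K v ⊗[K] 𝒬 b) :=
  ∑ i : Fin v, (MvPolynomial.X i : SymAlg K v) • (eMul 𝒬 i h).baseChange (SymAlg K v)

/-- `L(P)`, augmented by `ε : S ⊗ P_d → M`, is a graded free resolution
`⋯ → S ⊗ P_{d+1} → S ⊗ P_d → M → 0` of the graded `S`-module `M`. -/
structure IsLResolution {M : Type*} [AddCommGroup M] [Module K M] [Module (SymAlg K v) M]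
    (ℳ : ℤ → Submodule K M) (d : ℤ) (ε : (SymAlg K v ⊗[K] 𝒬 d) →ₗ[SymAlg K v] M) : Prop where
  eq_bot : ∀ j < d, 𝒬 j = ⊥
  aug_mem : ∀ p : 𝒬 d, ε (1 ⊗ₜ p) ∈ ℳ d
  aug_surjective : Function.Surjective ε
  aug_exact : Function.Exact (LDiff (v := v) 𝒬 (rfl : d + 1 = d + 1)) ε
  exact : ∀ (a b c : ℤ) (hab : a = b + 1) (hbc : b = c + 1), d < b →
    Function.Exact (LDiff (v := v) 𝒬 hab) (LDiff (v := v) 𝒬 hbc)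

end L

/-! ### The functor `R` -/

section R

/-- The left `E`-module `Hom_K(E, D)`. -/
def HomE (K : Type*) [Field K] (v : ℕ) (D : Type*) [AddCommGroup D] [Module K D] :=
  ExtAlg K v →ₗ[K] D

variable {K : Type*} [Field K] {v : ℕ} {D : Type*} [AddCommGroup D] [Module K D]

instance : AddCommGroup (HomE K v D) := inferInstanceAs (AddCommGroup (ExtAlg K v →ₗ[K] D))

instance : Module K (HomE K v D) := inferInstanceAs (Module K (ExtAlg K v →ₗ[K] D))

instance : FunLike (HomE K v D) (ExtAlg K v) D := inferInstanceAs (FunLike (ExtAlg K v →ₗ[K] D) _ _)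

instance : LinearMapClass (HomE K v D) K (ExtAlg K v) D :=
  inferInstanceAs (LinearMapClass (ExtAlg K v →ₗ[K] D) K (ExtAlg K v) D)

/-- The left action of `E` on `Hom_K(E, D)`: `(a • α)(e) = α(e a)`. -/
instance : Module (ExtAlg K v) (HomE K v D) where
  smul a α := LinearMap.comp (α : ExtAlg K v →ₗ[K] D) (LinearMap.mulRight K a)
  one_smul α := LinearMap.ext fun e => congrArg (α : ExtAlg K v →ₗ[K] D) (mul_one e)
  mul_smul a b α := LinearMap.ext fun e =>
    congrArg (α : ExtAlg K v →ₗ[K] D) (mul_assoc e a b).symm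
  smul_zero _ := LinearMap.ext fun _ => rfl
  smul_add _ _ _ := LinearMap.ext fun _ => rfl
  add_smul a b α := LinearMap.ext fun e =>
    (congrArg (α : ExtAlg K v →ₗ[K] D) (mul_add e a b)).trans
      (map_add (α : ExtAlg K v →ₗ[K] D) (e * a) (e * b))
  zero_smul α := LinearMap.ext fun e =>
    (congrArg (α : ExtAlg K v →ₗ[K] D) (mul_zero e)).trans (map_zero (α : ExtAlg K v →ₗ[K] D))

theorem HomE.smul_apply (a : ExtAlg K v) (α : HomE K v D) (e : ExtAlg K v) : (a • α) e = α (e * a) := rfl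

/-- The grading of `Hom_K(E, D)` when `D` is regarded as a vector space of degree `n`: `α` has
degree `t` if it factors through the projection of `E` onto `E_{n-t}`. -/
def HomE.grading (n t : ℤ) : Submodule K (HomE K v D) where
  carrier := {α | ∀ s : ℤ, s ≠ n - t → ∀ e ∈ extGrading K v s, α e = 0}
  add_mem' := by
    intro α β hα hβ s hs e he
    have h : α e + β e = 0 := by rw [hα s hs e he, hβ s hs e he, add_zero]
    exact h
  zero_mem' := fun s hs e he => rfl
  smul_mem' := by
    intro c α hα s hs e he
    have h : c • α e = 0 := by rw [hα s hs e he, smul_zero]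
    exact h

variable {N : Type*} [AddCommGroup N] [Module K N] [Module (SymAlg K v) N] (𝒩 : ℤ → Submodule K N)
  [h𝒩 : SetLike.GradedSMul (symGrading K v) 𝒩]

theorem X_smul_mem (i : Fin v) {a b : ℤ} (h : a + 1 = b) {y : N} (hy : y ∈ 𝒩 a) :
    (MvPolynomial.X i : SymAlg K v) • y ∈ 𝒩 b := by
  have := h𝒩.smul_mem (X_mem_symGrading K i) hy
  simpa [← h, add_comm] using this

variable [IsScalarTower K (SymAlg K v) N]

/-- Multiplication by `x_i`, as a map `N_a → N_b` with `a + 1 = b`. -/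
def xMul (i : Fin v) {a b : ℤ} (h : a + 1 = b) : 𝒩 a →ₗ[K] 𝒩 b where
  toFun y := ⟨(MvPolynomial.X i : SymAlg K v) • (y : N), X_smul_mem 𝒩 i h y.2⟩
  map_add' p q := by ext; simp
  map_smul' c p := Subtype.ext (smul_comm _ c _)

/-- The differential `Hom_K(E, N_a) → Hom_K(E, N_b)`, `a + 1 = b`, of `R(N)`; it sends `α` to
`e ↦ ∑ i, x_i α(e_i e)`.  The term `Hom_K(E, N_a)` of `R(N)` has cohomological degree `a`. -/
def RDiff {a b : ℤ} (h : a + 1 = b) : HomE K v (𝒩 a) →ₗ[ExtAlg K v] HomE K v (𝒩 b) where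
  toFun α := ∑ i : Fin v, (xMul 𝒩 i h).comp
    ((α : ExtAlg K v →ₗ[K] 𝒩 a).comp (LinearMap.mulLeft K (extVar K i)))
  map_add' α β := by
    refine LinearMap.ext fun e => ?_
    change (∑ i : Fin v, _ : ExtAlg K v →ₗ[K] 𝒩 b) e =
      (∑ i : Fin v, _ : ExtAlg K v →ₗ[K] 𝒩 b) e + (∑ i : Fin v, _ : ExtAlg K v →ₗ[K] 𝒩 b) e
    simp only [LinearMap.sum_apply, ← Finset.sum_add_distrib]
    exact Finset.sum_congr rfl fun i _ => map_add (xMul 𝒩 i h) _ _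
  map_smul' a α := by
    refine LinearMap.ext fun e => ?_
    change (∑ i : Fin v, _ : ExtAlg K v →ₗ[K] 𝒩 b) e =
      (∑ i : Fin v, _ : ExtAlg K v →ₗ[K] 𝒩 b) (e * a)
    simp only [LinearMap.sum_apply]
    refine Finset.sum_congr rfl fun i _ => ?_
    change xMul 𝒩 i h (α ((extVar K i * e) * a)) = xMul 𝒩 i h (α (extVar K i * (e * a)))
    rw [mul_assoc]

theorem RDiff_apply {a b : ℤ} (h : a + 1 = b) (α : HomE K v (𝒩 a)) (e : ExtAlg K v) :
    RDiff 𝒩 h α e = ∑ i : Fin v, xMul 𝒩 i h (α (extVar K i * e)) := by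
  change (∑ i : Fin v, _ : ExtAlg K v →ₗ[K] 𝒩 b) e = _
  simp only [LinearMap.sum_apply]
  rfl

end R

/-! ### Local cohomology of graded modules at the homogeneous maximal ideal

For a graded `S`-module `M`, the module `H^j_𝔪(M)` is the `j`-th cohomology of the (extended) Čech
complex `0 → M → ⨁_i M_{x_i} → ⨁_{i<k} M_{x_i x_k} → ⋯ → M_{x_0 ⋯ x_{v-1}} → 0`,
with the grading induced by the natural grading of the localizations. -/

section LocalCohomology

/-- The monomial `x_A = ∏ i ∈ A, x_i`. -/
def xProd (K : Type*) [Field K] {v : ℕ} (A : Finset (Fin v)) : SymAlg K v :=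
  ∏ i ∈ A, MvPolynomial.X i

variable {K : Type*} [Field K] {v : ℕ} (M : Type*) [AddCommGroup M] [Module (SymAlg K v) M]

/-- The localization `M_{x_A}`. -/
abbrev Loc (A : Finset (Fin v)) := LocalizedModule (Submonoid.powers (xProd K A)) M

theorem isUnit_xProd {A B : Finset (Fin v)} (h : A ⊆ B) (s : Submonoid.powers (xProd K A)) :
    IsUnit (algebraMap (SymAlg K v) (Module.End (SymAlg K v) (Loc (K := K) M B)) s) := by
  obtain ⟨_, n, rfl⟩ := s
  have hB : IsUnit (algebraMap (SymAlg K v) (Module.End (SymAlg K v) (Loc (K := K) M B)) (xProd K B)) :=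
    IsLocalizedModule.map_units (LocalizedModule.mkLinearMap (Submonoid.powers (xProd K B)) M)
      ⟨xProd K B, Submonoid.mem_powers _⟩
  change IsUnit (algebraMap (SymAlg K v) _ (xProd K A ^ n))
  rw [map_pow]
  refine IsUnit.pow n ?_
  have hd : xProd K B = xProd K A * xProd K (B \ A) := by
    rw [xProd, xProd, xProd, mul_comm, Finset.prod_sdiff h]
  have hm := congrArg (algebraMap (SymAlg K v) (Module.End (SymAlg K v) (Loc (K := K) M B))) hd
  rw [map_mul] at hm
  replace hB := hm ▸ hB
  exact ((Commute.isUnit_mul_iff (Algebra.commutes (xProd K A) (algebraMap (SymAlg K v)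
    (Module.End (SymAlg K v) (Loc (K := K) M B)) (xProd K (B \ A))))).mp hB).1

/-- The localization map `M_{x_A} → M_{x_B}` for `A ⊆ B`. -/
def locMap {A B : Finset (Fin v)} (h : A ⊆ B) : Loc (K := K) M A →ₗ[SymAlg K v] Loc (K := K) M B :=
  LocalizedModule.lift _ (LocalizedModule.mkLinearMap (Submonoid.powers (xProd K B)) M)
    (isUnit_xProd M h)

/-- The total Čech module `⨁_A M_{x_A}`, the sum running over all `A ⊆ {0, …, v-1}`. -/
abbrev Cech := (A : Finset (Fin v)) → Loc (K := K) M A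

/-- The Čech differential
`(∂c)_B = ∑ i ∈ B, (-1)^{#{k ∈ B | k < i}} c_{B ∖ {i}}` (restricted to `M_{x_B}`). -/
def cechDiff : Cech (K := K) (v := v) M →ₗ[SymAlg K v] Cech (K := K) (v := v) M :=
  LinearMap.pi fun B => ∑ i ∈ B, ((-1 : ℤ) ^ (B.filter (· < i)).card) •
    (locMap M (B.erase_subset i)).comp (LinearMap.proj (B.erase i))

/-- The cocycles in `Č^j = ⨁_{|A| = j} M_{x_A}`. -/
def cechCocycles (j : ℕ) : Submodule (SymAlg K v) (Cech (K := K) (v := v) M) where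
  carrier := {c | (∀ A, A.card ≠ j → c A = 0) ∧ cechDiff M c = 0}
  add_mem' := by
    rintro c c' ⟨h1, h2⟩ ⟨h1', h2'⟩
    refine ⟨fun A hA => ?_, ?_⟩
    · rw [Pi.add_apply, h1 A hA, h1' A hA, add_zero]
    · rw [map_add, h2, h2', add_zero]
  zero_mem' := ⟨fun A _ => rfl, map_zero _⟩
  smul_mem' := by
    rintro s c ⟨h1, h2⟩
    refine ⟨fun A hA => ?_, ?_⟩
    · rw [Pi.smul_apply, h1 A hA, smul_zero]
    · rw [map_smul, h2, smul_zero]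

/-- The coboundaries in `Č^j`, i.e. the image of `Č^{j-1} = ⨁_{|A| + 1 = j} M_{x_A}`. -/
def cechBoundaries (j : ℕ) : Submodule (SymAlg K v) (Cech (K := K) (v := v) M) where
  carrier := {c | ∃ b : Cech (K := K) (v := v) M,
    (∀ A, A.card + 1 ≠ j → b A = 0) ∧ cechDiff M b = c}
  add_mem' := by
    rintro _ _ ⟨b, h1, rfl⟩ ⟨b', h1', rfl⟩
    refine ⟨b + b', fun A hA => ?_, map_add _ _ _⟩
    rw [Pi.add_apply, h1 A hA, h1' A hA, add_zero]
  zero_mem' := ⟨0, fun A _ => rfl, map_zero _⟩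
  smul_mem' := by
    rintro s _ ⟨b, h1, rfl⟩
    refine ⟨s • b, fun A hA => ?_, map_smul _ _ _⟩
    rw [Pi.smul_apply, h1 A hA, smul_zero]

/-- The local cohomology module `H^j_𝔪(M)`. -/
abbrev LocalCohomology (j : ℕ) :=
  cechCocycles (K := K) (v := v) M j ⧸
    (cechBoundaries (K := K) (v := v) M j).submoduleOf (cechCocycles M j)

variable {M} [Module K M] [IsScalarTower K (SymAlg K v) M] (ℳ : ℤ → Submodule K M)

/-- The degree `n` part of `M_{x_A}`: the fractions `m / x_A^k` with `m ∈ M_{n + k|A|}`. -/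
def locGrading (A : Finset (Fin v)) (n : ℤ) : Submodule K (Loc (K := K) M A) :=
  Submodule.span K {y | ∃ (k : ℕ) (m : M), m ∈ ℳ (n + k * A.card) ∧
    y = LocalizedModule.mk m ⟨xProd K A ^ k, pow_mem (Submonoid.mem_powers _) k⟩}

/-- The degree `n` part of `H^j_𝔪(M)`: the classes of cocycles all of whose components have
degree `n`. -/
def localCohomologyGrading (j : ℕ) (n : ℤ) :
    Submodule K (LocalCohomology (K := K) (v := v) M j) where
  carrier := {y | ∃ z : cechCocycles (K := K) (v := v) M j,
    (∀ A, z.1 A ∈ locGrading ℳ A n) ∧ Submodule.Quotient.mk z = y}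
  add_mem' := by
    rintro _ _ ⟨z, h, rfl⟩ ⟨z', h', rfl⟩
    exact ⟨z + z', fun A => add_mem (h A) (h' A), rfl⟩
  zero_mem' := ⟨0, fun A => zero_mem _, rfl⟩
  smul_mem' := by
    rintro c _ ⟨z, h, rfl⟩
    exact ⟨c • z, fun A => Submodule.smul_mem _ c (h A), rfl⟩

theorem smul_mem_locGrading [h : SetLike.GradedSMul (symGrading K v) ℳ] (A : Finset (Fin v))
    {a n : ℤ} {s : SymAlg K v} (hs : s ∈ symGrading K v a) {y : Loc (K := K) M A}
    (hy : y ∈ locGrading ℳ A n) : s • y ∈ locGrading ℳ A (a + n) := by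
  induction hy using Submodule.span_induction with
  | mem y hy =>
    obtain ⟨k, m, hm, rfl⟩ := hy
    refine Submodule.subset_span ⟨k, s • m, ?_, by rw [LocalizedModule.smul'_mk]⟩
    have := h.smul_mem hs hm
    simpa [add_assoc] using this
  | zero => rw [smul_zero]; exact zero_mem _
  | add y z _ _ hy hz => rw [smul_add]; exact add_mem hy hz
  | smul c y _ hy => rw [smul_comm]; exact Submodule.smul_mem _ c hy

instance [SetLike.GradedSMul (symGrading K v) ℳ] (j : ℕ) :
    SetLike.GradedSMul (symGrading K v) (localCohomologyGrading (v := v) ℳ j) where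
  smul_mem := by
    rintro a n s _ hs ⟨z, h, rfl⟩
    exact ⟨s • z, fun A => smul_mem_locGrading ℳ A hs (h A), rfl⟩

/-- The term in cohomological degree `k` of the shifted complex `(⨁_j R(H^j_𝔪(M)))⟨d⟩`, where
`H^j_𝔪(M)` is regarded as a complex concentrated in cohomological degree `j`:
it is `⨁_j Hom_K(E, H^j_𝔪(M)_{k+d-j})`. -/
abbrev RLocTerm (d k : ℤ) :=
  ⨁ j : ℕ, HomE K v (localCohomologyGrading (v := v) ℳ j (k + d - j))

/-- The differential of `(⨁_j R(H^j_𝔪(M)))⟨d⟩`. -/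
def RLocDiff [SetLike.GradedSMul (symGrading K v) ℳ] (d : ℤ) {k l : ℤ} (h : k + 1 = l) :
    RLocTerm (v := v) ℳ d k →ₗ[ExtAlg K v] RLocTerm (v := v) ℳ d l :=
  DirectSum.lmap fun j : ℕ => RDiff (localCohomologyGrading (v := v) ℳ j)
    (show k + d - j + 1 = l + d - j by rw [← h]; ring)

/-- The degree `t` part of the term `⨁_j Hom_K(E, H^j_𝔪(M)_{k+d-j})`, where `H^j_𝔪(M)_{k+d-j}`
is regarded as a vector space of degree `k+d-j`. -/
def RLocGrading (d k t : ℤ) : Set (RLocTerm (v := v) ℳ d k) :=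
  {y | ∀ j : ℕ, y j ∈ HomE.grading (k + d - j) t}

end LocalCohomology

/-! ### Graded free complexes over `E` and their linear parts -/

/-- A complex of graded free `E`-modules, with chosen homogeneous bases and a differential that is
homogeneous of degree `0`. -/
structure GradedFreeComplex (K : Type*) [Field K] (v : ℕ) where
  /-- the terms -/
  X : ℤ → Type u
  [addCommGroup : ∀ k, AddCommGroup (X k)]
  [moduleK : ∀ k, Module K (X k)]
  [moduleE : ∀ k, Module (ExtAlg K v) (X k)]
  [isScalarTower : ∀ k, IsScalarTower K (ExtAlg K v) (X k)]
  /-- the gradings of the terms -/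
  gr : ∀ k, ℤ → Submodule K (X k)
  isInternal : ∀ k, DirectSum.IsInternal (gr k)
  gradedSMul : ∀ k, SetLike.GradedSMul (extGrading K v) (gr k)
  /-- the index sets of the bases -/
  I : ℤ → Type w
  /-- the homogeneous bases -/
  basis : ∀ k, Module.Basis (I k) (ExtAlg K v) (X k)
  basis_homogeneous : ∀ k i, ∃ n, basis k i ∈ gr k n
  /-- the differential -/
  d : ∀ {k l : ℤ}, k + 1 = l → (X k →ₗ[ExtAlg K v] X l)
  d_mem : ∀ {k l : ℤ} (h : k + 1 = l) (t : ℤ) (x : X k), x ∈ gr k t → d h x ∈ gr l t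
  d_comp_d : ∀ {k l m : ℤ} (h : k + 1 = l) (h' : l + 1 = m) (x : X k), d h' (d h x) = 0

attribute [instance] GradedFreeComplex.addCommGroup GradedFreeComplex.moduleK
  GradedFreeComplex.moduleE GradedFreeComplex.isScalarTower

/-- Erase from an element of `E` all terms that lie in exterior powers of order `> 1`. -/
def linElt (K : Type*) [Field K] (v : ℕ) (e : ExtAlg K v) : ExtAlg K v :=
  GradedAlgebra.proj (fun j : ℕ => ⋀[K]^j (Fin v → K)) 0 e +
    GradedAlgebra.proj (fun j : ℕ => ⋀[K]^j (Fin v → K)) 1 e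

theorem linElt_zero (K : Type*) [Field K] (v : ℕ) : linElt K v 0 = 0 := by
  simp only [linElt, map_zero, add_zero]

namespace GradedFreeComplex

variable {K : Type*} [Field K] {v : ℕ} (F : GradedFreeComplex.{u, w} K v)

/-- All matrix entries of the differentials lie in the maximal ideal of `E`, i.e. in the kernel of
the augmentation `E → K`. -/
def IsMinimal : Prop :=
  ∀ {k l : ℤ} (h : k + 1 = l) (i : F.I k) (j : F.I l),
    (ExteriorAlgebra.algebraMapInv : ExtAlg K v →ₐ[K] K) ((F.basis l).repr (F.d h (F.basis k i)) j) = 0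

/-- The differential of `lin(F)`: the `E`-linear map whose matrix is obtained from the matrix of the
differential of `F` by erasing all terms of entries that are of order `> 1`. -/
def linD {k l : ℤ} (h : k + 1 = l) : F.X k →ₗ[ExtAlg K v] F.X l :=
  (F.basis k).constr ℕ fun i => (F.basis l).repr.symm
    (((F.basis l).repr (F.d h (F.basis k i))).mapRange (linElt K v) (linElt_zero K v))

/-- `F`, augmented by `π : F^0 → P`, is a graded free resolution
`⋯ → F^{-1} → F^0 → P → 0` of the graded `E`-module `P`. -/
structure IsResolution {P : Type*} [AddCommGroup P] [Module K P] [Module (ExtAlg K v) P]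
    (𝒬 : ℤ → Submodule K P) (π : F.X 0 →ₗ[ExtAlg K v] P) : Prop where
  eq_zero : ∀ k > 0, Subsingleton (F.X k)
  aug_mem : ∀ (t : ℤ) (x : F.X 0), x ∈ F.gr 0 t → π x ∈ 𝒬 t
  aug_surjective : Function.Surjective π
  aug_exact : Function.Exact (F.d (show (-1 : ℤ) + 1 = 0 by norm_num)) π
  exact : ∀ (k l m : ℤ) (h : k + 1 = l) (h' : l + 1 = m), l < 0 →
    Function.Exact (F.d h) (F.d h')

end GradedFreeComplex

end BGG

end

/-! Both sides are computed by the Cartan complex `Hom_K(S, P)`, whose differential combines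
multiplication by e_l on P with the action of x_l on functions on monomials.

For a free E-module N the Cartan complex has homology only at the constant term, where it is N ⊗_E K
(`cartan_exact`). Comparing the two directions of the double complex `Hom_K(S, F)`, minimality of F
identifies the homology of `Hom_K(S, P)` on monomials of degree i with F^{-i} ⊗_E K. Under this
identification x_l acts through the coefficients of e_l in the linear part of the differential of F
(`ResRel.cartanX`). This is where lin(F) enters.

On the other side, the Čech complex of S ⊗ P_p has cohomology only in its last term, spanned by the
purely negative Laurent monomials, which are dual to the monomials of S (`laur_homotopy`).
Localizations of L(P) resolve those of M. Hence the double complex with terms S_{x_A} ⊗ P_p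
identifies H^j_𝔪(M) in degree d-j-i with the homology of the same Cartan complex, on monomials of
degree i with coefficients in P_{d-j+v}, compatibly with the x_l (`CechRel.X`).

Together: H^j_𝔪(M)_{d-j-i} is the part of F^{-i} ⊗_E K in degree d-j-i+v. Since E is a Frobenius
algebra (`exists_topCoeff_mul_eq`), Hom_K(E, D) is a free E-module on D shifted by v, so the terms
of F are sums of modules Hom_K(E, H^j_𝔪(M)_n). Compatibility with the x_l turns lin(F) into the
complex R, up to a sign absorbed into the isomorphisms.

The zigzags of both double complexes are handled as linear relations (`ResRel`, `CechRel`, composed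
to `LocRel`). On the homogeneous pieces concerned they are defined everywhere in both directions,
and match the zero class only with zero, so they are graphs of isomorphisms. Linear maps are chosen
only at the end, in `exists_isComparison`. -/

noncomputable section

set_option linter.unusedSectionVars false

namespace BGG

/-! ### Contractions and the augmentation on the exterior algebra -/

section Exterior

variable (K : Type*) [Field K] {v : ℕ}

/-- The augmentation `E → K`. -/
abbrev aug : ExtAlg K v →ₐ[K] K := ExteriorAlgebra.algebraMapInv

/-- Contraction with the `l`-th coordinate functional. -/
def ctr (l : Fin v) : ExtAlg K v →ₗ[K] ExtAlg K v :=
  CliffordAlgebra.contractLeft (Q := (0 : QuadraticForm K (Fin v → K))) (LinearMap.proj l)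

variable {K}

theorem ctr_extVar_mul (l m : Fin v) (a : ExtAlg K v) :
    ctr K l (extVar K m * a) = (if l = m then a else 0) - extVar K m * ctr K l a := by
  have := CliffordAlgebra.contractLeft_ι_mul (Q := (0 : QuadraticForm K (Fin v → K)))
    (d := LinearMap.proj l) (Pi.single m 1) a
  refine this.trans ?_
  congr 1
  by_cases h : l = m
  · subst h; simp
  · simp [h]

theorem ctr_algebraMap (l : Fin v) (k : K) : ctr K l (algebraMap K _ k) = 0 :=
  CliffordAlgebra.contractLeft_algebraMap (Q := (0 : QuadraticForm K (Fin v → K))) _ k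

theorem ctr_ctr_self (l : Fin v) (a : ExtAlg K v) : ctr K l (ctr K l a) = 0 :=
  CliffordAlgebra.contractLeft_contractLeft (Q := (0 : QuadraticForm K (Fin v → K))) _ a

theorem ctr_ctr (l m : Fin v) (a : ExtAlg K v) : ctr K l (ctr K m a) = -ctr K m (ctr K l a) :=
  CliffordAlgebra.contractLeft_comm (Q := (0 : QuadraticForm K (Fin v → K))) _ _ a

theorem extVar_mul_self (l : Fin v) : extVar K l * extVar K l = 0 :=
  ExteriorAlgebra.ι_sq_zero _

theorem extVar_mul_comm (l m : Fin v) : extVar K l * extVar K m = -(extVar K m * extVar K l) :=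
  eq_neg_of_add_eq_zero_left (ExteriorAlgebra.ι_add_mul_swap _ _)

theorem aug_ι (x : Fin v → K) : aug K (ExteriorAlgebra.ι K x) = 0 := by
  simp [aug, ExteriorAlgebra.algebraMapInv]

theorem aug_extVar (l : Fin v) : aug K (extVar K l) = 0 := aug_ι _

theorem aug_algebraMap (k : K) : aug K (algebraMap K (ExtAlg K v) k) = k :=
  ExteriorAlgebra.algebraMap_leftInverse _ k

theorem ι_eq_sum (x : Fin v → K) :
    ExteriorAlgebra.ι K x = ∑ l, x l • extVar K l := by
  conv_lhs => rw [pi_eq_sum_univ' x]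
  rw [map_sum]
  refine Finset.sum_congr rfl fun l _ => ?_
  rw [map_smul, extVar]

/-- Every element of `E` is a scalar plus an element of the left ideal generated by the `e_l`. -/
theorem exists_eq_aug_add (a : ExtAlg K v) :
    ∃ b : Fin v → ExtAlg K v, a = algebraMap K _ (aug K a) + ∑ l, extVar K l * b l := by
  induction a using CliffordAlgebra.left_induction with
  | algebraMap r =>
    exact ⟨0, by rw [show aug K ((algebraMap K _) r) = r from aug_algebraMap r]; simp⟩
  | add x y hx hy =>
    obtain ⟨b, hb⟩ := hx
    obtain ⟨b', hb'⟩ := hy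
    refine ⟨b + b', ?_⟩
    conv_lhs => rw [hb, hb']
    simp only [map_add, Pi.add_apply, mul_add, Finset.sum_add_distrib]
    abel
  | ι_mul x m _ =>
    refine ⟨fun l => m l • x, ?_⟩
    have h1 : aug K (ExteriorAlgebra.ι K m * x) = 0 := by rw [map_mul, aug_ι, zero_mul]
    have h2 : (CliffordAlgebra.ι (0 : QuadraticForm K (Fin v → K))) m * x
      = ExteriorAlgebra.ι K m * x := rfl
    rw [h2, h1, ι_eq_sum, Finset.sum_mul, map_zero, zero_add]
    exact Finset.sum_congr rfl fun l _ => by rw [smul_mul_assoc, mul_smul_comm]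

/-- The composite of the idempotents `a ↦ ι_l (e_l a)` for `l` in a list. -/
def projList (L : List (Fin v)) (a : ExtAlg K v) : ExtAlg K v :=
  L.foldr (fun l a => ctr K l (extVar K l * a)) a

theorem projList_cons (l : Fin v) (L : List (Fin v)) (a : ExtAlg K v) :
    projList (l :: L) a = ctr K l (extVar K l * projList L a) := rfl

theorem projList_add (L : List (Fin v)) (a b : ExtAlg K v) :
    projList L (a + b) = projList L a + projList L b := by
  induction L with
  | nil => rfl
  | cons l L ih => simp only [projList_cons, ih, mul_add, map_add]

theorem projList_sum {α : Type*} (L : List (Fin v)) (s : Finset α) (f : α → ExtAlg K v) :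
    projList L (∑ i ∈ s, f i) = ∑ i ∈ s, projList L (f i) := by
  induction L with
  | nil => rfl
  | cons l L ih => simp only [projList_cons, ih, Finset.mul_sum, map_sum]

/-- Contraction by a coordinate l ≠ m anticommutes with e_m. Thus annihilation by e_m survives all
factors applied before the factor of m, which then kills the element. -/
theorem extVar_mul_projList (L : List (Fin v)) (m : Fin v) (a : ExtAlg K v)
    (h : extVar K m * a = 0) : extVar K m * projList L a = 0 := by
  induction L with
  | nil => exact h
  | cons l L ih =>
    rw [projList_cons]
    by_cases hlm : l = m
    · subst hlm; rw [ih, map_zero, mul_zero]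
    · have := ctr_extVar_mul l m (extVar K l * projList L a)
      rw [if_neg hlm, zero_sub, ← mul_assoc, extVar_mul_comm, neg_mul, mul_assoc, ih, mul_zero,
        neg_zero, map_zero] at this
      exact neg_eq_zero.mp this.symm

theorem projList_extVar_mul (L : List (Fin v)) {m : Fin v} (hm : m ∈ L) (a : ExtAlg K v) :
    projList L (extVar K m * a) = 0 := by
  induction L with
  | nil => simp at hm
  | cons l L ih =>
    rw [projList_cons]
    by_cases hL : m ∈ L
    · rw [ih hL, mul_zero, map_zero]
    · obtain rfl : m = l := by simpa [hL] using hm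
      rw [extVar_mul_projList _ _ _ (by rw [← mul_assoc, extVar_mul_self, zero_mul]), map_zero]

theorem projList_algebraMap (L : List (Fin v)) (k : K) :
    projList L (algebraMap K _ k) = algebraMap K (ExtAlg K v) k := by
  induction L with
  | nil => rfl
  | cons l L ih => rw [projList_cons, ih, ctr_extVar_mul, if_pos rfl, ctr_algebraMap, mul_zero,
      sub_zero]

/-- The factor of l destroys multiples of e_l and every factor fixes scalars. When all l occur,
nothing of the augmentation ideal is left. -/
theorem projList_eq (L : List (Fin v)) (hL : ∀ l, l ∈ L) (a : ExtAlg K v) :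
    projList L a = algebraMap K _ (aug K a) := by
  obtain ⟨b, hb⟩ := exists_eq_aug_add a
  conv_lhs => rw [hb]
  rw [projList_add, projList_algebraMap, projList_sum,
    Finset.sum_eq_zero (fun l _ => projList_extVar_mul L (hL l) (b l)), add_zero]

/-- Since ι_l e_l + e_l ι_l = 1, an element killed by ι_l is fixed by a ↦ ι_l(e_l a). If this holds
for all l, the element is fixed by the projection onto the scalars. -/
theorem eq_algebraMap_of_ctr (a : ExtAlg K v) (h : ∀ l, ctr K l a = 0) :
    a = algebraMap K _ (aug K a) := by
  have key : ∀ L : List (Fin v), projList L a = a := by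
    intro L
    induction L with
    | nil => rfl
    | cons l L ih => rw [projList_cons, ih, ctr_extVar_mul, if_pos rfl, h, mul_zero, sub_zero]
  rw [← projList_eq (List.finRange v) (List.mem_finRange) a, key]

/-- A double sum of an alternating family vanishes. -/
theorem sum_sum_alternating {ι A : Type*} [Fintype ι] [LinearOrder ι] [AddCommGroup A]
    (f : ι → ι → A) (h0 : ∀ i, f i i = 0) (h : ∀ i j, f i j = -f j i) :
    ∑ i, ∑ j, f i j = 0 := by
  have e : ∀ i j, f i j = (if i < j then f i j else 0) - (if j < i then f j i else 0) := by
    intro i j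
    rcases lt_trichotomy i j with hij | rfl | hij
    · rw [if_pos hij, if_neg hij.not_gt, sub_zero]
    · simp [h0]
    · rw [if_neg hij.not_gt, if_pos hij, zero_sub, h]
  rw [Finset.sum_congr rfl fun i _ => Finset.sum_congr rfl fun j _ => e i j]
  simp only [Finset.sum_sub_distrib]
  rw [Finset.sum_comm, sub_self]

end Exterior

/-! ### The Cartan complex `Hom_K(S, N)` -/

section Cartan

variable (K : Type*) [Field K] {v : ℕ}

/-- The differential of the Cartan complex `Hom_K(S, N)`, whose elements are given by their values
on the monomials. -/
def cartanD (N : Type*) [AddCommGroup N] [Module K N] [Module (ExtAlg K v) N]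
    [IsScalarTower K (ExtAlg K v) N] : ((Fin v → ℕ) → N) →ₗ[K] ((Fin v → ℕ) → N) where
  toFun c a := ∑ l, extVar K l • c (a + Pi.single l 1)
  map_add' c c' := by ext a; simp [Finset.sum_add_distrib]
  map_smul' k c := by
    ext a
    simp only [Pi.smul_apply, RingHom.id_apply, Finset.smul_sum]
    exact Finset.sum_congr rfl fun l _ => smul_comm _ _ _

variable {K} {N : Type*} [AddCommGroup N] [Module K N] [Module (ExtAlg K v) N]
    [IsScalarTower K (ExtAlg K v) N]

theorem cartanD_apply (c : (Fin v → ℕ) → N) (a : Fin v → ℕ) :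
    cartanD K N c a = ∑ l, extVar K l • c (a + Pi.single l 1) := rfl

theorem cartanD_cartanD (c : (Fin v → ℕ) → N) : cartanD K N (cartanD K N c) = 0 := by
  ext a
  simp only [cartanD_apply, Finset.smul_sum, smul_smul, Pi.zero_apply]
  refine sum_sum_alternating _ (fun i => ?_) (fun i j => ?_)
  · rw [extVar_mul_self, zero_smul]
  · rw [extVar_mul_comm, neg_smul, add_right_comm]

theorem cartanD_comp {N' : Type*} [AddCommGroup N'] [Module K N'] [Module (ExtAlg K v) N']
    [IsScalarTower K (ExtAlg K v) N'] (f : N →ₗ[ExtAlg K v] N') (c : (Fin v → ℕ) → N) :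
    cartanD K N' (fun a => f (c a)) = fun a => f (cartanD K N c a) := by
  ext a
  simp [cartanD_apply]

/-- Multiplication by `x_l` on the Cartan complex. -/
def cartanX (l : Fin v) (c : (Fin v → ℕ) → N) : (Fin v → ℕ) → N := fun a => c (a + Pi.single l 1)

theorem cartanD_cartanX (l : Fin v) (c : (Fin v → ℕ) → N) :
    cartanD K N (cartanX l c) = cartanX l (cartanD K N c) := by
  ext a
  simp only [cartanD_apply, cartanX, add_right_comm]

/-- A homotopy contracting the Cartan complex in the direction of `x_l`. -/
def cartanH (κ : Fin v → N →+ N) (l : Fin v) (c : (Fin v → ℕ) → N) : (Fin v → ℕ) → N :=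
  fun a => if a l = 0 then 0 else κ l (c (a - Pi.single l 1))

/-- The operators κ_l stand for contractions in the coordinates of a free module, and `hκ` is the
relation ι_l e_m + e_m ι_l = δ_{lm}. The terms with m ≠ l cancel. The terms with m = l add up to
c(a), except on the face a_l = 0, where one of the two is missing and leaves the correction. -/
theorem cartan_homotopy (κ : Fin v → N →+ N)
    (hκ : ∀ l m (x : N), κ l (extVar K m • x) = (if l = m then x else 0) - extVar K m • κ l x)
    (l : Fin v) (c : (Fin v → ℕ) → N) (a : Fin v → ℕ) :
    cartanD K N (cartanH κ l c) a + cartanH κ l (cartanD K N c) a =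
      c a - if a l = 0 then κ l (extVar K l • c a) else 0 := by
  classical
  have h1 : ∀ m, m ≠ l → cartanH κ l c (a + Pi.single m 1) =
      if a l = 0 then 0 else κ l (c (a + Pi.single m 1 - Pi.single l 1)) := by
    intro m hm
    simp [cartanH, hm.symm]
  have h2 : cartanH κ l c (a + Pi.single l 1) = κ l (c a) := by
    simp [cartanH]
  rw [cartanD_apply, ← Finset.add_sum_erase _ _ (Finset.mem_univ l), h2]
  by_cases ha : a l = 0
  · rw [Finset.sum_eq_zero, if_pos ha, hκ, if_pos rfl, cartanH, if_pos ha]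
    · abel
    · intro m hm
      rw [h1 m (Finset.ne_of_mem_erase hm), if_pos ha, smul_zero]
  · have h3 : ∀ m, a - Pi.single l 1 + Pi.single m 1 = a + Pi.single m 1 - Pi.single l 1 := by
      intro m
      ext i
      by_cases hi : i = l
      · subst hi; simp; omega
      · simp [hi]
    rw [if_neg ha, sub_zero, cartanH, if_neg ha, cartanD_apply, map_sum,
      ← Finset.add_sum_erase _ _ (Finset.mem_univ l), hκ, if_pos rfl, h3, add_tsub_cancel_right,
      add_add_add_comm, ← Finset.sum_add_distrib, Finset.sum_eq_zero]
    · abel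
    · intro m hm
      have hm' := Finset.ne_of_mem_erase hm
      rw [h1 m hm', if_neg ha, hκ, if_neg hm'.symm, h3]
      abel

/-- Modulo boundaries, a cycle of the Cartan complex only depends on its constant term. -/
theorem cartan_exact_aux (κ : Fin v → N →+ N)
    (hκ : ∀ l m (x : N), κ l (extVar K m • x) = (if l = m then x else 0) - extVar K m • κ l x)
    (c : (Fin v → ℕ) → N) (hc : cartanD K N c = 0) (L : List (Fin v)) :
    ∃ y, ∀ a, c a = cartanD K N y a + if ∀ l ∈ L, a l = 0 then
      L.foldr (fun l x => κ l (extVar K l • x)) (c a) else 0 := by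
  induction L with
  | nil => exact ⟨0, fun a => by simp⟩
  | cons l L ih =>
    obtain ⟨y, hy⟩ := ih
    -- The cycle c' is c after the directions in L have been contracted. It lives on the face where
    -- these coordinates vanish, and the homotopy in direction l is now applied to it.
    set c' := c - cartanD K N y with hc'
    have hDc' : cartanD K N c' = 0 := by rw [hc', map_sub, hc, cartanD_cartanD, sub_zero]
    refine ⟨y + cartanH κ l c', fun a => ?_⟩
    have h := cartan_homotopy κ hκ l c' a
    have h0 : cartanH κ l (cartanD K N c') a = 0 := by
      rw [hDc']; simp [cartanH]
    have hca : c' a = if ∀ l ∈ L, a l = 0 then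
      L.foldr (fun l x => κ l (extVar K l • x)) (c a) else 0 := by
      rw [hc', Pi.sub_apply, sub_eq_iff_eq_add, add_comm]; exact hy a
    rw [h0, add_zero] at h
    rw [map_add, Pi.add_apply, h, hc', Pi.sub_apply]
    rw [← Pi.sub_apply, ← hc', hca]
    by_cases h1 : a l = 0 <;> by_cases h2 : ∀ l ∈ L, a l = 0
    · have h3 : ∀ m ∈ l :: L, a m = 0 := by simpa [h1] using h2
      rw [if_pos h2, if_pos h3, if_pos h1, List.foldr_cons]
      have := hy a
      rw [if_pos h2] at this
      rw [add_assoc, sub_add_cancel, ← this]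
    · have h3 : ¬ ∀ m ∈ l :: L, a m = 0 := fun h => h2 fun m hm => h m (List.mem_cons_of_mem _ hm)
      have := hy a
      rw [if_neg h2] at this
      rw [if_neg h2, if_neg h3, if_pos h1]
      simpa using this
    · have h3 : ¬ ∀ m ∈ l :: L, a m = 0 := fun h => h1 (h l List.mem_cons_self)
      have := hy a
      rw [if_pos h2] at this
      rw [if_pos h2, if_neg h3, if_neg h1, sub_zero, add_zero]
      exact this
    · have h3 : ¬ ∀ m ∈ l :: L, a m = 0 := fun h => h1 (h l List.mem_cons_self)
      have := hy a
      rw [if_neg h2] at this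
      rw [if_neg h2, if_neg h3, if_neg h1]
      simpa using this

/-- The coordinates modulo the maximal ideal of an element of a free `E`-module. -/
def augCoord {I : Type*} (B : Module.Basis I (ExtAlg K v) N) : N →ₗ[K] I →₀ K :=
  (Finsupp.mapRange.linearMap (aug K).toLinearMap).comp (B.repr.toLinearMap.restrictScalars K)

theorem augCoord_apply {I : Type*} (B : Module.Basis I (ExtAlg K v) N) (x : N) (i : I) :
    augCoord B x i = aug K (B.repr x i) := rfl

theorem augCoord_extVar_smul {I : Type*} (B : Module.Basis I (ExtAlg K v) N) (l : Fin v) (x : N) :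
    augCoord B (extVar K l • x) = 0 := by
  ext i
  simp [augCoord_apply, aug_extVar]

theorem augCoord_cartanD {I : Type*} (B : Module.Basis I (ExtAlg K v) N) (c : (Fin v → ℕ) → N)
    (a : Fin v → ℕ) : augCoord B (cartanD K N c a) = 0 := by
  rw [cartanD_apply, map_sum, Finset.sum_eq_zero fun l _ => augCoord_extVar_smul B l _]

/-- For free `N`, a cycle of the Cartan complex whose constant term lies in the maximal ideal is a
boundary. -/
theorem cartan_exact {I : Type*} (B : Module.Basis I (ExtAlg K v) N) (c : (Fin v → ℕ) → N)
    (hc : cartanD K N c = 0) (h0 : augCoord B (c 0) = 0) : ∃ y, cartanD K N y = c := by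
  -- Contraction acts on N coordinatewise in the basis. On the constant term the iterated correction
  -- becomes `projList` in each coordinate, hence the augmentation, which `h0` makes zero.
  let κ : Fin v → N →+ N := fun l =>
    (B.repr.symm.toAddEquiv.toAddMonoidHom.comp
      (Finsupp.mapRange.addMonoidHom (ctr K l).toAddMonoidHom)).comp
        B.repr.toAddEquiv.toAddMonoidHom
  have κ_apply : ∀ l x i, B.repr (κ l x) i = ctr K l (B.repr x i) := by
    intro l x i
    change B.repr (B.repr.symm _) i = _
    rw [LinearEquiv.apply_symm_apply]
    rfl
  have hκ : ∀ l m (x : N), κ l (extVar K m • x) =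
      (if l = m then x else 0) - extVar K m • κ l x := by
    intro l m x
    apply B.repr.injective
    ext i
    rw [κ_apply, map_smul, map_sub, map_smul, Finsupp.smul_apply, Finsupp.sub_apply,
      Finsupp.smul_apply, κ_apply, smul_eq_mul, smul_eq_mul, ctr_extVar_mul]
    by_cases h : l = m <;> simp [h]
  obtain ⟨y, hy⟩ := cartan_exact_aux κ hκ c hc (List.finRange v)
  refine ⟨y, funext fun a => ?_⟩
  rw [hy a]
  split_ifs with ha
  · obtain rfl : a = 0 := funext fun l => ha l (List.mem_finRange l)
    have key : ∀ (L : List (Fin v)) (x : N) (i : I),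
        B.repr (L.foldr (fun l x => κ l (extVar K l • x)) x) i = projList L (B.repr x i) := by
      intro L x i
      induction L with
      | nil => rfl
      | cons l L ih =>
        rw [List.foldr_cons, κ_apply, map_smul, Finsupp.smul_apply, ih, projList_cons, smul_eq_mul]
    have : (List.finRange v).foldr (fun l x => κ l (extVar K l • x)) (c 0) = 0 := by
      apply B.repr.injective
      ext i
      rw [key, projList_eq _ List.mem_finRange, ← augCoord_apply, h0]
      simp
    rw [this, add_zero]
  · rw [add_zero]

end Cartan

/-! ### Projections of graded vector spaces -/

section GradedProj

variable {K : Type*} [Field K] {N : Type*} [AddCommGroup N] [Module K N]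

/-- `pr t` are the projections onto the components of a grading. -/
structure IsGradedProj (gr : ℤ → Submodule K N) (pr : ℤ → N →ₗ[K] N) : Prop where
  mem : ∀ t x, pr t x ∈ gr t
  eq_self : ∀ t, ∀ x ∈ gr t, pr t x = x
  eq_zero : ∀ s t, ∀ x ∈ gr s, s ≠ t → pr t x = 0
  iSup_eq_top : ⨆ t, gr t = ⊤

theorem exists_isGradedProj {gr : ℤ → Submodule K N} (h : DirectSum.IsInternal gr) :
    ∃ pr, IsGradedProj gr pr := by
  classical
  let e := LinearEquiv.ofBijective (DirectSum.coeLinearMap gr) h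
  have he : ∀ t (x : gr t), e.symm x = DirectSum.lof K ℤ (fun t => gr t) t x := by
    intro t x
    rw [LinearEquiv.symm_apply_eq]
    exact (DirectSum.coeLinearMap_lof (R := K) gr t x).symm
  refine ⟨fun t => (gr t).subtype ∘ₗ DirectSum.component K ℤ (fun t => gr t) t ∘ₗ e.symm.toLinearMap,
    fun t x => Subtype.property _, fun t x hx => ?_, fun s t x hx hst => ?_, h.submodule_iSup_eq_top⟩
  · have := he t ⟨x, hx⟩
    simp only [LinearMap.comp_apply, LinearEquiv.coe_coe]
    rw [this, DirectSum.component.lof_self]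
    rfl
  · have := he s ⟨x, hx⟩
    simp only [LinearMap.comp_apply, LinearEquiv.coe_coe]
    rw [this, DirectSum.component.of, dif_neg hst]
    rfl

namespace IsGradedProj

variable {gr : ℤ → Submodule K N} {pr : ℤ → N →ₗ[K] N}

@[elab_as_elim]
theorem induction (h : IsGradedProj gr pr) {C : N → Prop} (zero : C 0) (mem : ∀ t, ∀ x ∈ gr t, C x)
    (add : ∀ x y, C x → C y → C (x + y)) (x : N) : C x :=
  Submodule.iSup_induction gr (motive := C) (h.iSup_eq_top ▸ Submodule.mem_top) mem zero add

theorem map_pr (h : IsGradedProj gr pr) {N' : Type*} [AddCommGroup N'] [Module K N'] {gr' : ℤ → Submodule K N'}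
    {pr' : ℤ → N' →ₗ[K] N'} (h' : IsGradedProj gr' pr') (f : N →ₗ[K] N') (r : ℤ)
    (hf : ∀ t, ∀ x ∈ gr t, f x ∈ gr' (t + r)) (t : ℤ) (x : N) :
    f (pr t x) = pr' (t + r) (f x) := by
  induction x using h.induction with
  | zero => simp
  | mem s x hx =>
    by_cases hst : s = t
    · subst hst
      rw [h.eq_self _ x hx, h'.eq_self _ _ (hf _ x hx)]
    · rw [h.eq_zero _ _ x hx hst, map_zero, h'.eq_zero _ _ _ (hf _ x hx) (by omega)]
  | add x y hx hy => simp only [map_add, hx, hy]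

theorem eq_zero_of_pr (h : IsGradedProj gr pr) (x : N) (hx : ∀ t, pr t x = 0) : x = 0 := by
  obtain ⟨f, hf, rfl⟩ := (Submodule.mem_iSup_iff_exists_finsupp gr x).mp
    (h.iSup_eq_top ▸ Submodule.mem_top)
  refine Finset.sum_eq_zero fun t _ => ?_
  rw [← hx t, Finsupp.sum, map_sum, Finset.sum_eq_single t, h.eq_self _ _ (hf t)]
  · exact fun s _ hst => h.eq_zero _ _ _ (hf s) hst
  · intro ht
    rw [Finsupp.notMem_support_iff.mp ht, map_zero]

end IsGradedProj

end GradedProj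

/-! ### Graded components of `E` and the coefficients of the e_l -/

section ExtGrading

variable {K : Type*} [Field K] {v : ℕ}

theorem proj_of_mem_same {j : ℕ} {a : ExtAlg K v} (ha : a ∈ ⋀[K]^j (Fin v → K)) :
    GradedAlgebra.proj (fun j : ℕ => ⋀[K]^j (Fin v → K)) j a = a :=
  DirectSum.decompose_of_mem_same (fun j : ℕ => ⋀[K]^j (Fin v → K)) ha

theorem proj_of_mem_ne {i j : ℕ} {a : ExtAlg K v} (ha : a ∈ ⋀[K]^i (Fin v → K)) (h : i ≠ j) :
    GradedAlgebra.proj (fun j : ℕ => ⋀[K]^j (Fin v → K)) j a = 0 :=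
  DirectSum.decompose_of_mem_ne (fun j : ℕ => ⋀[K]^j (Fin v → K)) ha h

/-- The projection of `E` onto its component of degree `s`. -/
def extProj (K : Type*) [Field K] (v : ℕ) (s : ℤ) : ExtAlg K v →ₗ[K] ExtAlg K v :=
  if s ≤ 0 then GradedAlgebra.proj (fun j : ℕ => ⋀[K]^j (Fin v → K)) (-s).toNat else 0

theorem isGradedProj_extGrading : IsGradedProj (extGrading K v) (extProj K v) where
  mem t x := by
    by_cases ht : t ≤ 0
    · simp only [extProj, extGrading, if_pos ht]
      exact Subtype.property _
    · simp [extProj, extGrading, ht]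
  eq_self t x hx := by
    by_cases ht : t ≤ 0
    · simp only [extProj, extGrading, if_pos ht] at hx ⊢
      exact proj_of_mem_same hx
    · simp only [extGrading, if_neg ht, Submodule.mem_bot] at hx
      rw [hx, map_zero]
  eq_zero s t x hx hst := by
    by_cases ht : t ≤ 0
    · by_cases hs : s ≤ 0
      · simp only [extProj, extGrading, if_pos ht, if_pos hs] at hx ⊢
        exact proj_of_mem_ne hx (by omega)
      · simp only [extGrading, if_neg hs, Submodule.mem_bot] at hx
        rw [hx, map_zero]
    · simp [extProj, ht]
  iSup_eq_top := by
    rw [eq_top_iff, ← (DirectSum.Decomposition.isInternal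
      (fun j : ℕ => ⋀[K]^j (Fin v → K))).submodule_iSup_eq_top]
    refine iSup_le fun j => ?_
    refine le_trans (le_of_eq ?_) (le_iSup _ (-(j : ℤ)))
    simp [extGrading]

theorem extGrading_neg_natCast (j : ℕ) :
    extGrading K v (-(j : ℤ)) = ⋀[K]^j (Fin v → K) := by
  simp [extGrading]

theorem extGrading_of_pos {s : ℤ} (hs : 0 < s) : extGrading K v s = ⊥ := by
  simp [extGrading, not_le.mpr hs]

theorem mul_mem_extGrading {s t : ℤ} {a b : ExtAlg K v} (ha : a ∈ extGrading K v s)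
    (hb : b ∈ extGrading K v t) : a * b ∈ extGrading K v (s + t) := by
  rcases lt_or_ge 0 s with hs | hs
  · rw [extGrading_of_pos hs, Submodule.mem_bot] at ha
    rw [ha, zero_mul]; exact zero_mem _
  rcases lt_or_ge 0 t with ht | ht
  · rw [extGrading_of_pos ht, Submodule.mem_bot] at hb
    rw [hb, mul_zero]; exact zero_mem _
  obtain ⟨m, rfl⟩ : ∃ m : ℕ, s = -m := ⟨(-s).toNat, by omega⟩
  obtain ⟨n, rfl⟩ : ∃ n : ℕ, t = -n := ⟨(-t).toNat, by omega⟩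
  rw [extGrading_neg_natCast] at ha hb
  rw [show -(m : ℤ) + -n = -((m + n : ℕ) : ℤ) by push_cast; ring, extGrading_neg_natCast]
  exact SetLike.GradedMul.mul_mem ha hb

/-- The coefficient of `e_l` in an element of `E`. -/
def linCoeff (l : Fin v) : ExtAlg K v →ₗ[K] K := (aug K).toLinearMap ∘ₗ ctr K l

theorem linCoeff_apply (l : Fin v) (a : ExtAlg K v) : linCoeff l a = aug K (ctr K l a) := rfl

theorem linCoeff_extVar_mul (l m : Fin v) (a : ExtAlg K v) :
    linCoeff l (extVar K m * a) = if l = m then aug K a else 0 := by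
  rw [linCoeff_apply, ctr_extVar_mul, map_sub, map_mul, aug_extVar, zero_mul, sub_zero]
  split_ifs <;> simp

theorem linCoeff_algebraMap (l : Fin v) (k : K) :
    linCoeff l (algebraMap K (ExtAlg K v) k) = 0 := by
  rw [linCoeff_apply, ctr_algebraMap, map_zero]

/-- The linear term of a product arises only from constant times linear: `linCoeff l` is a
derivation over the augmentation. -/
theorem linCoeff_mul (l : Fin v) (a b : ExtAlg K v) :
    linCoeff l (a * b) = aug K a * linCoeff l b + aug K b * linCoeff l a := by
  obtain ⟨c, hc⟩ := exists_eq_aug_add a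
  have h1 : a * b = aug K a • b + ∑ m, extVar K m * (c m * b) := by
    conv_lhs => rw [hc]
    rw [add_mul, Algebra.smul_def, Finset.sum_mul]
    simp only [mul_assoc]
  have h2 : linCoeff l a = aug K (c l) := by
    conv_lhs => rw [hc]
    simp [linCoeff_extVar_mul, linCoeff_algebraMap]
  rw [h1, h2]
  simp [linCoeff_extVar_mul, mul_comm]

theorem proj_ι_ι_mul {j : ℕ} (hj : j < 2) (l m : Fin v) (b : ExtAlg K v) :
    GradedAlgebra.proj (fun j : ℕ => ⋀[K]^j (Fin v → K)) j (extVar K l * (extVar K m * b)) = 0 := by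
  have h1 : ∀ l : Fin v, extVar K l ∈ ⋀[K]^1 (Fin v → K) := fun l => by simp [extVar]
  have h2 : extVar K l * extVar K m ∈ ⋀[K]^(1 + 1) (Fin v → K) :=
    SetLike.GradedMul.mul_mem (h1 l) (h1 m)
  rw [← mul_assoc]
  exact DirectSum.coe_decompose_mul_of_left_mem_of_not_le (fun j : ℕ => ⋀[K]^j (Fin v → K)) h2 (by omega)

/-- Applying `exists_eq_aug_add` twice writes a as constant plus linear terms plus multiples of
products e_l e_m. The last have no component in degrees 0 and 1. -/
theorem linElt_eq (a : ExtAlg K v) :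
    linElt K v a = algebraMap K _ (aug K a) + ∑ l, linCoeff l a • extVar K l := by
  obtain ⟨b, hb⟩ := exists_eq_aug_add a
  choose c hc using fun l => exists_eq_aug_add (b l)
  set k := aug K a
  have h0 : ∀ (j : ℕ) (k : K), GradedAlgebra.proj (fun j : ℕ => ⋀[K]^j (Fin v → K)) j
      (algebraMap K (ExtAlg K v) k) = if j = 0 then algebraMap K _ k else 0 := by
    intro j k
    have hk : algebraMap K (ExtAlg K v) k ∈ ⋀[K]^0 (Fin v → K) := by simp
    split_ifs with hj
    · subst hj; exact proj_of_mem_same hk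
    · exact proj_of_mem_ne hk (Ne.symm hj)
  have h1 : ∀ (j : ℕ) l, GradedAlgebra.proj (fun j : ℕ => ⋀[K]^j (Fin v → K)) j
      (extVar K l : ExtAlg K v) = if j = 1 then extVar K l else 0 := by
    intro j l
    have hk : (extVar K l) ∈ ⋀[K]^1 (Fin v → K) := by simp [extVar]
    split_ifs with hj
    · subst hj; exact proj_of_mem_same hk
    · exact proj_of_mem_ne hk (Ne.symm hj)
  have ha : a = algebraMap K _ k + ∑ l, (aug K (b l) • extVar K l +
      ∑ m, extVar K l * (extVar K m * c l m)) := by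
    conv_lhs => rw [hb]
    congr 1
    refine Finset.sum_congr rfl fun l _ => ?_
    conv_lhs => rw [hc l]
    rw [mul_add, Finset.mul_sum, ← Algebra.commutes, Algebra.smul_def]
  have h2 : ∀ l, linCoeff l a = aug K (b l) := by
    intro l
    conv_lhs => rw [hb]
    simp [linCoeff_extVar_mul, linCoeff_algebraMap]
  simp only [h2]
  rw [linElt]
  conv_lhs => rw [ha]
  simp only [map_add, map_sum, map_smul, h0, h1, proj_ι_ι_mul (show 0 < 2 by norm_num),
    proj_ι_ι_mul (show 1 < 2 by norm_num)]
  simp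

theorem aug_eq_zero_of_mem {s : ℤ} (hs : s ≠ 0) {a : ExtAlg K v} (ha : a ∈ extGrading K v s) :
    aug K a = 0 := by
  rcases lt_or_ge 0 s with hs' | hs'
  · rw [extGrading_of_pos hs', Submodule.mem_bot] at ha
    rw [ha, map_zero]
  obtain ⟨m, rfl⟩ : ∃ m : ℕ, s = -m := ⟨(-s).toNat, by omega⟩
  rw [extGrading_neg_natCast] at ha
  have h := congrArg (aug K) (linElt_eq a)
  have h0 : GradedAlgebra.proj (fun j : ℕ => ⋀[K]^j (Fin v → K)) 0 a = 0 :=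
    proj_of_mem_ne ha (by omega)
  by_cases hm : m = 1
  · subst hm
    obtain ⟨x, rfl⟩ : ∃ x, ExteriorAlgebra.ι K x = a := by simpa using ha
    exact aug_ι x
  · have h1 : GradedAlgebra.proj (fun j : ℕ => ⋀[K]^j (Fin v → K)) 1 a = 0 :=
      proj_of_mem_ne ha hm
    rw [linElt, h0, h1] at h
    simpa [aug_algebraMap, aug_extVar] using h.symm

theorem linCoeff_eq_zero_of_mem {s : ℤ} (hs : s ≠ -1) (l : Fin v) {a : ExtAlg K v}
    (ha : a ∈ extGrading K v s) : linCoeff l a = 0 := by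
  rcases lt_or_ge 0 s with hs' | hs'
  · rw [extGrading_of_pos hs', Submodule.mem_bot] at ha
    rw [ha, map_zero]
  obtain ⟨m, rfl⟩ : ∃ m : ℕ, s = -m := ⟨(-s).toNat, by omega⟩
  rw [extGrading_neg_natCast] at ha
  have h := congrArg (linCoeff l) (linElt_eq a)
  have h1 : GradedAlgebra.proj (fun j : ℕ => ⋀[K]^j (Fin v → K)) 1 a = 0 :=
    proj_of_mem_ne ha (by omega)
  have h2 : ∀ m, linCoeff l (extVar K m) = if l = m then (1 : K) else 0 := by
    intro m
    have := linCoeff_extVar_mul (K := K) l m 1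
    rwa [mul_one, map_one] at this
  by_cases hm : m = 0
  · subst hm
    obtain ⟨x, rfl⟩ : ∃ x, algebraMap K _ x = a := by
      simpa [Submodule.mem_one] using ha
    exact linCoeff_algebraMap l x
  · have h0 : GradedAlgebra.proj (fun j : ℕ => ⋀[K]^j (Fin v → K)) 0 a = 0 :=
      proj_of_mem_ne ha (by omega)
    rw [linElt, h0, h1] at h
    simpa [linCoeff_algebraMap, h2] using h.symm

end ExtGrading

/-! ### The perfect pairing on `E` -/

section Pairing

variable {K : Type*} [Field K] {v : ℕ}

/-- The product of the `e_l` for `l` in a list. -/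
def wedgeList (K : Type*) [Field K] {v : ℕ} (L : List (Fin v)) : ExtAlg K v := (L.map (extVar K)).prod

/-- The composite of the contractions with the coordinates in a list. -/
def ctrList : List (Fin v) → ExtAlg K v →ₗ[K] ExtAlg K v
  | [] => LinearMap.id
  | l :: L => ctrList L ∘ₗ ctr K l

theorem ctrList_cons (l : Fin v) (L : List (Fin v)) (a : ExtAlg K v) :
    ctrList (l :: L) a = ctrList L (ctr K l a) := rfl

/-- If e_l a = 0 then ι_l e_l + e_l ι_l = 1 gives a = e_l ι_l(a). The factor ι_l(a) is still killed
by the remaining e_m, so one may continue. -/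
theorem eq_wedgeList_mul (L : List (Fin v)) (hL : L.Nodup) (a : ExtAlg K v)
    (h : ∀ l ∈ L, extVar K l * a = 0) : a = wedgeList K L * ctrList L a := by
  induction L generalizing a with
  | nil => simp [wedgeList, ctrList]
  | cons l L ih =>
    have h1 : a = extVar K l * ctr K l a := by
      have := ctr_extVar_mul l l a
      rw [h l List.mem_cons_self, map_zero, if_pos rfl] at this
      exact (sub_eq_zero.mp this.symm)
    have h2 := ih (List.nodup_cons.mp hL).2 (ctr K l a) (fun m hm => by
      have := ctr_extVar_mul l m a
      rw [h m (List.mem_cons_of_mem _ hm), map_zero, if_neg, zero_sub] at this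
      · exact neg_eq_zero.mp this.symm
      · rintro rfl
        exact (List.nodup_cons.mp hL).1 hm)
    rw [ctrList_cons, wedgeList, List.map_cons, List.prod_cons, mul_assoc]
    rw [wedgeList] at h2
    rw [← h2, ← h1]

theorem ctr_ctrList_of_ctr (L : List (Fin v)) (m : Fin v) (a : ExtAlg K v) (h : ctr K m a = 0) :
    ctr K m (ctrList L a) = 0 := by
  induction L generalizing a with
  | nil => exact h
  | cons l L ih =>
    rw [ctrList_cons]
    exact ih _ (by rw [ctr_ctr, h, map_zero, neg_zero])

theorem ctr_ctrList (L : List (Fin v)) {m : Fin v} (hm : m ∈ L) (a : ExtAlg K v) :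
    ctr K m (ctrList L a) = 0 := by
  induction L generalizing a with
  | nil => simp at hm
  | cons l L ih =>
    rw [ctrList_cons]
    rcases List.mem_cons.mp hm with rfl | h
    · exact ctr_ctrList_of_ctr L _ _ (ctr_ctr_self _ _)
    · exact ih h _

theorem wedgeList_mem (L : List (Fin v)) : wedgeList K L ∈ extGrading K v (-(L.length : ℤ)) := by
  induction L with
  | nil => simp [wedgeList, extGrading]
  | cons l L ih =>
    have := mul_mem_extGrading (extVar_mem_extGrading K l) ih
    rw [wedgeList, List.map_cons, List.prod_cons, ← wedgeList]
    convert this using 2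
    push_cast [List.length_cons]
    ring

/-- The coefficient of the top form `e_0 ⋯ e_{v-1}`. -/
def topCoeff (K : Type*) [Field K] (v : ℕ) : ExtAlg K v →ₗ[K] K :=
  (aug K).toLinearMap ∘ₗ ctrList (List.finRange v) ∘ₗ extProj K v (-(v : ℤ))

theorem topCoeff_eq_zero_of_mem {s : ℤ} (hs : s ≠ -v) {a : ExtAlg K v}
    (ha : a ∈ extGrading K v s) : topCoeff K v a = 0 := by
  rw [topCoeff, LinearMap.comp_apply, LinearMap.comp_apply,
    isGradedProj_extGrading.eq_zero _ _ _ ha hs, map_zero, map_zero]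

/-- The socle of E is spanned by the top form: `eq_wedgeList_mul` writes a as the top form times an
element killed by all contractions, and such an element is a scalar. -/
theorem topCoeff_ne_zero_of_socle (a : ExtAlg K v) (ha : a ≠ 0)
    (h : ∀ l, extVar K l * a = 0) : topCoeff K v a ≠ 0 := by
  have h1 := eq_wedgeList_mul (List.finRange v) (List.nodup_finRange v) a (fun l _ => h l)
  have h2 := eq_algebraMap_of_ctr (ctrList (List.finRange v) a)
    (fun l => ctr_ctrList _ (List.mem_finRange l) a)
  set k := aug K (ctrList (List.finRange v) a) with hk
  rw [h2, ← Algebra.commutes, ← Algebra.smul_def] at h1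
  have hmem : a ∈ extGrading K v (-(v : ℤ)) := by
    rw [h1]
    refine Submodule.smul_mem _ _ ?_
    simpa using wedgeList_mem (K := K) (List.finRange v)
  rw [topCoeff, LinearMap.comp_apply, LinearMap.comp_apply,
    isGradedProj_extGrading.eq_self _ _ hmem]
  change k ≠ 0
  intro hk0
  exact ha (by rw [h1, hk0, zero_smul])

/-- Multiply by e_l whenever the product stays nonzero. Anticommutativity preserves the
annihilations obtained before, so every nonzero left ideal meets the socle. -/
theorem exists_mul_socle (a : ExtAlg K v) (ha : a ≠ 0) (L : List (Fin v)) :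
    ∃ e : ExtAlg K v, e * a ≠ 0 ∧ ∀ l ∈ L, extVar K l * (e * a) = 0 := by
  induction L with
  | nil => exact ⟨1, by simpa using ha, by simp⟩
  | cons l L ih =>
    obtain ⟨e, he, h⟩ := ih
    by_cases hl : extVar K l * (e * a) = 0
    · refine ⟨e, he, fun m hm => ?_⟩
      rcases List.mem_cons.mp hm with rfl | hm
      · exact hl
      · exact h m hm
    · refine ⟨extVar K l * e, by rwa [mul_assoc], fun m hm => ?_⟩
      rcases List.mem_cons.mp hm with rfl | hm
      · rw [mul_assoc, ← mul_assoc, extVar_mul_self, zero_mul]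
      · rw [mul_assoc, ← mul_assoc, extVar_mul_comm, neg_mul, mul_assoc, h m hm, mul_zero, neg_zero]

theorem eq_zero_of_topCoeff_mul (a : ExtAlg K v) (h : ∀ e, topCoeff K v (e * a) = 0) : a = 0 := by
  by_contra ha
  obtain ⟨e, he, hs⟩ := exists_mul_socle a ha (List.finRange v)
  exact topCoeff_ne_zero_of_socle _ he (fun l => hs l (List.mem_finRange l)) (h e)

theorem extPower_eq_bot {j : ℕ} (hj : v < j) : ⋀[K]^j (Fin v → K) = ⊥ := by
  rw [← Submodule.finrank_eq_zero (R := K), exteriorPower.finrank_eq,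
    Module.finrank_fin_fun, Nat.choose_eq_zero_of_lt hj]

instance : Module.Finite K (ExtAlg K v) := by
  have h1 := (DirectSum.Decomposition.isInternal
    (fun j : ℕ => ⋀[K]^j (Fin v → K))).submodule_iSup_eq_top
  have h2 : (⨆ j : Fin (v + 1), ⋀[K]^(j : ℕ) (Fin v → K)) = ⊤ := by
    rw [eq_top_iff, ← h1]
    refine iSup_le fun j => ?_
    by_cases hj : j < v + 1
    · exact le_iSup (fun j : Fin (v + 1) => ⋀[K]^(j : ℕ) (Fin v → K)) ⟨j, hj⟩
    · rw [extPower_eq_bot (by omega)]; exact bot_le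
  refine ⟨?_⟩
  rw [← h2]
  exact Submodule.fg_iSup _ fun j => Module.Finite.iff_fg.mp exteriorPower.instFinite

/-- The Frobenius property of E: the pairing (e, a) ↦ `topCoeff` (e a) is nondegenerate, and E is
finite-dimensional, so it represents every functional. -/
theorem exists_topCoeff_mul_eq (φ : ExtAlg K v →ₗ[K] K) :
    ∃ a, ∀ e, topCoeff K v (e * a) = φ e := by
  let Φ : ExtAlg K v →ₗ[K] Module.Dual K (ExtAlg K v) :=
    ((LinearMap.mul K (ExtAlg K v)).flip).compr₂ (topCoeff K v)
  have hΦ : ∀ a e, Φ a e = topCoeff K v (e * a) := fun a e => rfl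
  have hinj : Function.Injective Φ := by
    rw [injective_iff_map_eq_zero]
    intro a ha
    refine eq_zero_of_topCoeff_mul a fun e => ?_
    rw [← hΦ, ha]; rfl
  obtain ⟨a, ha⟩ := (LinearMap.injective_iff_surjective_of_finrank_eq_finrank
    Subspace.dual_finrank_eq.symm).mp hinj φ
  exact ⟨a, fun e => by rw [← hΦ, ha]⟩

theorem mul_ι_of_mem {j : ℕ} {a : ExtAlg K v} (ha : a ∈ ⋀[K]^j (Fin v → K)) (l : Fin v) :
    a * extVar K l = (-1 : K) ^ j • (extVar K l * a) := by
  induction ha using Submodule.pow_induction_on_left' with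
  | algebraMap r => simp [Algebra.commutes]
  | add x y i _ _ hx hy => rw [add_mul, hx, hy, mul_add, smul_add]
  | mem_mul m hm i x hx ih =>
    obtain ⟨y, rfl⟩ := hm
    rw [mul_assoc, ih, mul_smul_comm, ← mul_assoc, extVar, eq_neg_of_add_eq_zero_left
      (ExteriorAlgebra.ι_add_mul_swap y (Pi.single l (1 : K))), neg_mul, smul_neg, pow_succ,
      mul_neg_one, neg_smul, mul_assoc]

/-- Only the component of a in the exterior power of order v-1 matters, and e_l passes it with the
sign (-1)^{v-1} = (-1)^{v+1}. -/
theorem topCoeff_mul_extVar (a : ExtAlg K v) (l : Fin v) :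
    topCoeff K v (a * extVar K l) = (-1 : K) ^ (v + 1) * topCoeff K v (extVar K l * a) := by
  induction a using isGradedProj_extGrading.induction with
  | zero => simp
  | mem t a ha =>
    by_cases ht : t + -1 = -v
    · obtain ⟨n, rfl⟩ : ∃ n : ℕ, t = -n := ⟨(-t).toNat, by have := l.pos; omega⟩
      rw [extGrading_neg_natCast] at ha
      have hn : v + 1 = n + 2 := by omega
      rw [mul_ι_of_mem ha, map_smul, smul_eq_mul, hn, pow_add]
      simp
    · rw [topCoeff_eq_zero_of_mem ht (mul_mem_extGrading ha (extVar_mem_extGrading K l)),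
        topCoeff_eq_zero_of_mem (s := -1 + t) (by omega)
          (mul_mem_extGrading (extVar_mem_extGrading K l) ha), mul_zero]
  | add x y hx hy => rw [add_mul, map_add, hx, hy, mul_add, map_add, mul_add]

end Pairing

/-! ### Coordinates in free `E`-modules -/

section Coordinates

variable {K : Type*} [Field K] {v : ℕ} {N : Type*} [AddCommGroup N] [Module K N]
  [Module (ExtAlg K v) N] [IsScalarTower K (ExtAlg K v) N]

theorem basis_induction {I : Type*} (B : Module.Basis I (ExtAlg K v) N) {C : N → Prop}
    (zero : C 0) (add : ∀ x y, C x → C y → C (x + y))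
    (smul : ∀ (a : ExtAlg K v) i, C (a • B i)) (x : N) : C x := by
  rw [← B.linearCombination_repr x]
  induction B.repr x using Finsupp.induction_linear with
  | zero => simpa using zero
  | add f g hf hg => rw [map_add]; exact add _ _ hf hg
  | single i a => rw [Finsupp.linearCombination_single]; exact smul a i

theorem augCoord_smul {I : Type*} (B : Module.Basis I (ExtAlg K v) N) (a : ExtAlg K v) (x : N) :
    augCoord B (a • x) = aug K a • augCoord B x := by
  ext i
  simp [augCoord_apply]

theorem augCoord_self {I : Type*} (B : Module.Basis I (ExtAlg K v) N) (i : I) :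
    augCoord B (B i) = Finsupp.single i 1 := by
  classical
  ext j
  rw [augCoord_apply, B.repr_self, Finsupp.single_apply, Finsupp.single_apply]
  split_ifs <;> simp

/-- The coefficients of `e_l` in the coordinates of an element of a free `E`-module. -/
def linCoord {I : Type*} (B : Module.Basis I (ExtAlg K v) N) (l : Fin v) : N →ₗ[K] I →₀ K :=
  (Finsupp.mapRange.linearMap (linCoeff l)).comp (B.repr.toLinearMap.restrictScalars K)

theorem linCoord_apply {I : Type*} (B : Module.Basis I (ExtAlg K v) N) (l : Fin v) (x : N) (i : I) :
    linCoord B l x i = linCoeff l (B.repr x i) := rfl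

theorem linCoord_extVar_smul {I : Type*} (B : Module.Basis I (ExtAlg K v) N) (l m : Fin v) (x : N) :
    linCoord B l (extVar K m • x) = if l = m then augCoord B x else 0 := by
  ext i
  rw [linCoord_apply, map_smul, Finsupp.smul_apply, smul_eq_mul, linCoeff_extVar_mul]
  split_ifs <;> rfl

theorem linCoord_smul {I : Type*} (B : Module.Basis I (ExtAlg K v) N) (l : Fin v) (a : ExtAlg K v)
    (x : N) (hx : augCoord B x = 0) : linCoord B l (a • x) = aug K a • linCoord B l x := by
  ext i
  have : aug K (B.repr x i) = 0 := by rw [← augCoord_apply, hx]; rfl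
  rw [linCoord_apply, map_smul, Finsupp.smul_apply, smul_eq_mul, linCoeff_mul, this, zero_mul,
    add_zero]
  rfl

/-- Of the sum of the e_m c(a + 1_m), only the summand m = l has e_l-coefficients, and they are the
constant terms of c(a + 1_l). This ties the action of x_l on the Cartan complex to linear parts over
E. -/
theorem linCoord_cartanD {I : Type*} (B : Module.Basis I (ExtAlg K v) N) (l : Fin v)
    (c : (Fin v → ℕ) → N) (a : Fin v → ℕ) :
    linCoord B l (cartanD K N c a) = augCoord B (c (a + Pi.single l 1)) := by
  rw [cartanD_apply, map_sum]
  simp only [linCoord_extVar_smul]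
  simp

theorem repr_pr {I : Type*} (B : Module.Basis I (ExtAlg K v) N) {gr : ℤ → Submodule K N}
    [hgr : SetLike.GradedSMul (extGrading K v) gr] {pr : ℤ → N →ₗ[K] N} (h : IsGradedProj gr pr)
    (deg : I → ℤ) (hdeg : ∀ i, B i ∈ gr (deg i)) (t : ℤ) (x : N) (i : I) :
    B.repr (pr t x) i = extProj K v (t - deg i) (B.repr x i) := by
  have key : ∀ (a : ExtAlg K v) i, pr t (a • B i) = extProj K v (t - deg i) a • B i := by
    intro a i
    have := isGradedProj_extGrading.map_pr h
      ((LinearMap.toSpanSingleton (ExtAlg K v) N (B i)).restrictScalars K) (deg i)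
      (fun s a ha => hgr.smul_mem ha (hdeg i)) (t - deg i) a
    simpa using this.symm
  induction x using basis_induction B with
  | zero => simp
  | add x y hx hy => simp only [map_add, Finsupp.add_apply, hx, hy]
  | smul a j =>
    classical
    rw [key, map_smul, map_smul, B.repr_self, Finsupp.smul_apply, Finsupp.smul_apply,
      Finsupp.single_apply]
    split_ifs with hij
    · subst hij; simp
    · simp

theorem repr_mem {I : Type*} (B : Module.Basis I (ExtAlg K v) N) {gr : ℤ → Submodule K N}
    [hgr : SetLike.GradedSMul (extGrading K v) gr] {pr : ℤ → N →ₗ[K] N} (h : IsGradedProj gr pr)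
    (deg : I → ℤ) (hdeg : ∀ i, B i ∈ gr (deg i)) {t : ℤ} {x : N} (hx : x ∈ gr t) (i : I) :
    B.repr x i ∈ extGrading K v (t - deg i) := by
  rw [← h.eq_self t x hx, repr_pr B h deg hdeg]
  exact isGradedProj_extGrading.mem _ _

theorem augCoord_eq_zero {I : Type*} (B : Module.Basis I (ExtAlg K v) N) {gr : ℤ → Submodule K N}
    [hgr : SetLike.GradedSMul (extGrading K v) gr] {pr : ℤ → N →ₗ[K] N} (h : IsGradedProj gr pr)
    (deg : I → ℤ) (hdeg : ∀ i, B i ∈ gr (deg i)) {t : ℤ} {x : N} (hx : x ∈ gr t) (i : I)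
    (hi : deg i ≠ t) : augCoord B x i = 0 :=
  aug_eq_zero_of_mem (sub_ne_zero.mpr hi.symm) (repr_mem B h deg hdeg hx i)

theorem linCoord_eq_zero {I : Type*} (B : Module.Basis I (ExtAlg K v) N) {gr : ℤ → Submodule K N}
    [hgr : SetLike.GradedSMul (extGrading K v) gr] {pr : ℤ → N →ₗ[K] N} (h : IsGradedProj gr pr)
    (deg : I → ℤ) (hdeg : ∀ i, B i ∈ gr (deg i)) (l : Fin v) {t : ℤ} {x : N} (hx : x ∈ gr t) (i : I)
    (hi : deg i ≠ t + 1) : linCoord B l x i = 0 :=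
  linCoeff_eq_zero_of_mem (by omega) l (repr_mem B h deg hdeg hx i)

/-- `c` is an element of `Hom_K(S, N)` whose values lie in degree `p` and that is concentrated on
the monomials of degree `q`. -/
def IsHomog (gr : ℤ → Submodule K N) (q p : ℤ) (c : (Fin v → ℕ) → N) : Prop :=
  ∀ a, c a ∈ gr p ∧ (c a ≠ 0 → ∑ l, (a l : ℤ) = q)

open Classical in
/-- The projection onto the homogeneous elements of `Hom_K(S, N)`. -/
def homogProj (pr : ℤ → N →ₗ[K] N) (q p : ℤ) (c : (Fin v → ℕ) → N) : (Fin v → ℕ) → N :=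
  fun a => if ∑ l, (a l : ℤ) = q then pr p (c a) else 0

theorem isHomog_homogProj {gr : ℤ → Submodule K N} {pr : ℤ → N →ₗ[K] N} (h : IsGradedProj gr pr)
    (q p : ℤ) (c : (Fin v → ℕ) → N) : IsHomog gr q p (homogProj pr q p c) := by
  intro a
  rw [homogProj]
  split_ifs with ha
  · exact ⟨h.mem _ _, fun _ => ha⟩
  · exact ⟨zero_mem _, fun h => absurd rfl h⟩

theorem homogProj_of_isHomog {gr : ℤ → Submodule K N} {pr : ℤ → N →ₗ[K] N} (h : IsGradedProj gr pr)
    {q p : ℤ} {c : (Fin v → ℕ) → N} (hc : IsHomog gr q p c) : homogProj pr q p c = c := by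
  funext a
  rw [homogProj]
  split_ifs with ha
  · exact h.eq_self _ _ (hc a).1
  · by_contra h'
    exact ha ((hc a).2 (Ne.symm h'))

theorem sum_add_single (a : Fin v → ℕ) (l : Fin v) :
    ∑ i, ((a + Pi.single l 1 : Fin v → ℕ) i : ℤ) = ∑ i, (a i : ℤ) + 1 := by
  simp [Finset.sum_add_distrib, Pi.single_apply]

theorem cartanD_homogProj {gr : ℤ → Submodule K N} [hgr : SetLike.GradedSMul (extGrading K v) gr]
    {pr : ℤ → N →ₗ[K] N} (h : IsGradedProj gr pr) (q p : ℤ) (c : (Fin v → ℕ) → N) :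
    cartanD K N (homogProj pr q p c) = homogProj pr (q - 1) (p - 1) (cartanD K N c) := by
  funext a
  have h1 : ∀ (l : Fin v) x, extVar K l • pr p x = pr (p - 1) (extVar K l • x) := fun l x => by
    have := h.map_pr h (Algebra.lsmul K K N (extVar K l)) (-1)
      (fun t x hx => extVar_smul_mem gr l (show t = t + -1 + 1 by ring) hx) p x
    exact this
  simp only [cartanD_apply, homogProj, sum_add_single]
  by_cases ha : ∑ l, (a l : ℤ) = q - 1
  · rw [if_pos ha, map_sum]
    refine Finset.sum_congr rfl fun l _ => ?_
    rw [if_pos (by omega), h1]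
  · rw [if_neg ha]
    refine Finset.sum_eq_zero fun l _ => ?_
    rw [if_neg (by omega), smul_zero]

theorem homogProj_comp {N' : Type*} [AddCommGroup N'] [Module K N'] [Module (ExtAlg K v) N']
    [IsScalarTower K (ExtAlg K v) N'] {gr : ℤ → Submodule K N} {gr' : ℤ → Submodule K N'}
    {pr : ℤ → N →ₗ[K] N} {pr' : ℤ → N' →ₗ[K] N'} (h : IsGradedProj gr pr)
    (h' : IsGradedProj gr' pr') (f : N →ₗ[ExtAlg K v] N') (hf : ∀ t, ∀ x ∈ gr t, f x ∈ gr' t)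
    (q p : ℤ) (c : (Fin v → ℕ) → N) (a : Fin v → ℕ) :
    f (homogProj pr q p c a) = homogProj pr' q p (fun a => f (c a)) a := by
  have := h.map_pr h' (f.restrictScalars K) 0 (by simpa using hf) p (c a)
  rw [homogProj, homogProj]
  split_ifs
  · simpa using this
  · exact map_zero f

end Coordinates

/-- Dependent choice in types that vary with m; the invariant Q guarantees that the next step can be
made. -/
theorem exists_seq {X : ℕ → Type*} (Q : ∀ m, X m → Prop) (r : ∀ m, X m → X (m + 1) → Prop)
    (x0 : X 0) (h0 : Q 0 x0) (hs : ∀ m x, Q m x → ∃ x', Q (m + 1) x' ∧ r m x x') :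
    ∃ x : ∀ m, X m, x 0 = x0 ∧ ∀ m, r m (x m) (x (m + 1)) := by
  choose f hf hr using hs
  let s : ∀ m, {x : X m // Q m x} := fun m =>
    Nat.rec ⟨x0, h0⟩ (fun m x => ⟨f m x.1 x.2, hf m x.1 x.2⟩) m
  exact ⟨fun m => (s m).1, rfl, fun m => hr m (s m).1 (s m).2⟩

/-! ### The Cartan homology of a module and its minimal free resolution -/

namespace GradedFreeComplex

universe u w

variable {K : Type*} [Field K] {v : ℕ} (F : GradedFreeComplex.{u, w} K v)

/-- The differential `F^{-(m+1)} → F^{-m}`. -/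
def dNeg (m : ℕ) : F.X (-((m + 1 : ℕ) : ℤ)) →ₗ[ExtAlg K v] F.X (-(m : ℤ)) :=
  F.d (by push_cast; ring)

theorem exists_deg (k : ℤ) : ∃ deg : F.I k → ℤ, ∀ i, F.basis k i ∈ F.gr k (deg i) :=
  ⟨fun i => (F.basis_homogeneous k i).choose, fun i => (F.basis_homogeneous k i).choose_spec⟩

/-- The degrees of the chosen basis elements. -/
def deg (k : ℤ) : F.I k → ℤ := (F.exists_deg k).choose

theorem basis_mem (k : ℤ) (i : F.I k) : F.basis k i ∈ F.gr k (F.deg k i) :=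
  (F.exists_deg k).choose_spec i

instance (k : ℤ) : SetLike.GradedSMul (extGrading K v) (F.gr k) := F.gradedSMul k

/-- The projections onto the graded components of the terms. -/
def pr (k : ℤ) : ℤ → F.X k →ₗ[K] F.X k := (exists_isGradedProj (F.isInternal k)).choose

theorem isGradedProj (k : ℤ) : IsGradedProj (F.gr k) (F.pr k) :=
  (exists_isGradedProj (F.isInternal k)).choose_spec

variable {F}

theorem IsMinimal.augCoord_d (hmin : F.IsMinimal) {k l : ℤ} (h : k + 1 = l) (x : F.X k) :
    augCoord (F.basis l) (F.d h x) = 0 := by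
  induction x using basis_induction (F.basis k) with
  | zero => simp
  | add x y hx hy => rw [map_add, map_add, hx, hy, add_zero]
  | smul a i =>
    rw [map_smul, augCoord_smul]
    have : augCoord (F.basis l) (F.d h (F.basis k i)) = 0 := by
      ext j
      exact hmin h i j
    rw [this, smul_zero]

variable (F)

/-- The matrix of coefficients of `e_m` in the linear part of the differential. -/
def linPart {k l : ℤ} (h : k + 1 = l) (m : Fin v) : (F.I k →₀ K) →ₗ[K] (F.I l →₀ K) :=
  Finsupp.linearCombination K fun i => linCoord (F.basis l) m (F.d h (F.basis k i))

theorem linPart_single {k l : ℤ} (h : k + 1 = l) (m : Fin v) (i : F.I k) :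
    F.linPart h m (Finsupp.single i 1) = linCoord (F.basis l) m (F.d h (F.basis k i)) := by
  rw [linPart, Finsupp.linearCombination_single, one_smul]

variable {F}

/-- Matrix entries have no constant term, so a coefficient in the augmentation ideal contributes
only in order at least two. The linear coefficients of dx therefore depend on x only modulo that
ideal. -/
theorem IsMinimal.linCoord_d (hmin : F.IsMinimal) {k l : ℤ} (h : k + 1 = l) (m : Fin v)
    (x : F.X k) :
    linCoord (F.basis l) m (F.d h x) = F.linPart h m (augCoord (F.basis k) x) := by
  induction x using basis_induction (F.basis k) with
  | zero => simp
  | add x y hx hy => simp only [map_add, hx, hy]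
  | smul a i =>
    rw [map_smul, linCoord_smul _ _ _ _ (hmin.augCoord_d h _), augCoord_smul, map_smul,
      augCoord_self, linPart_single]

section Resolution

variable {P : Type*} [AddCommGroup P] [Module K P] [Module (ExtAlg K v) P]
  [IsScalarTower K (ExtAlg K v) P] {𝒬 : ℤ → Submodule K P}
  {π : F.X 0 →ₗ[ExtAlg K v] P}

/-- The augmentation, with source `F^{-0}`. -/
def augNeg (π : F.X 0 →ₗ[ExtAlg K v] P) : F.X (-((0 : ℕ) : ℤ)) →ₗ[ExtAlg K v] P := π

theorem IsResolution.exists_dNeg (hF : F.IsResolution 𝒬 π) (m : ℕ)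
    (x : F.X (-((m + 1 : ℕ) : ℤ))) (hx : F.dNeg m x = 0) : ∃ y, F.dNeg (m + 1) y = x :=
  (hF.exact (-((m + 1 + 1 : ℕ) : ℤ)) (-((m + 1 : ℕ) : ℤ)) (-(m : ℤ)) (by push_cast; ring)
    (by push_cast; ring) (by push_cast; omega) x).mp hx

theorem IsResolution.exists_dNeg_zero (hF : F.IsResolution 𝒬 π) (x : F.X (-((0 : ℕ) : ℤ)))
    (hx : augNeg π x = 0) : ∃ y, F.dNeg 0 y = x :=
  (hF.aug_exact x).mp hx

theorem IsResolution.augNeg_dNeg (hF : F.IsResolution 𝒬 π) (x : F.X (-((0 + 1 : ℕ) : ℤ))) :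
    augNeg π (F.dNeg 0 x) = 0 :=
  (hF.aug_exact _).mpr ⟨x, rfl⟩

/-- Solving `d y_{m+1} = φ_m + s D y_m` for increasing `m`. -/
theorem IsResolution.exists_ascending (hF : F.IsResolution 𝒬 π) (s : K)
    (φ : ∀ m : ℕ, (Fin v → ℕ) → F.X (-(m : ℤ)))
    (hφ : ∀ m a, F.dNeg m (φ (m + 1) a) = -(s • cartanD K _ (φ m) a))
    (y0 : (Fin v → ℕ) → F.X (-((0 : ℕ) : ℤ)))
    (h0 : ∀ a, augNeg π (φ 0 a + s • cartanD K _ y0 a) = 0) :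
    ∃ y : ∀ m : ℕ, (Fin v → ℕ) → F.X (-(m : ℤ)), y 0 = y0 ∧
      ∀ m a, F.dNeg m (y (m + 1) a) = φ m a + s • cartanD K _ (y m) a := by
  -- The invariant is solvability of the next equation. The parameters serve two purposes: s = 1, φ
  -- = 0 produces a zigzag over a cycle, while s = -1 produces y with φ = dy + Dy, a null-homotopy
  -- of the zigzag φ.
  refine exists_seq (X := fun m : ℕ => (Fin v → ℕ) → F.X (-(m : ℤ)))
    (fun m y => ∀ a, ∃ z, F.dNeg m z = φ m a + s • cartanD K _ y a)
    (fun m y y' => ∀ a, F.dNeg m (y' a) = φ m a + s • cartanD K _ y a) y0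
    (fun a => hF.exists_dNeg_zero _ (h0 a)) ?_
  intro m y hy
  choose y' hy' using hy
  refine ⟨y', fun a => hF.exists_dNeg _ _ ?_, hy'⟩
  have h1 := congrFun (cartanD_comp (F.dNeg m) y') a
  rw [map_add, hφ, LinearMap.map_smul_of_tower, ← h1]
  have h2 : (fun a => F.dNeg m (y' a)) = φ m + s • cartanD K _ y := funext hy'
  rw [h2, map_add, map_smul, cartanD_cartanD, smul_zero, add_zero, neg_add_cancel]

/-- Solving `D y_m = φ_m + s d y_{m+1}` for decreasing `m < n`. -/
theorem IsMinimal.exists_descending (hmin : F.IsMinimal) (s : K)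
    (φ : ∀ m : ℕ, (Fin v → ℕ) → F.X (-(m : ℤ)))
    (hφ : ∀ m a, cartanD K _ (φ m) a = -(s • F.dNeg m (φ (m + 1) a))) (n : ℕ)
    (haug : ∀ m < n, augCoord (F.basis _) (φ m 0) = 0)
    (yn : (Fin v → ℕ) → F.X (-(n : ℤ)))
    (hn : ∀ (l : ℤ) (h : -(n : ℤ) + 1 = l) a, F.d h (cartanD K _ yn a - φ n a) = 0) :
    ∃ y : ∀ m : ℕ, (Fin v → ℕ) → F.X (-(m : ℤ)), y n = yn ∧
      ∀ m < n, ∀ a, cartanD K _ (y m) a = φ m a + s • F.dNeg m (y (m + 1) a) := by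
  induction n with
  | zero =>
    exact ⟨Function.update 0 0 yn, Function.update_self _ _ _, fun m hm => absurd hm (by omega)⟩
  | succ n ih =>
    -- The right-hand side for m = n. It is a Cartan cycle by `hn`, and its constant term is zero
    -- modulo the augmentation ideal by `haug` and minimality, so `cartan_exact` applies.
    let g : (Fin v → ℕ) → F.X (-(n : ℤ)) := fun a => φ n a + s • F.dNeg n (yn a)
    have hg : cartanD K _ g = 0 := by
      have e : g = φ n + s • fun a => F.dNeg n (yn a) := rfl
      rw [e, map_add, map_smul, cartanD_comp]
      funext a
      have h1 : F.dNeg n (cartanD K _ yn a - φ (n + 1) a) = 0 := hn _ _ a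
      rw [map_sub, sub_eq_zero] at h1
      rw [Pi.add_apply, Pi.smul_apply, hφ, h1]
      exact neg_add_cancel _
    have hg0 : augCoord (F.basis _) (g 0) = 0 := by
      change augCoord (F.basis _) (φ n 0 + s • F.dNeg n (yn 0)) = 0
      rw [map_add, map_smul, haug n (Nat.lt_succ_self n), dNeg, hmin.augCoord_d, smul_zero, add_zero]
    obtain ⟨z, hz⟩ := cartan_exact _ g hg hg0
    obtain ⟨y, hy, hy'⟩ := ih (fun m hm => haug m (Nat.lt_succ_of_lt hm)) z (fun l h a => by
      obtain rfl | ⟨n, rfl⟩ : n = 0 ∨ ∃ k, n = k + 1 := by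
        cases n with
        | zero => exact Or.inl rfl
        | succ n => exact Or.inr ⟨n, rfl⟩
      all_goals
        have e : cartanD K _ z a - φ _ a = s • F.dNeg _ (yn a) := by
          rw [hz]; exact add_sub_cancel_left _ _
        rw [e, LinearMap.map_smul_of_tower, dNeg, F.d_comp_d, smul_zero])
    refine ⟨Function.update y (n + 1) yn, Function.update_self _ _ _, fun m hm a => ?_⟩
    rw [Function.update_of_ne (by omega)]
    rcases Nat.lt_succ_iff_lt_or_eq.mp hm with h | rfl
    · rw [Function.update_of_ne (by omega), hy' m h]
    · rw [Function.update_self, hy, hz]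

end Resolution

end GradedFreeComplex

/-! ### Zigzags in `Hom_K(S, F)`: Cartan homology of P and F ⊗_E K -/

namespace GradedFreeComplex

universe u w

variable {K : Type*} [Field K] {v : ℕ} {F : GradedFreeComplex.{u, w} K v}
  {P : Type*} [AddCommGroup P] [Module K P] [Module (ExtAlg K v) P]
  [IsScalarTower K (ExtAlg K v) P] {𝒬 : ℤ → Submodule K P}
  {π : F.X 0 →ₗ[ExtAlg K v] P}

/-- The relation between cycles `w ∈ Hom_K(S, P)` of degree `i` with values in `P_p` and
elements `u` of `F^{-i} ⊗_E K`, given by the zigzags in the double complex `Hom_K(S, F)`. -/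
def ResRel (π : F.X 0 →ₗ[ExtAlg K v] P) (i : ℕ) (p : ℤ) (w : (Fin v → ℕ) → P)
    (u : F.I (-(i : ℤ)) →₀ K) : Prop :=
  ∃ c : ∀ m : ℕ, (Fin v → ℕ) → F.X (-(m : ℤ)),
    (∀ m : ℕ, IsHomog (F.gr _) (i - m) (p - m) (c m)) ∧
    (∀ m a, cartanD K _ (c m) a = F.dNeg m (c (m + 1) a)) ∧
    (∀ a, augNeg π (c 0 a) = w a) ∧ augCoord (F.basis _) (c i 0) = u

theorem IsHomog_add {N : Type*} [AddCommGroup N] [Module K N] {gr : ℤ → Submodule K N} {q p : ℤ}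
    {c c' : (Fin v → ℕ) → N} (h : IsHomog gr q p c) (h' : IsHomog gr q p c') :
    IsHomog gr q p (c + c') := by
  refine fun a => ⟨add_mem (h a).1 (h' a).1, fun ha => ?_⟩
  by_contra hq
  exact ha (by rw [Pi.add_apply, not_not.mp (mt (h a).2 hq), not_not.mp (mt (h' a).2 hq), add_zero])

theorem IsHomog_smul {N : Type*} [AddCommGroup N] [Module K N] {gr : ℤ → Submodule K N} {q p : ℤ}
    {c : (Fin v → ℕ) → N} (h : IsHomog gr q p c) (k : K) : IsHomog gr q p (k • c) := by
  refine fun a => ⟨Submodule.smul_mem _ _ (h a).1, fun ha => (h a).2 fun h0 => ha ?_⟩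
  rw [Pi.smul_apply, h0, smul_zero]

theorem isHomog_comp {N N' : Type*} [AddCommGroup N] [Module K N] {gr : ℤ → Submodule K N}
    [AddCommGroup N'] [Module K N'] {gr' : ℤ → Submodule K N'} {q p : ℤ}
    {c : (Fin v → ℕ) → N} (h : IsHomog gr q p c) (f : N → N') (h0 : f 0 = 0)
    (hf : ∀ x ∈ gr p, f x ∈ gr' p) : IsHomog gr' q p (fun a => f (c a)) :=
  fun a => ⟨hf _ (h a).1, fun ha => (h a).2 fun h' => ha (by change f (c a) = 0; rw [h', h0])⟩

theorem isHomog_cartanX {N : Type*} [AddCommGroup N] [Module K N] {gr : ℤ → Submodule K N}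
    {q p : ℤ} {c : (Fin v → ℕ) → N} (h : IsHomog gr q p c) (l : Fin v) :
    IsHomog gr (q - 1) p (cartanX l c) :=
  fun a => ⟨(h _).1, fun ha => by have := (h _).2 ha; rw [sum_add_single] at this; omega⟩

theorem eq_zero_of_isHomog_of_neg {N : Type*} [AddCommGroup N] [Module K N]
    {gr : ℤ → Submodule K N} {q p : ℤ} (hq : q < 0) {c : (Fin v → ℕ) → N} (h : IsHomog gr q p c) :
    c = 0 := by
  funext a
  by_contra ha
  have := (h a).2 ha
  have : 0 ≤ ∑ l, (a l : ℤ) := Finset.sum_nonneg fun l _ => by positivity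
  omega

theorem eq_zero_at_zero_of_isHomog {N : Type*} [AddCommGroup N] [Module K N]
    {gr : ℤ → Submodule K N} {q p : ℤ} (hq : q ≠ 0) {c : (Fin v → ℕ) → N} (h : IsHomog gr q p c) :
    c 0 = 0 := by
  by_contra ha
  have := (h 0).2 ha
  simp at this
  omega

namespace ResRel

variable {i : ℕ} {p : ℤ} {w w' : (Fin v → ℕ) → P} {u u' : F.I (-(i : ℤ)) →₀ K}

theorem add (h : ResRel π i p w u) (h' : ResRel π i p w' u') :
    ResRel π i p (w + w') (u + u') := by
  obtain ⟨c, h1, h2, h3, h4⟩ := h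
  obtain ⟨c', h1', h2', h3', h4'⟩ := h'
  refine ⟨c + c', fun m => IsHomog_add (h1 m) (h1' m), fun m a => ?_, fun a => ?_, ?_⟩
  · rw [Pi.add_apply, map_add, Pi.add_apply, h2, h2', Pi.add_apply, Pi.add_apply, map_add]
  · rw [Pi.add_apply, Pi.add_apply, map_add, h3, h3', Pi.add_apply]
  · rw [Pi.add_apply, Pi.add_apply, map_add, h4, h4']

theorem smul (h : ResRel π i p w u) (k : K) : ResRel π i p (k • w) (k • u) := by
  obtain ⟨c, h1, h2, h3, h4⟩ := h
  refine ⟨k • c, fun m => IsHomog_smul (h1 m) k, fun m a => ?_, fun a => ?_, ?_⟩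
  · rw [Pi.smul_apply, map_smul, Pi.smul_apply, h2, Pi.smul_apply, Pi.smul_apply,
      LinearMap.map_smul_of_tower]
  · rw [Pi.smul_apply, Pi.smul_apply, LinearMap.map_smul_of_tower, h3, Pi.smul_apply]
  · rw [Pi.smul_apply, Pi.smul_apply, map_smul, h4]

/-- Shifting a zigzag by x_l moves its end to level i, with constant term c_i(1_l). This is the
e_l-coefficient of (D c_i)(0) = d c_{i+1}(0), which by minimality is the linear part of d applied to
u. -/
theorem cartanX (hmin : F.IsMinimal) {u : F.I (-((i + 1 : ℕ) : ℤ)) →₀ K}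
    (h : ResRel π (i + 1) p w u) (l : Fin v)
    (hk : -((i + 1 : ℕ) : ℤ) + 1 = -(i : ℤ)) :
    ResRel π i p (cartanX l w) (F.linPart hk l u) := by
  obtain ⟨c, h1, h2, h3, h4⟩ := h
  refine ⟨fun m => BGG.cartanX l (c m), fun m => ?_, fun m a => ?_, fun a => h3 _, ?_⟩
  · have := isHomog_cartanX (h1 m) l
    convert this using 1
    push_cast; ring
  · rw [cartanD_cartanX]; exact h2 m _
  · rw [← h4, ← hmin.linCoord_d hk]
    have := congrArg (linCoord (F.basis _) l) (h2 i 0)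
    rw [linCoord_cartanD] at this
    exact this

theorem apply_eq_zero (h : ResRel π i p w u) (b : F.I (-(i : ℤ))) (hb : F.deg _ b ≠ p - i) :
    u b = 0 := by
  obtain ⟨c, h1, h2, h3, rfl⟩ := h
  exact augCoord_eq_zero _ (F.isGradedProj _) _ (F.basis_mem _) (h1 i 0).1 b hb

theorem isHomog (hF : F.IsResolution 𝒬 π) (h : ResRel π i p w u) : IsHomog 𝒬 i p w := by
  obtain ⟨c, h1, h2, h3, rfl⟩ := h
  have := isHomog_comp (gr' := 𝒬) (h1 0) (augNeg π) (map_zero _) (fun x hx => hF.aug_mem _ x hx)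
  simp only [h3] at this
  simpa using this

theorem cartanD_eq_zero (hF : F.IsResolution 𝒬 π) (h : ResRel π i p w u) : cartanD K P w = 0 := by
  obtain ⟨c, h1, h2, h3, rfl⟩ := h
  have := cartanD_comp (K := K) (augNeg π) (c 0)
  rw [funext h3] at this
  rw [this]
  funext a
  rw [h2]
  exact hF.augNeg_dNeg _

/-- A lift of w' to F^0 extends to y with c_i = d y_{i+1} + D y_i. Both summands vanish modulo the
augmentation ideal, the first by minimality. -/
theorem eq_zero_of_boundary (hmin : F.IsMinimal) (hF : F.IsResolution 𝒬 π)
    (h : ResRel π i p w u) (hw : ∃ w', cartanD K P w' = w) : u = 0 := by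
  obtain ⟨c, h1, h2, h3, rfl⟩ := h
  obtain ⟨w', rfl⟩ := hw
  choose y0 hy0 using fun a => hF.aug_surjective (w' a)
  obtain ⟨y, rfl, hy⟩ := hF.exists_ascending (-1) c
    (fun m a => by rw [← h2, neg_one_smul, neg_neg]) y0 (fun a => by
      have h4 : augNeg π (cartanD K _ y0 a) = cartanD K P w' a := by
        have := congrFun (cartanD_comp (K := K) (augNeg π) y0) a
        rw [← this, show (fun a => augNeg π (y0 a)) = w' from funext hy0]
      rw [map_add, h3, LinearMap.map_smul_of_tower, h4, neg_one_smul, add_neg_cancel])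
  have : c i 0 = F.dNeg i (y (i + 1) 0) + cartanD K _ (y i) 0 := by
    rw [hy, neg_one_smul, neg_add_cancel_right]
  rw [this, map_add, augCoord_cartanD, dNeg, hmin.augCoord_d, add_zero]

/-- The obstruction to descending is the constant term of c_m modulo the augmentation ideal. For m <
i it vanishes since c_m lives on monomials of positive degree i-m, and for m = i since u = 0. Above
level i the zigzag is zero, so the descent may start with zero. -/
theorem boundary (hmin : F.IsMinimal) (hF : F.IsResolution 𝒬 π)
    (h : ResRel π i p w 0) : ∃ w', cartanD K P w' = w := by
  obtain ⟨c, h1, h2, h3, h4⟩ := h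
  have hc : c (i + 1) = 0 := eq_zero_of_isHomog_of_neg (by push_cast; omega) (h1 (i + 1))
  obtain ⟨y, hyn, hy⟩ := hmin.exists_descending (-1) c
    (fun m a => by rw [← h2, neg_one_smul, neg_neg]) (i + 1) (fun m hm => by
      by_cases hmi : m = i
      · subst hmi; exact h4
      · rw [eq_zero_at_zero_of_isHomog (by omega) (h1 m), map_zero]) 0 (fun l h a => by
        rw [hc]; simp)
  refine ⟨fun a => augNeg π (y 0 a), ?_⟩
  rw [cartanD_comp]
  funext a
  rw [hy 0 (Nat.succ_pos i), map_add, LinearMap.map_smul_of_tower, hF.augNeg_dNeg, smul_zero,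
    add_zero, h3]

end ResRel

/-- Homogeneous projections commute with both differentials. Beyond level i the monomial degree
would be negative, so nothing needs to be assumed there. -/
theorem homogProj_zigzag (hF : F.IsResolution 𝒬 π)
    {prP : ℤ → P →ₗ[K] P} (hP : IsGradedProj 𝒬 prP) {i : ℕ} {p : ℤ}
    {c : ∀ m : ℕ, (Fin v → ℕ) → F.X (-(m : ℤ))} (h2 : ∀ m < i, ∀ a, cartanD K _ (c m) a = F.dNeg m (c (m + 1) a)) :
    ResRel π i p (homogProj prP i p fun a => augNeg π (c 0 a))
      (augCoord (F.basis _) (F.pr _ (p - i) (c i 0))) := by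
  let c' : ∀ m : ℕ, (Fin v → ℕ) → F.X (-(m : ℤ)) := fun m => homogProj (F.pr _) (i - m) (p - m) (c m)
  have hc' : ∀ m : ℕ, IsHomog (F.gr _) (i - m) (p - m) (c' m) := fun m : ℕ =>
    isHomog_homogProj (F.isGradedProj _) _ _ _
  refine ⟨c', hc', fun m a => ?_, fun a => ?_, ?_⟩
  · rcases lt_or_ge m i with hm | hm
    · have e1 : cartanD K _ (c' m) a = _ :=
        congrFun (cartanD_homogProj (F.isGradedProj _) (i - m) (p - m) (c m)) a
      have e2 := homogProj_comp (F.isGradedProj _) (F.isGradedProj _) (F.dNeg m)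
        (fun t x hx => F.d_mem _ t x hx) (i - m - 1) (p - m - 1) (c (m + 1)) a
      have e3 : c' (m + 1) = homogProj (F.pr _) (i - m - 1) (p - m - 1) (c (m + 1)) := by
        change homogProj (F.pr _) (i - (m + 1 : ℕ)) (p - (m + 1 : ℕ)) (c (m + 1)) = _
        congr 1 <;> push_cast <;> ring
      rw [e1, e3, e2]
      congr 1
      exact funext (h2 m hm)
    · have e : c' (m + 1) = 0 :=
        eq_zero_of_isHomog_of_neg (by push_cast; omega) (hc' (m + 1))
      rw [e, Pi.zero_apply, map_zero, cartanD_apply]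
      refine Finset.sum_eq_zero fun l _ => ?_
      have : c' m (a + Pi.single l 1) = 0 := by
        by_contra h
        have := (hc' m _).2 h
        rw [sum_add_single] at this
        have : 0 ≤ ∑ l, (a l : ℤ) := Finset.sum_nonneg fun l _ => by positivity
        omega
      rw [this, smul_zero]
  · have := homogProj_comp (F.isGradedProj _) hP (augNeg π)
      (fun t x hx => hF.aug_mem t x hx) (i - (0 : ℕ)) (p - (0 : ℕ)) (c 0) a
    rw [this]
    simp
  · change augCoord _ (homogProj (F.pr _) (i - i) (p - i) (c i) 0) = _
    rw [homogProj, if_pos (by simp)]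

theorem exists_resRel_right (hF : F.IsResolution 𝒬 π)
    {prP : ℤ → P →ₗ[K] P} (hP : IsGradedProj 𝒬 prP) {i : ℕ} {p : ℤ} {w : (Fin v → ℕ) → P}
    (hw : IsHomog 𝒬 i p w) (hD : cartanD K P w = 0) : ∃ u, ResRel π i p w u := by
  choose c0 hc0 using fun a => hF.aug_surjective (w a)
  obtain ⟨c, rfl, hc⟩ := hF.exists_ascending (1 : K) 0 (fun m a => by simp [cartanD]) c0 (fun a => by
    have := congrFun (cartanD_comp (K := K) (augNeg π) c0) a
    rw [show (fun a => augNeg π (c0 a)) = w from funext hc0, hD] at this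
    rw [one_smul, Pi.zero_apply, Pi.zero_apply, zero_add, ← this]
    rfl)
  have := homogProj_zigzag hF hP (i := i) (p := p) (c := c) (fun m _ a => by
    rw [hc]; simp)
  rw [show (fun a => augNeg π (c 0 a)) = w from funext hc0, homogProj_of_isHomog hP hw] at this
  exact ⟨_, this⟩

theorem exists_resRel_left (hmin : F.IsMinimal) (hF : F.IsResolution 𝒬 π)
    {prP : ℤ → P →ₗ[K] P} (hP : IsGradedProj 𝒬 prP) {i : ℕ} {p : ℤ} (b : F.I (-(i : ℤ)))
    (hb : F.deg _ b = p - i) : ∃ w, ResRel π i p w (Finsupp.single b 1) := by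
  classical
  -- The zigzag starts with the generator placed at the constant monomial. This is a cycle because
  -- no a + 1_l is zero.
  let ci : (Fin v → ℕ) → F.X (-(i : ℤ)) := fun a => if a = 0 then F.basis _ b else 0
  have hci : cartanD K _ ci = 0 := by
    funext a
    rw [cartanD_apply]
    refine Finset.sum_eq_zero fun l _ => ?_
    have : a + Pi.single l 1 ≠ 0 := fun h => by simpa using congrFun h l
    simp only [ci, if_neg this, smul_zero]
  obtain ⟨c, hcn, hc⟩ := hmin.exists_descending (1 : K) 0 (fun m a => by simp) i
    (fun m hm => by simp) ci (fun l h a => by rw [hci]; simp)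
  have := homogProj_zigzag hF hP (i := i) (p := p) (c := c) (fun m hm a => by
    rw [hc m hm]; simp)
  rw [hcn, show ci 0 = F.basis _ b from if_pos rfl, ← hb,
    (F.isGradedProj _).eq_self _ _ (F.basis_mem _ b), augCoord_self] at this
  exact ⟨_, this⟩

end GradedFreeComplex

/-! ### Laurent polynomials with coefficients in an `E`-module -/

section Laurent

variable {K : Type*} [Field K] {v : ℕ} {P : Type*} [AddCommGroup P] [Module K P]
  [Module (ExtAlg K v) P] [IsScalarTower K (ExtAlg K v) P]

/-- Multiplication by the Laurent monomial `x^b`. -/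
def laurShift (b : Fin v → ℤ) (c : (Fin v → ℤ) → P) : (Fin v → ℤ) → P := fun a => c (a - b)

theorem laurShift_apply (b : Fin v → ℤ) (c : (Fin v → ℤ) → P) (a : Fin v → ℤ) :
    laurShift b c a = c (a - b) := rfl

theorem laurShift_zero (c : (Fin v → ℤ) → P) : laurShift 0 c = c := by
  funext a; rw [laurShift_apply, sub_zero]

theorem laurShift_laurShift (b b' : Fin v → ℤ) (c : (Fin v → ℤ) → P) :
    laurShift b (laurShift b' c) = laurShift (b + b') c := by
  funext a; simp only [laurShift_apply, sub_sub]

variable (K) in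
/-- The differential `∑ x_l ⊗ e_l` on Laurent polynomials. -/
def laurD : ((Fin v → ℤ) → P) →ₗ[K] ((Fin v → ℤ) → P) where
  toFun c a := ∑ l, extVar K l • c (a - Pi.single l 1)
  map_add' c c' := by ext a; simp [Finset.sum_add_distrib]
  map_smul' k c := by
    ext a
    simp only [Pi.smul_apply, RingHom.id_apply, Finset.smul_sum]
    exact Finset.sum_congr rfl fun l _ => smul_comm _ _ _

theorem laurD_apply (c : (Fin v → ℤ) → P) (a : Fin v → ℤ) :
    laurD K c a = ∑ l, extVar K l • c (a - Pi.single l 1) := rfl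

theorem laurD_laurD (c : (Fin v → ℤ) → P) : laurD K (laurD K c) = 0 := by
  ext a
  simp only [laurD_apply, Finset.smul_sum, smul_smul, Pi.zero_apply]
  refine sum_sum_alternating _ (fun i => ?_) (fun i j => ?_)
  · rw [extVar_mul_self, zero_smul]
  · rw [extVar_mul_comm, neg_smul, sub_right_comm]

theorem laurD_laurShift (b : Fin v → ℤ) (c : (Fin v → ℤ) → P) :
    laurD K (laurShift b c) = laurShift b (laurD K c) := by
  ext a
  simp only [laurD_apply, laurShift_apply, sub_right_comm]

/-- The Laurent polynomials in `S_{x_A} ⊗ P_p`. -/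
structure IsLaurent (𝒬 : ℤ → Submodule K P) (A : Finset (Fin v)) (p : ℤ)
    (c : (Fin v → ℤ) → P) : Prop where
  finite : {a | c a ≠ 0}.Finite
  nonneg : ∀ a, c a ≠ 0 → ∀ l ∉ A, 0 ≤ a l
  mem : ∀ a, c a ∈ 𝒬 p

/-- All monomials of a Laurent polynomial with coefficients in degree `p` have total degree in
`Γ`. -/
def DegIn (Γ : ℤ → Prop) (p : ℤ) (c : (Fin v → ℤ) → P) : Prop :=
  ∀ a, c a ≠ 0 → Γ (∑ l, a l + p)

variable {𝒬 : ℤ → Submodule K P} {A B : Finset (Fin v)} {p : ℤ} {c c' : (Fin v → ℤ) → P}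
  {Γ : ℤ → Prop}

theorem isLaurent_zero : IsLaurent 𝒬 A p (0 : (Fin v → ℤ) → P) :=
  ⟨by simp, fun a h => absurd rfl h, fun _ => zero_mem _⟩

theorem degIn_zero : DegIn Γ p (0 : (Fin v → ℤ) → P) := fun _ h => absurd rfl h

theorem IsLaurent.add (h : IsLaurent 𝒬 A p c) (h' : IsLaurent 𝒬 A p c') :
    IsLaurent 𝒬 A p (c + c') where
  finite := (h.finite.union h'.finite).subset fun a ha => by
    by_contra hn
    simp only [Set.mem_union, Set.mem_ofPred_eq, not_or, not_not] at hn
    exact ha (by rw [Pi.add_apply, hn.1, hn.2, add_zero])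
  nonneg a ha := by
    by_cases hc : c a = 0
    · exact h'.nonneg a (by simpa [hc] using ha)
    · exact h.nonneg a hc
  mem a := add_mem (h.mem a) (h'.mem a)

theorem DegIn.add (h : DegIn Γ p c) (h' : DegIn Γ p c') : DegIn Γ p (c + c') := by
  intro a ha
  by_cases hc : c a = 0
  · exact h' a (by simpa [hc] using ha)
  · exact h a hc

theorem IsLaurent.smul (h : IsLaurent 𝒬 A p c) (k : K) : IsLaurent 𝒬 A p (k • c) where
  finite := h.finite.subset fun a ha h0 => ha (by rw [Pi.smul_apply, h0, smul_zero])
  nonneg a ha := h.nonneg a fun h0 => ha (by rw [Pi.smul_apply, h0, smul_zero])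
  mem a := Submodule.smul_mem _ _ (h.mem a)

theorem DegIn.smul (h : DegIn Γ p c) (k : K) : DegIn Γ p (k • c) :=
  fun a ha => h a fun h0 => ha (by rw [Pi.smul_apply, h0, smul_zero])

theorem IsLaurent.zsmul (h : IsLaurent 𝒬 A p c) (k : ℤ) : IsLaurent 𝒬 A p (k • c) := by
  rw [← Int.cast_smul_eq_zsmul K]
  exact h.smul _

theorem DegIn.zsmul (h : DegIn Γ p c) (k : ℤ) : DegIn Γ p (k • c) :=
  fun a ha => h a fun h0 => ha (by rw [Pi.smul_apply, h0, smul_zero])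

theorem IsLaurent.sum {ι : Type*} {s : Finset ι} {f : ι → (Fin v → ℤ) → P}
    (h : ∀ i ∈ s, IsLaurent 𝒬 A p (f i)) : IsLaurent 𝒬 A p (∑ i ∈ s, f i) := by
  classical
  induction s using Finset.induction_on with
  | empty => exact isLaurent_zero
  | insert i s hi ih =>
    rw [Finset.sum_insert hi]
    exact (h i (Finset.mem_insert_self i s)).add
      (ih fun j hj => h j (Finset.mem_insert_of_mem hj))

theorem DegIn.sum {ι : Type*} {s : Finset ι} {f : ι → (Fin v → ℤ) → P}
    (h : ∀ i ∈ s, DegIn Γ p (f i)) : DegIn Γ p (∑ i ∈ s, f i) := by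
  classical
  induction s using Finset.induction_on with
  | empty => exact degIn_zero
  | insert i s hi ih =>
    rw [Finset.sum_insert hi]
    exact (h i (Finset.mem_insert_self i s)).add
      (ih fun j hj => h j (Finset.mem_insert_of_mem hj))

theorem IsLaurent.mono (h : IsLaurent 𝒬 A p c) (hAB : A ⊆ B) : IsLaurent 𝒬 B p c :=
  ⟨h.finite, fun a ha l hl => h.nonneg a ha l fun hl' => hl (hAB hl'), h.mem⟩

theorem IsLaurent.laurShift (h : IsLaurent 𝒬 A p c) (b : Fin v → ℤ) (hb : ∀ l ∉ A, 0 ≤ b l) :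
    IsLaurent 𝒬 A p (laurShift b c) where
  finite := (h.finite.image (· + b)).subset fun a ha => ⟨a - b, ha, by simp⟩
  nonneg a ha l hl := by
    have h1 := h.nonneg (a - b) ha l hl
    have h2 := hb l hl
    rw [Pi.sub_apply] at h1
    omega
  mem a := h.mem _

theorem DegIn.laurShift {n k : ℤ} (h : DegIn (· = n) p c) (b : Fin v → ℤ) (hb : ∑ l, b l = k) :
    DegIn (· = n + k) p (laurShift b c) := by
  intro a ha
  have := h (a - b) ha
  simp only [Pi.sub_apply, Finset.sum_sub_distrib] at this
  change _ = _
  omega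

theorem IsLaurent.laurD [SetLike.GradedSMul (extGrading K v) 𝒬] (h : IsLaurent 𝒬 A p c)
    {p' : ℤ} (hp : p = p' + 1) :
    IsLaurent 𝒬 A p' (laurD K c) := by
  have e : BGG.laurD K c = ∑ l, fun a => extVar K l • BGG.laurShift (Pi.single l 1) c a := by
    funext a
    rw [Finset.sum_apply]
    rfl
  rw [e]
  refine IsLaurent.sum fun l _ => ?_
  have hl := h.laurShift (Pi.single l 1) fun m _ => by
    by_cases hm : m = l
    · subst hm; simp
    · simp [hm]
  exact ⟨hl.finite.subset fun a ha h0 => ha (by rw [h0, smul_zero]),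
    fun a ha => hl.nonneg a fun h0 => ha (by rw [h0, smul_zero]),
    fun a => extVar_smul_mem 𝒬 l hp (hl.mem a)⟩

theorem DegIn.laurD (h : DegIn Γ p c) {p' : ℤ} (hp : p = p' + 1) : DegIn Γ p' (laurD K c) := by
  intro a ha
  obtain ⟨l, _, hl⟩ := Finset.exists_ne_zero_of_sum_ne_zero (s := Finset.univ)
    (f := fun l => extVar K l • c (a - Pi.single l 1)) ha
  have := h (a - Pi.single l 1) fun h0 => hl (by simp only [h0, smul_zero])
  convert this using 1
  simp [Finset.sum_sub_distrib, hp]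

open Classical in
/-- The part of a Laurent polynomial with total degree in `Γ`. -/
def laurTrunc (Γ : ℤ → Prop) (p : ℤ) (c : (Fin v → ℤ) → P) : (Fin v → ℤ) → P :=
  fun a => if Γ (∑ l, a l + p) then c a else 0

theorem IsLaurent.laurTrunc (h : IsLaurent 𝒬 A p c) (Γ : ℤ → Prop) :
    IsLaurent 𝒬 A p (laurTrunc Γ p c) := by
  have h0 : ∀ a, BGG.laurTrunc Γ p c a ≠ 0 → c a ≠ 0 := by
    intro a ha h0
    simp [BGG.laurTrunc, h0] at ha
  refine ⟨h.finite.subset h0, fun a ha => h.nonneg a (h0 a ha), fun a => ?_⟩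
  rw [BGG.laurTrunc]
  split_ifs
  · exact h.mem a
  · exact zero_mem _

theorem degIn_laurTrunc : DegIn Γ p (laurTrunc Γ p c) := by
  intro a ha
  by_contra h
  exact ha (if_neg h)

theorem laurTrunc_of_degIn (h : DegIn Γ p c) : laurTrunc Γ p c = c := by
  funext a
  rw [laurTrunc]
  split_ifs with ha
  · rfl
  · exact (not_not.mp (mt (h a) ha)).symm

/-- The differential raises the degree of monomials by one and lowers that of coefficients by one.
Total degree is preserved, so solutions of Dy = c can be truncated to the degrees of c. -/
theorem laurD_laurTrunc {p' : ℤ} (hp : p = p' + 1) :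
    laurD K (laurTrunc Γ p c) = laurTrunc Γ p' (laurD K c) := by
  funext a
  have e : ∀ l : Fin v, ∑ m, (a - Pi.single l 1 : Fin v → ℤ) m + p = ∑ m, a m + p' := by
    intro l
    simp [Finset.sum_sub_distrib, hp]
  rw [laurD_apply, laurTrunc]
  split_ifs with h
  · refine Finset.sum_congr rfl fun l _ => ?_
    rw [laurTrunc, if_pos (by rw [e]; exact h)]
  · refine Finset.sum_eq_zero fun l _ => ?_
    rw [laurTrunc, if_neg (by rw [e]; exact h), smul_zero]

/-- The indicator vector of `A`. -/
def indVec (A : Finset (Fin v)) : Fin v → ℤ := fun l => if l ∈ A then 1 else 0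

theorem sum_indVec (A : Finset (Fin v)) : ∑ l, indVec A l = A.card := by
  simp [indVec]

theorem IsLaurent.exists_shift (h : IsLaurent 𝒬 A p c) :
    ∃ k : ℕ, IsLaurent 𝒬 ∅ p (BGG.laurShift ((k : ℤ) • indVec A) c) := by
  obtain ⟨k, hk⟩ : ∃ k : ℕ, ∀ a, c a ≠ 0 → ∀ l, -(k : ℤ) ≤ a l := by
    -- The largest absolute value of an exponent in the support bounds the denominators.
    refine ⟨h.finite.toFinset.sup fun a => Finset.univ.sup fun l => (a l).natAbs, fun a ha l => ?_⟩
    have h1 : (Finset.univ.sup fun l => (a l).natAbs) ≤ h.finite.toFinset.sup fun a =>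
      Finset.univ.sup fun l => (a l).natAbs :=
      Finset.le_sup (f := fun a : Fin v → ℤ => Finset.univ.sup fun l => (a l).natAbs)
        (h.finite.mem_toFinset.mpr ha)
    have h2 : (a l).natAbs ≤ Finset.univ.sup fun l => (a l).natAbs :=
      Finset.le_sup (f := fun l => (a l).natAbs) (Finset.mem_univ l)
    omega
  refine ⟨k, ?_⟩
  have h1 := h.laurShift ((k : ℤ) • indVec A) fun l hl => by simp [indVec, hl]
  refine ⟨h1.finite, fun a ha l _ => ?_, h1.mem⟩
  by_cases hl : l ∈ A
  · have := hk _ ha l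
    simp [indVec, hl] at this
    omega
  · exact h1.nonneg a ha l hl

end Laurent

/-! ### Elements of S ⊗ P_p as Laurent polynomials with coefficients in P_p -/

section Expansion

variable {K : Type*} [Field K] {v : ℕ} {P : Type*} [AddCommGroup P] [Module K P]
  [Module (ExtAlg K v) P] [IsScalarTower K (ExtAlg K v) P] (𝒬 : ℤ → Submodule K P)

/-- The exponent vector with the given (nonnegative) entries. -/
def natExp (a : Fin v → ℤ) : Fin v →₀ ℕ := Finsupp.equivFunOnFinite.symm fun l => (a l).toNat

theorem natExp_cast (m : Fin v →₀ ℕ) : natExp (fun l => (m l : ℤ)) = m := by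
  ext l; simp [natExp]

open Classical in
/-- The expansion in monomials of the elements of `S ⊗ P_p`. -/
def expansion (p : ℤ) : (SymAlg K v ⊗[K] 𝒬 p) →ₗ[K] ((Fin v → ℤ) → P) where
  toFun s a := if 0 ≤ a then
    (TensorProduct.equivFinsuppOfBasisLeft (MvPolynomial.basisMonomials (Fin v) K) s (natExp a) : P)
    else 0
  map_add' s t := by ext a; by_cases h : 0 ≤ a <;> simp [h]
  map_smul' k s := by ext a; by_cases h : 0 ≤ a <;> simp [h]

variable {𝒬} {p : ℤ}

open Classical in
theorem expansion_tmul (f : SymAlg K v) (q : 𝒬 p) (a : Fin v → ℤ) :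
    expansion 𝒬 p (f ⊗ₜ q) a = if 0 ≤ a then f.coeff (natExp a) • (q : P) else 0 := by
  change (if 0 ≤ a then _ else _) = _
  rw [TensorProduct.equivFinsuppOfBasisLeft_apply_tmul_apply]
  rfl

theorem expansion_injective : Function.Injective (expansion (K := K) (v := v) 𝒬 p) := by
  intro s t h
  apply (TensorProduct.equivFinsuppOfBasisLeft (MvPolynomial.basisMonomials (Fin v) K)).injective
  ext m
  have := congrFun h fun l => (m l : ℤ)
  have h0 : (0 : Fin v → ℤ) ≤ fun l => (m l : ℤ) := fun l => by positivity
  simpa only [expansion, LinearMap.coe_mk, AddHom.coe_mk, if_pos h0, natExp_cast] using this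

theorem isLaurent_expansion (s : SymAlg K v ⊗[K] 𝒬 p) : IsLaurent 𝒬 ∅ p (expansion 𝒬 p s) := by
  induction s using TensorProduct.induction_on with
  | zero => rw [map_zero]; exact isLaurent_zero
  | add s t hs ht => rw [map_add]; exact hs.add ht
  | tmul f q =>
    refine ⟨?_, fun a ha l _ => ?_, fun a => ?_⟩
    · refine (f.support.finite_toSet.image fun m l => (m l : ℤ)).subset fun a ha => ?_
      rw [Set.mem_ofPred_eq, expansion_tmul] at ha
      by_cases h0 : 0 ≤ a
      · refine ⟨natExp a, ?_, ?_⟩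
        · rw [Finset.mem_coe, MvPolynomial.mem_support_iff]
          rintro h
          simp [h] at ha
        · ext l
          have := h0 l
          simp only [Pi.zero_apply] at this
          simp [natExp, this]
      · simp [h0] at ha
    · rw [expansion_tmul] at ha
      by_contra h
      exact ha (if_neg fun h0 => h (h0 l))
    · rw [expansion_tmul]
      split_ifs
      · exact Submodule.smul_mem _ _ q.2
      · exact zero_mem _

theorem IsLaurent.exists_expansion {c : (Fin v → ℤ) → P} (h : IsLaurent 𝒬 ∅ p c) :
    ∃ s, expansion 𝒬 p s = c := by
  let g : (Fin v →₀ ℕ) →₀ 𝒬 p := Finsupp.ofSupportFinite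
    (fun m => ⟨c fun l => (m l : ℤ), h.mem _⟩) (by
      refine Set.Finite.of_finite_image (f := fun m : Fin v →₀ ℕ => fun l => (m l : ℤ))
        (h.finite.subset ?_) ?_
      · rintro _ ⟨m, hm, rfl⟩ h0
        exact hm (Subtype.ext h0)
      · intro m _ m' _ hmm
        ext l
        exact Int.natCast_inj.mp (congrFun hmm l))
  refine ⟨(TensorProduct.equivFinsuppOfBasisLeft
    (MvPolynomial.basisMonomials (Fin v) K)).symm g, funext fun a => ?_⟩
  simp only [expansion, LinearMap.coe_mk, AddHom.coe_mk, LinearEquiv.apply_symm_apply]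
  by_cases h0 : 0 ≤ a
  · rw [if_pos h0]
    change c _ = c a
    congr 1
    funext l
    have := h0 l
    simp only [Pi.zero_apply] at this
    simp [natExp, this]
  · rw [if_neg h0]
    by_contra hc
    exact h0 fun l => h.nonneg a (Ne.symm hc) l (Finset.notMem_empty l)

theorem expansion_X_smul (l : Fin v) (s : SymAlg K v ⊗[K] 𝒬 p) :
    expansion 𝒬 p ((MvPolynomial.X l : SymAlg K v) • s) =
      laurShift (Pi.single l 1) (expansion 𝒬 p s) := by
  classical
  induction s using TensorProduct.induction_on with
  | zero => simp only [smul_zero, map_zero]; rfl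
  | add s t hs ht => rw [smul_add, map_add, hs, ht, map_add]; rfl
  | tmul f q =>
    funext a
    rw [TensorProduct.smul_tmul', smul_eq_mul, expansion_tmul, laurShift_apply, expansion_tmul,
      MvPolynomial.coeff_X_mul' (natExp a) l f]
    have h1 : natExp (a - Pi.single l 1) = natExp a - Finsupp.single l 1 := by
      ext m
      by_cases hm : m = l
      · subst hm; simp [natExp]
      · simp [natExp, hm]
    by_cases h0 : 0 ≤ a
    · by_cases hl : a l = 0
      · have h2 : ¬ (0 ≤ a - Pi.single l 1) := fun h => by simpa [hl] using h l
        rw [if_pos h0, if_neg h2, if_neg (by simp [natExp, hl]), zero_smul]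
      · have h3 := h0 l
        simp only [Pi.zero_apply] at h3
        have h2 : 0 ≤ a - Pi.single l 1 := fun m => by
          by_cases hm : m = l
          · subst hm; simp; omega
          · simpa [hm] using h0 m
        rw [if_pos h0, if_pos h2, h1, if_pos]
        simp [natExp]
        omega
    · have h2 : ¬ (0 ≤ a - Pi.single l 1) := fun h => h0 fun m => by
        have := h m
        by_cases hm : m = l
        · subst hm; simp at this ⊢; omega
        · simpa [hm] using this
      rw [if_neg h0, if_neg h2]

theorem expansion_xProd_smul (A : Finset (Fin v)) (s : SymAlg K v ⊗[K] 𝒬 p) :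
    expansion 𝒬 p (xProd K A • s) = laurShift (indVec A) (expansion 𝒬 p s) := by
  classical
  induction A using Finset.induction_on with
  | empty =>
    have : indVec (∅ : Finset (Fin v)) = 0 := by ext; simp [indVec]
    rw [xProd, Finset.prod_empty, one_smul, this, laurShift_zero]
  | insert l A hl ih =>
    have : indVec (insert l A) = Pi.single l 1 + indVec A := by
      ext m
      by_cases hm : m = l
      · subst hm; simp [indVec, hl]
      · simp [indVec, hm]
    rw [xProd, Finset.prod_insert hl, mul_smul, expansion_X_smul, ← xProd, ih, laurShift_laurShift,
      this]

theorem expansion_xProd_pow_smul (A : Finset (Fin v)) (k : ℕ) (s : SymAlg K v ⊗[K] 𝒬 p) :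
    expansion 𝒬 p (xProd K A ^ k • s) = laurShift ((k : ℤ) • indVec A) (expansion 𝒬 p s) := by
  induction k with
  | zero => simp [laurShift_zero]
  | succ k ih =>
    rw [pow_succ', mul_smul, expansion_xProd_smul, ih, laurShift_laurShift]
    congr 1
    push_cast
    rw [add_smul, one_smul, add_comm]

theorem expansion_LDiff [SetLike.GradedSMul (extGrading K v) 𝒬] {a b : ℤ} (h : a = b + 1)
    (s : SymAlg K v ⊗[K] 𝒬 a) :
    expansion 𝒬 b (LDiff 𝒬 h s) = laurD K (expansion 𝒬 a s) := by
  induction s using TensorProduct.induction_on with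
  | zero => simp
  | add s t hs ht => simp only [map_add, hs, ht]
  | tmul f q =>
    funext e
    rw [LDiff, LinearMap.sum_apply, map_sum, Finset.sum_apply, laurD_apply]
    refine Finset.sum_congr rfl fun l _ => ?_
    rw [LinearMap.smul_apply, LinearMap.baseChange_tmul, expansion_X_smul, laurShift_apply,
      expansion_tmul, expansion_tmul]
    split_ifs
    · change _ • (extVar K l • (q : P)) = _
      rw [smul_comm]
    · rw [smul_zero]

end Expansion

/-! ### Localizations of the linear resolution -/

section Localized

variable {K : Type*} [Field K] {v : ℕ}
  {M : Type*} [AddCommGroup M] [Module K M] [Module (SymAlg K v) M] [IsScalarTower K (SymAlg K v) M]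
  {ℳ : ℤ → Submodule K M} {d : ℤ}
  {P : Type*} [AddCommGroup P] [Module K P] [Module (ExtAlg K v) P] [IsScalarTower K (ExtAlg K v) P]
  {𝒬 : ℤ → Submodule K P} {ε : (SymAlg K v ⊗[K] 𝒬 d) →ₗ[SymAlg K v] M}
  {A B : Finset (Fin v)}

theorem xProd_pow_smul_injective (A : Finset (Fin v)) (k : ℕ) {z z' : Loc (K := K) M A}
    (h : xProd K A ^ k • z = xProd K A ^ k • z') : z = z' :=
  IsLocalizedModule.smul_injective
    (LocalizedModule.mkLinearMap (Submonoid.powers (xProd K A)) M)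
    ⟨xProd K A ^ k, pow_mem (Submonoid.mem_powers _) k⟩ h

theorem xProd_pow_smul_mk (A : Finset (Fin v)) (k : ℕ) (m : M) :
    xProd K A ^ k • (LocalizedModule.mk m ⟨xProd K A ^ k, pow_mem (Submonoid.mem_powers _) k⟩ :
      Loc (K := K) M A) = LocalizedModule.mk m 1 := by
  rw [LocalizedModule.smul'_mk]
  exact LocalizedModule.mk_cancel ⟨xProd K A ^ k, pow_mem (Submonoid.mem_powers _) k⟩ m

theorem locMap_mk_one (h : A ⊆ B) (m : M) :
    locMap (K := K) M h (LocalizedModule.mk m 1) = LocalizedModule.mk m 1 := by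
  rw [locMap, LocalizedModule.lift_mk_one, LocalizedModule.mkLinearMap_apply]

variable (ε) in
/-- The graph of the localization `S_{x_A} ⊗ P_d → M_{x_A}` of the augmentation. -/
def epsGraph (A : Finset (Fin v)) : Submodule K (((Fin v → ℤ) → P) × Loc (K := K) M A) where
  carrier := {y | ∃ (k : ℕ) (s : SymAlg K v ⊗[K] 𝒬 d),
    expansion 𝒬 d s = laurShift ((k : ℤ) • indVec A) y.1 ∧
      xProd K A ^ k • y.2 = LocalizedModule.mk (ε s) 1}
  zero_mem' := ⟨0, 0, by simp [laurShift_zero], by simp⟩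
  add_mem' := by
    have key : ∀ (c : (Fin v → ℤ) → P) (z : Loc (K := K) M A) (k k' : ℕ)
        (s : SymAlg K v ⊗[K] 𝒬 d), expansion 𝒬 d s = laurShift ((k : ℤ) • indVec A) c →
        xProd K A ^ k • z = LocalizedModule.mk (ε s) 1 →
        expansion 𝒬 d (xProd K A ^ k' • s) = laurShift (((k' + k : ℕ) : ℤ) • indVec A) c ∧
        xProd K A ^ (k' + k) • z = LocalizedModule.mk (ε (xProd K A ^ k' • s)) 1 := by
      intro c z k k' s h1 h2
      constructor
      · rw [expansion_xProd_pow_smul, h1, laurShift_laurShift]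
        push_cast
        rw [add_smul]
      · rw [pow_add, mul_smul, h2, map_smul, LocalizedModule.smul'_mk]
    rintro ⟨c, z⟩ ⟨c', z'⟩ ⟨k, s, h1, h2⟩ ⟨k', s', h1', h2'⟩
    obtain ⟨h3, h4⟩ := key c z k k' s h1 h2
    obtain ⟨h3', h4'⟩ := key c' z' k' k s' h1' h2'
    rw [add_comm k k'] at h3' h4'
    refine ⟨k' + k, xProd K A ^ k' • s + xProd K A ^ k • s', ?_, ?_⟩
    · rw [map_add, h3, h3']; rfl
    · change _ • (z + z') = _
      rw [smul_add, h4, h4', map_add]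
      exact (map_add (LocalizedModule.mkLinearMap (Submonoid.powers (xProd K A)) M) _ _).symm
  smul_mem' := by
    rintro a ⟨c, z⟩ ⟨k, s, h1, h2⟩
    refine ⟨k, a • s, ?_, ?_⟩
    · rw [map_smul, h1]; rfl
    · change _ • (a • z) = _
      rw [smul_comm, h2, LocalizedModule.smul'_mk, LinearMap.map_smul_of_tower]

theorem epsGraph_unique {c : (Fin v → ℤ) → P} {z z' : Loc (K := K) M A}
    (h : (c, z) ∈ epsGraph ε A) (h' : (c, z') ∈ epsGraph ε A) : z = z' := by
  have h0 := sub_mem h h'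
  obtain ⟨k, s, h1, h2⟩ := h0
  have h3 : s = 0 := expansion_injective (by
    rw [h1, map_zero]
    funext a
    simp [laurShift_apply])
  rw [h3, map_zero] at h2
  rw [← sub_eq_zero]
  exact xProd_pow_smul_injective A k (by rw [smul_zero]; simpa using h2)

theorem epsGraph_locMap (h : A ⊆ B) {c : (Fin v → ℤ) → P} {z : Loc (K := K) M A}
    (hz : (c, z) ∈ epsGraph ε A) : (c, locMap M h z) ∈ epsGraph ε B := by
  obtain ⟨k, s, h1, h2⟩ := hz
  have hd : xProd K B = xProd K (B \ A) * xProd K A := by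
    rw [xProd, xProd, xProd, Finset.prod_sdiff h]
  have hi : indVec B = indVec (B \ A) + indVec A := by
    ext l
    by_cases hA : l ∈ A
    · simp [indVec, hA, h hA]
    · simp [indVec, hA]
  refine ⟨k, xProd K (B \ A) ^ k • s, ?_, ?_⟩
  · rw [expansion_xProd_pow_smul, h1, laurShift_laurShift, ← smul_add, ← hi]
  · change _ • locMap M h z = _
    have hd' : xProd K B ^ k = xProd K (B \ A) ^ k * xProd K A ^ k := by rw [hd, mul_pow]
    refine (congrArg (· • locMap M h z) hd').trans ?_
    change (xProd K (B \ A) ^ k * xProd K A ^ k) • locMap M h z = _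
    rw [mul_smul, ← map_smul, h2, locMap_mk_one, LocalizedModule.smul'_mk, map_smul]

theorem epsGraph_X (l : Fin v) {c : (Fin v → ℤ) → P} {z : Loc (K := K) M A}
    (hz : (c, z) ∈ epsGraph ε A) :
    (laurShift (Pi.single l 1) c, (MvPolynomial.X l : SymAlg K v) • z) ∈ epsGraph ε A := by
  obtain ⟨k, s, h1, h2⟩ := hz
  refine ⟨k, (MvPolynomial.X l : SymAlg K v) • s, ?_, ?_⟩
  · rw [expansion_X_smul, h1, laurShift_laurShift, laurShift_laurShift, add_comm]
  · change _ • ((MvPolynomial.X l : SymAlg K v) • z) = _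
    rw [smul_comm, h2, LocalizedModule.smul'_mk, map_smul]

theorem exists_epsGraph {c : (Fin v → ℤ) → P} (h : IsLaurent 𝒬 A d c) :
    ∃ z, (c, z) ∈ epsGraph ε A := by
  obtain ⟨k, hk⟩ := h.exists_shift
  obtain ⟨s, hs⟩ := hk.exists_expansion
  exact ⟨_, k, s, hs, xProd_pow_smul_mk A k (ε s)⟩

theorem isLaurent_unshift {p : ℤ} (A : Finset (Fin v)) (k : ℕ) (s : SymAlg K v ⊗[K] 𝒬 p) :
    IsLaurent 𝒬 A p (laurShift (-((k : ℤ) • indVec A)) (expansion 𝒬 p s)) :=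
  ((isLaurent_expansion s).mono (Finset.empty_subset A)).laurShift _
    fun l hl => by simp [indVec, hl]

variable [SetLike.GradedSMul (extGrading K v) 𝒬]

theorem exists_lift (hL : IsLResolution 𝒬 ℳ d ε) (z : Loc (K := K) M A) :
    ∃ c, IsLaurent 𝒬 A d c ∧ (c, z) ∈ epsGraph ε A := by
  induction z using LocalizedModule.induction_on with
  | h m s =>
    obtain ⟨_, k, rfl⟩ := s
    obtain ⟨s, rfl⟩ := hL.aug_surjective m
    refine ⟨_, isLaurent_unshift A k s, k, s, ?_, xProd_pow_smul_mk A k _⟩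
    rw [laurShift_laurShift, add_neg_cancel, laurShift_zero]

theorem epsGraph_laurD (hL : IsLResolution 𝒬 ℳ d ε) {c : (Fin v → ℤ) → P}
    (h : IsLaurent 𝒬 A (d + 1) c) : (laurD K c, 0) ∈ epsGraph ε A := by
  obtain ⟨k, hk⟩ := h.exists_shift
  obtain ⟨s, hs⟩ := hk.exists_expansion
  refine ⟨k, LDiff 𝒬 rfl s, ?_, ?_⟩
  · rw [expansion_LDiff, hs, laurD_laurShift]
  · rw [(hL.aug_exact _).mpr ⟨s, rfl⟩]
    simp

/-- Exactness of localization at S ⊗ P_d: a further power of x_A kills ε(s) in M itself, so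
exactness of L(P) applies there. The solution is divided back and truncated to Γ. -/
theorem exists_laurD_of_epsGraph_zero (hL : IsLResolution 𝒬 ℳ d ε) {c : (Fin v → ℤ) → P}
    {Γ : ℤ → Prop} (hΓ : DegIn Γ d c) (h0 : (c, 0) ∈ epsGraph ε A) :
    ∃ y, IsLaurent 𝒬 A (d + 1) y ∧ DegIn Γ (d + 1) y ∧ laurD K y = c := by
  obtain ⟨k, s, h1, h2⟩ := h0
  have h3 : (LocalizedModule.mk (ε s) 1 : Loc (K := K) M A) = LocalizedModule.mk 0 1 := by
    rw [← h2]; simp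
  obtain ⟨⟨_, k', rfl⟩, hu⟩ := LocalizedModule.mk_eq.mp h3
  have h4 : ε (xProd K A ^ k' • s) = 0 := by
    rw [map_smul]
    rw [one_smul, one_smul, smul_zero] at hu
    exact hu
  obtain ⟨t, ht⟩ := (hL.aug_exact _).mp h4
  have h5 : laurD K (laurShift (-(((k' + k : ℕ) : ℤ) • indVec A)) (expansion 𝒬 (d + 1) t)) = c := by
    rw [laurD_laurShift, ← expansion_LDiff rfl, ht, expansion_xProd_pow_smul, h1,
      laurShift_laurShift, laurShift_laurShift]
    convert laurShift_zero c using 2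
    push_cast
    rw [add_smul]
    abel
  refine ⟨_, (isLaurent_unshift A (k' + k) t).laurTrunc Γ, degIn_laurTrunc, ?_⟩
  rw [laurD_laurTrunc rfl, h5, laurTrunc_of_degIn hΓ]

theorem exists_laurD (hL : IsLResolution 𝒬 ℳ d ε) {c : (Fin v → ℤ) → P}
    {p : ℤ} (hp : d < p) {Γ : ℤ → Prop} (hΓ : DegIn Γ p c) (hc : IsLaurent 𝒬 A p c)
    (h0 : laurD K c = 0) :
    ∃ y, IsLaurent 𝒬 A (p + 1) y ∧ DegIn Γ (p + 1) y ∧ laurD K y = c := by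
  obtain ⟨k, hk⟩ := hc.exists_shift
  obtain ⟨s, hs⟩ := hk.exists_expansion
  have hs0 : LDiff 𝒬 (show p = p - 1 + 1 by ring) s = 0 := expansion_injective (by
    rw [expansion_LDiff, hs, laurD_laurShift, h0, map_zero]
    rfl)
  obtain ⟨t, ht⟩ := (hL.exact (p + 1) p (p - 1) rfl (by ring) hp s).mp hs0
  have h5 : laurD K (laurShift (-((k : ℤ) • indVec A)) (expansion 𝒬 (p + 1) t)) = c := by
    rw [laurD_laurShift, ← expansion_LDiff rfl, ht, hs, laurShift_laurShift, neg_add_cancel,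
      laurShift_zero]
  refine ⟨_, (isLaurent_unshift A k t).laurTrunc Γ, degIn_laurTrunc, ?_⟩
  rw [laurD_laurTrunc rfl, h5, laurTrunc_of_degIn hΓ]

theorem eq_zero_of_isLaurent (hL : IsLResolution 𝒬 ℳ d ε) {c : (Fin v → ℤ) → P}
    {p : ℤ} (hp : p < d) (hc : IsLaurent 𝒬 A p c) : c = 0 := by
  funext a
  have := hc.mem a
  rwa [hL.eq_bot p hp, Submodule.mem_bot] at this

theorem degIn_monomial {p : ℤ} (m : Fin v →₀ ℕ) (q : 𝒬 p) :
    DegIn (· = ∑ l, (m l : ℤ) + p) p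
      (expansion 𝒬 p (MvPolynomial.monomial m (1 : K) ⊗ₜ q)) := by
  classical
  intro a ha
  rw [expansion_tmul] at ha
  by_cases h0 : 0 ≤ a
  · rw [if_pos h0, MvPolynomial.coeff_monomial] at ha
    have hm : m = natExp a := by
      by_contra h
      simp [h] at ha
    change _ = _
    rw [hm]
    congr 1
    refine Finset.sum_congr rfl fun l _ => ?_
    have := h0 l
    simp only [Pi.zero_apply] at this
    simp [natExp, this]
  · exact absurd (if_neg h0) ha

theorem aug_monomial_mem [hℳ : SetLike.GradedSMul (symGrading K v) ℳ]
    (hL : IsLResolution 𝒬 ℳ d ε) (m : Fin v →₀ ℕ) (q : 𝒬 d) :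
    ε (MvPolynomial.monomial m (1 : K) ⊗ₜ q) ∈ ℳ (∑ l, (m l : ℤ) + d) := by
  have h1 : (MvPolynomial.monomial m (1 : K) ⊗ₜ[K] q : SymAlg K v ⊗[K] 𝒬 d) =
      MvPolynomial.monomial m (1 : K) • (1 ⊗ₜ q) := by
    rw [TensorProduct.smul_tmul', smul_eq_mul, mul_one]
  have h2 : MvPolynomial.monomial m (1 : K) ∈ symGrading K v (∑ l, (m l : ℤ)) := by
    have h0 : 0 ≤ ∑ l, (m l : ℤ) := Finset.sum_nonneg fun l _ => by positivity
    rw [symGrading, if_pos h0, MvPolynomial.mem_homogeneousSubmodule]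
    refine MvPolynomial.isHomogeneous_monomial _ ?_
    rw [Finsupp.degree_eq_sum, ← Nat.cast_sum, Int.toNat_natCast]
  rw [h1, map_smul]
  exact hℳ.smul_mem h2 (hL.aug_mem q)

theorem eq_sum_monomial {p : ℤ} (s : SymAlg K v ⊗[K] 𝒬 p) :
    ∃ g : (Fin v →₀ ℕ) →₀ 𝒬 p, s = ∑ m ∈ g.support, MvPolynomial.monomial m (1 : K) ⊗ₜ g m ∧
      ∀ m, (g m : P) = expansion 𝒬 p s (fun l => (m l : ℤ)) := by
  let e := TensorProduct.equivFinsuppOfBasisLeft (N := 𝒬 p)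
    (MvPolynomial.basisMonomials (Fin v) K)
  refine ⟨e s, ?_, fun m => ?_⟩
  · conv_lhs => rw [← e.symm_apply_apply s, TensorProduct.equivFinsuppOfBasisLeft_symm_apply]
    simp [Finsupp.sum, MvPolynomial.coe_basisMonomials]
  · have h0 : (0 : Fin v → ℤ) ≤ fun l => (m l : ℤ) := fun l => by positivity
    simp only [expansion, LinearMap.coe_mk, AddHom.coe_mk, if_pos h0, natExp_cast]
    rfl

theorem aug_mem_of_degIn [SetLike.GradedSMul (symGrading K v) ℳ]
    (hL : IsLResolution 𝒬 ℳ d ε) {n : ℤ} (s : SymAlg K v ⊗[K] 𝒬 d)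
    (hs : DegIn (· = n) d (expansion 𝒬 d s)) : ε s ∈ ℳ n := by
  obtain ⟨g, h1, h2⟩ := eq_sum_monomial s
  rw [h1, map_sum]
  refine sum_mem fun m hm => ?_
  have : ∑ l, (m l : ℤ) + d = n := hs _ (by
    rw [← h2]
    simpa using hm)
  rw [← this]
  exact aug_monomial_mem hL m _

/-- Any preimage of m works after discarding its monomials of total degree other than n, since these
map to other components of M. -/
theorem exists_degIn_of_mem [SetLike.GradedSMul (symGrading K v) ℳ]
    {pr : ℤ → M →ₗ[K] M} (hM : IsGradedProj ℳ pr)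
    (hL : IsLResolution 𝒬 ℳ d ε) {n : ℤ} {m : M} (hm : m ∈ ℳ n) :
    ∃ s, ε s = m ∧ DegIn (· = n) d (expansion 𝒬 d s) := by
  classical
  obtain ⟨s, rfl⟩ := hL.aug_surjective m
  obtain ⟨g, h1, h2⟩ := eq_sum_monomial s
  refine ⟨∑ m ∈ g.support with ∑ l, (m l : ℤ) + d = n, MvPolynomial.monomial m (1 : K) ⊗ₜ g m,
    ?_, ?_⟩
  · rw [← hM.eq_self n _ hm, h1, map_sum, map_sum, map_sum, Finset.sum_filter]
    refine Finset.sum_congr rfl fun m _ => ?_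
    split_ifs with h
    · rw [hM.eq_self n]
      rw [← h]
      exact aug_monomial_mem hL m _
    · rw [hM.eq_zero _ n _ (aug_monomial_mem hL m _) h]
  · rw [map_sum]
    refine DegIn.sum fun m hm => ?_
    rw [← (Finset.mem_filter.mp hm).2]
    exact degIn_monomial m _

theorem mem_locGrading_of_epsGraph [SetLike.GradedSMul (symGrading K v) ℳ]
    (hL : IsLResolution 𝒬 ℳ d ε) {n : ℤ} {c : (Fin v → ℤ) → P} (hc : DegIn (· = n) d c)
    {z : Loc (K := K) M A} (hz : (c, z) ∈ epsGraph ε A) : z ∈ locGrading ℳ A n := by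
  obtain ⟨k, s, h1, h2⟩ := hz
  refine Submodule.subset_span ⟨k, ε s, aug_mem_of_degIn hL s ?_, ?_⟩
  · rw [h1]
    refine hc.laurShift _ ?_
    simp only [Pi.smul_apply, smul_eq_mul, ← Finset.mul_sum, sum_indVec]
  · exact xProd_pow_smul_injective A k (h2.trans (xProd_pow_smul_mk A k _).symm)

theorem exists_lift_of_mem_locGrading [SetLike.GradedSMul (symGrading K v) ℳ]
    {pr : ℤ → M →ₗ[K] M} (hM : IsGradedProj ℳ pr)
    (hL : IsLResolution 𝒬 ℳ d ε) {n : ℤ} {z : Loc (K := K) M A} (hz : z ∈ locGrading ℳ A n) :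
    ∃ c, IsLaurent 𝒬 A d c ∧ DegIn (· = n) d c ∧ (c, z) ∈ epsGraph ε A := by
  induction hz using Submodule.span_induction with
  | mem z hz =>
    obtain ⟨k, m, hm, rfl⟩ := hz
    obtain ⟨s, rfl, hs⟩ := exists_degIn_of_mem hM hL hm
    refine ⟨_, isLaurent_unshift A k s, ?_, k, s, ?_, xProd_pow_smul_mk A k _⟩
    · have := hs.laurShift (k := -(k * A.card)) (-((k : ℤ) • indVec A)) (by
        simp only [Pi.neg_apply, Pi.smul_apply, smul_eq_mul, Finset.sum_neg_distrib,
          ← Finset.mul_sum, sum_indVec])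
      rwa [show n + k * A.card + -(k * A.card : ℤ) = n by ring] at this
    · rw [laurShift_laurShift, add_neg_cancel, laurShift_zero]
  | zero => exact ⟨0, isLaurent_zero, degIn_zero, zero_mem _⟩
  | add y z _ _ hy hz =>
    obtain ⟨c, h1, h2, h3⟩ := hy
    obtain ⟨c', h1', h2', h3'⟩ := hz
    exact ⟨c + c', h1.add h1', h2.add h2', add_mem h3 h3'⟩
  | smul a z _ hz =>
    obtain ⟨c, h1, h2, h3⟩ := hz
    exact ⟨a • c, h1.smul a, h2.smul a, Submodule.smul_mem _ a h3⟩

end Localized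

/-! ### The Čech differential on families indexed by subsets -/

section CechSum

variable {v : ℕ} {N : Type*} [AddCommGroup N]

/-- The sign of `i` in the Čech differential. -/
def cechSign (B : Finset (Fin v)) (i : Fin v) : ℤ := (-1) ^ (B.filter (· < i)).card

/-- The Čech differential on families of elements of a fixed group. -/
def cechSum (c : Finset (Fin v) → N) (B : Finset (Fin v)) : N :=
  ∑ i ∈ B, cechSign B i • c (B.erase i)

theorem cechSign_mul_self (B : Finset (Fin v)) (i : Fin v) : cechSign B i * cechSign B i = 1 := by
  rw [cechSign, ← pow_add, ← two_mul, pow_mul, neg_one_sq, one_pow]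

theorem cechSign_eq_erase {B : Finset (Fin v)} {i : Fin v} (hi : i ∈ B) (j : Fin v) :
    cechSign B j = (if i < j then -1 else 1) * cechSign (B.erase i) j := by
  have h : (B.erase i).filter (· < j) = (B.filter (· < j)).erase i := by
    ext k; simp [and_assoc]
  rw [cechSign, cechSign, h]
  split_ifs with hij
  · have hmem : i ∈ B.filter (· < j) := Finset.mem_filter.mpr ⟨hi, hij⟩
    rw [← pow_succ', Finset.card_erase_add_one hmem]
  · rw [Finset.erase_eq_of_notMem (by simp [hij]), one_mul]

theorem cechSign_erase_self (B : Finset (Fin v)) (i : Fin v) :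
    cechSign (B.erase i) i = cechSign B i := by
  by_cases hi : i ∈ B
  · rw [cechSign_eq_erase hi]; simp
  · rw [Finset.erase_eq_of_notMem hi]

theorem cechSign_swap {B : Finset (Fin v)} {i j : Fin v} (hi : i ∈ B) (hj : j ∈ B) (hij : i ≠ j) :
    cechSign B i * cechSign (B.erase i) j = -(cechSign B j * cechSign (B.erase j) i) := by
  rw [cechSign_eq_erase hi j, cechSign_eq_erase hj i]
  rcases lt_or_gt_of_ne hij with h | h
  · rw [if_neg h.not_gt, if_pos h]; ring
  · rw [if_neg h.not_gt, if_pos h]; ring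

theorem cechSum_add (c c' : Finset (Fin v) → N) (B : Finset (Fin v)) :
    cechSum (c + c') B = cechSum c B + cechSum c' B := by
  simp [cechSum, Finset.sum_add_distrib]

theorem cechSum_smul {R : Type*} [Monoid R] [DistribMulAction R N] (k : R)
    (c : Finset (Fin v) → N) (B : Finset (Fin v)) : cechSum (k • c) B = k • cechSum c B := by
  simp only [cechSum, Pi.smul_apply, Finset.smul_sum]
  exact Finset.sum_congr rfl fun i _ => (smul_comm _ _ _)

theorem cechSum_map {N' : Type*} [AddCommGroup N'] (f : N →+ N') (c : Finset (Fin v) → N)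
    (B : Finset (Fin v)) : cechSum (fun A => f (c A)) B = f (cechSum c B) := by
  simp [cechSum]

theorem cechSum_zero (B : Finset (Fin v)) : cechSum (0 : Finset (Fin v) → N) B = 0 := by
  simp [cechSum]

theorem cechSum_cechSum (c : Finset (Fin v) → N) (B : Finset (Fin v)) :
    cechSum (cechSum c) B = 0 := by
  classical
  let f : Fin v → Fin v → N := fun i j => if i ∈ B ∧ j ∈ B ∧ i ≠ j then
    (cechSign B i * cechSign (B.erase i) j) • c ((B.erase i).erase j) else 0
  have h1 : cechSum (cechSum c) B = ∑ i, ∑ j, f i j := by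
    simp only [cechSum, Finset.smul_sum, smul_smul]
    rw [← Finset.sum_subset (Finset.subset_univ B)]
    · refine Finset.sum_congr rfl fun i hi => ?_
      rw [← Finset.sum_subset (Finset.subset_univ (B.erase i))]
      · refine Finset.sum_congr rfl fun j hj => ?_
        rw [Finset.mem_erase] at hj
        exact (if_pos ⟨hi, hj.2, hj.1.symm⟩).symm
      · intro j _ hj
        refine if_neg fun h => hj (Finset.mem_erase.mpr ⟨h.2.2.symm, h.2.1⟩)
    · intro i _ hi
      exact Finset.sum_eq_zero fun j _ => if_neg fun h => hi h.1
  rw [h1]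
  refine sum_sum_alternating f (fun i => if_neg fun h => h.2.2 rfl) (fun i j => ?_)
  by_cases h : i ∈ B ∧ j ∈ B ∧ i ≠ j
  · have h' : j ∈ B ∧ i ∈ B ∧ j ≠ i := ⟨h.2.1, h.1, h.2.2.symm⟩
    simp only [f, if_pos h, if_pos h']
    rw [cechSign_swap h.1 h.2.1 h.2.2, neg_smul, Finset.erase_right_comm]
  · have h' : ¬ (j ∈ B ∧ i ∈ B ∧ j ≠ i) := fun h' => h ⟨h'.2.1, h'.1, h'.2.2.symm⟩
    simp only [f, if_neg h, if_neg h', neg_zero]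

/-- The homotopy contracting the Čech complex at the index `l`. -/
def cechH (l : Fin v) (c : Finset (Fin v) → N) (A : Finset (Fin v)) : N :=
  if l ∈ A then 0 else cechSign A l • c (insert l A)

/-- With constant coefficients the Čech complex is the augmented cochain complex of a full simplex,
contracted by inserting the vertex l. -/
theorem cech_homotopy (l : Fin v) (c : Finset (Fin v) → N) (B : Finset (Fin v)) :
    cechSum (cechH l c) B + cechH l (cechSum c) B = c B := by
  by_cases hl : l ∈ B
  · rw [cechH, if_pos hl, add_zero, cechSum, Finset.sum_eq_single l]
    · rw [cechH, if_neg (Finset.notMem_erase l B), cechSign_erase_self, smul_smul,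
        cechSign_mul_self, one_smul, Finset.insert_erase hl]
    · intro i _ hil
      rw [cechH, if_pos (Finset.mem_erase.mpr ⟨hil.symm, hl⟩), smul_zero]
    · exact fun h => absurd hl h
  · have hB : (insert l B).erase l = B := Finset.erase_insert hl
    have hs : cechSign (insert l B) l = cechSign B l := by
      rw [← cechSign_erase_self, hB]
    rw [cechH, if_neg hl, cechSum, cechSum, Finset.sum_insert hl, hB, hs, smul_add, smul_smul,
      cechSign_mul_self, one_smul, add_left_comm, Finset.smul_sum, ← Finset.sum_add_distrib,
      Finset.sum_eq_zero, add_zero]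
    intro i hi
    have hil : i ≠ l := fun h => hl (h ▸ hi)
    have h1 : (insert l B).erase i = insert l (B.erase i) := Finset.erase_insert_of_ne hil.symm
    rw [cechH, if_neg fun h => hl (Finset.mem_of_mem_erase h), smul_smul, smul_smul, h1, ← add_smul]
    have h2 := cechSign_eq_erase (Finset.mem_insert_self l B) i
    rw [hB] at h2
    have h3 := cechSign_eq_erase hi l
    rw [h2, h3]
    rcases lt_or_gt_of_ne hil with h | h
    · rw [if_neg h.not_gt, if_pos h]
      convert zero_smul ℤ _ using 2
      ring
    · rw [if_neg h.not_gt, if_pos h]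
      convert zero_smul ℤ _ using 2
      ring

/-- Construction of families by recursion along a bounded rank function. -/
theorem exists_family {α X : Type*} [DecidableEq α] (r : α → ℕ) (n : ℕ) (hr : ∀ A, r A < n)
    (x0 : X) (G : (α → X) → α → Prop)
    (hcongr : ∀ y y' A, (∀ B, r B < r A → y B = y' B) → y A = y' A → G y A → G y' A)
    (hstep : ∀ y A, (∀ B, r B < r A → G y B) → ∃ x, G (Function.update y A x) A) :
    ∃ y, ∀ A, G y A := by
  -- The family is built rank by rank. By `hcongr` the condition at A depends only on the values at
  -- A and at lower ranks, so later choices do not disturb it.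
  suffices h : ∀ n, ∃ y, ∀ A, r A < n → G y A by
    obtain ⟨y, hy⟩ := h n
    exact ⟨y, fun A => hy A (hr A)⟩
  intro n
  induction n with
  | zero => exact ⟨fun _ => x0, fun A hA => absurd hA (Nat.not_lt_zero _)⟩
  | succ n ih =>
    obtain ⟨y, hy⟩ := ih
    have hex : ∀ A, ∃ x, r A = n → G (Function.update y A x) A := by
      intro A
      by_cases hA : r A = n
      · obtain ⟨x, hx⟩ := hstep y A fun B hB => hy B (hA ▸ hB)
        exact ⟨x, fun _ => hx⟩
      · exact ⟨x0, fun h => absurd h hA⟩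
    choose f hf using hex
    refine ⟨fun A => if r A = n then f A else y A, fun A hA => ?_⟩
    rcases Nat.lt_succ_iff_lt_or_eq.mp hA with h | h
    · refine hcongr y _ A (fun B hB => ?_) ?_ (hy A h)
      · rw [if_neg (by omega)]
      · rw [if_neg (by omega)]
    · refine hcongr _ _ A (fun B hB => ?_) ?_ (hf A h)
      · rw [Function.update_of_ne (fun hBA => by subst hBA; omega), if_neg (by omega)]
      · rw [Function.update_self, if_pos h]

end CechSum

/-! ### Čech cohomology of Laurent polynomials -/

section LaurentCech

variable {K : Type*} [Field K] {v : ℕ} {P : Type*} [AddCommGroup P] [Module K P]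
  [Module (ExtAlg K v) P] [IsScalarTower K (ExtAlg K v) P] {𝒬 : ℤ → Submodule K P}

theorem cechSum_apply (c : Finset (Fin v) → (Fin v → ℤ) → P) (B : Finset (Fin v)) (a : Fin v → ℤ) :
    cechSum c B a = cechSum (fun A => c A a) B := by
  simp [cechSum]

theorem cechSum_laurD (c : Finset (Fin v) → (Fin v → ℤ) → P) (B : Finset (Fin v)) :
    cechSum (fun A => laurD K (c A)) B = laurD K (cechSum c B) :=
  cechSum_map (laurD K).toAddMonoidHom c B

theorem card_erase_int {B : Finset (Fin v)} {i : Fin v} (hi : i ∈ B) :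
    ((B.erase i).card : ℤ) = B.card - 1 := by
  have := Finset.card_erase_add_one hi
  omega

theorem isLaurent_cechSum {c : Finset (Fin v) → (Fin v → ℤ) → P} {B : Finset (Fin v)} {p : ℤ}
    (h : ∀ i ∈ B, IsLaurent 𝒬 (B.erase i) p (c (B.erase i))) : IsLaurent 𝒬 B p (cechSum c B) :=
  IsLaurent.sum fun i hi => ((h i hi).mono (Finset.erase_subset _ _)).zsmul _

theorem degIn_cechSum {c : Finset (Fin v) → (Fin v → ℤ) → P} {B : Finset (Fin v)} {p : ℤ}
    {Γ : ℤ → Prop} (h : ∀ i ∈ B, DegIn Γ p (c (B.erase i))) : DegIn Γ p (cechSum c B) :=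
  DegIn.sum fun i hi => (h i hi).zsmul _

open Classical in
/-- The homotopy for the Čech complex of Laurent polynomials; in each multidegree some nonnegative
coordinate is used. -/
def laurH (c : Finset (Fin v) → (Fin v → ℤ) → P) (A : Finset (Fin v)) : (Fin v → ℤ) → P := fun a =>
  if h : ∃ l, 0 ≤ a l then cechH h.choose (fun A => c A a) A else 0

theorem laurH_congr {c c' : Finset (Fin v) → (Fin v → ℤ) → P} {A : Finset (Fin v)}
    (h : ∀ l ∉ A, c (insert l A) = c' (insert l A)) : laurH c A = laurH c' A := by
  funext a
  rw [laurH, laurH]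
  split_ifs with ha
  · rw [cechH, cechH]
    split_ifs with hl
    · rfl
    · rw [h _ hl]
  · rfl

theorem laurH_ne_zero {c : Finset (Fin v) → (Fin v → ℤ) → P} {A : Finset (Fin v)} {a : Fin v → ℤ}
    (h : laurH c A a ≠ 0) : ∃ l ∉ A, 0 ≤ a l ∧ c (insert l A) a ≠ 0 := by
  rw [laurH] at h
  split_ifs at h with ha
  · rw [cechH] at h
    split_ifs at h with hl
    · exact absurd rfl h
    · exact ⟨_, hl, ha.choose_spec, fun h0 => h (by rw [h0, smul_zero])⟩
  · exact absurd rfl h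

/-- The inserted index l has a_l ≥ 0, so a monomial allowed for A ∪ {l} is already allowed for A.
The homotopy creates no new denominators. -/
theorem isLaurent_laurH {c : Finset (Fin v) → (Fin v → ℤ) → P} {A : Finset (Fin v)} {p : ℤ}
    (h : ∀ l ∉ A, IsLaurent 𝒬 (insert l A) p (c (insert l A))) : IsLaurent 𝒬 A p (laurH c A) where
  finite := by
    refine ((Set.finite_univ (α := Fin v)).biUnion
      (t := fun l => {a | l ∉ A ∧ c (insert l A) a ≠ 0}) fun l _ => ?_).subset fun a ha => ?_
    · by_cases hl : l ∈ A
      · simp [hl]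
      · exact (h l hl).finite.subset fun a ha => ha.2
    · obtain ⟨l, hl, _, h0⟩ := laurH_ne_zero ha
      exact Set.mem_biUnion (Set.mem_univ l) ⟨hl, h0⟩
  nonneg a ha m hm := by
    obtain ⟨l, hl, hal, h0⟩ := laurH_ne_zero ha
    by_cases hml : m = l
    · rw [hml]; exact hal
    · exact (h l hl).nonneg a h0 m (by simp [hml, hm])
  mem a := by
    rw [laurH]
    split_ifs with ha
    · rw [cechH]
      split_ifs with hl
      · exact zero_mem _
      · exact zsmul_mem ((h _ hl).mem a) _
    · exact zero_mem _

theorem degIn_laurH {c : Finset (Fin v) → (Fin v → ℤ) → P} {A : Finset (Fin v)} {p : ℤ}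
    {Γ : ℤ → Prop} (h : ∀ l ∉ A, DegIn Γ p (c (insert l A))) : DegIn Γ p (laurH c A) := by
  intro a ha
  obtain ⟨l, hl, _, h0⟩ := laurH_ne_zero ha
  exact h l hl a h0

/-- The projection of Laurent polynomials to their purely negative part, as an element of
`Hom_K(S, P)`. -/
def negPart (c : (Fin v → ℤ) → P) : (Fin v → ℕ) → P := fun a => c fun l => -1 - (a l : ℤ)

theorem negPart_laurD (c : (Fin v → ℤ) → P) :
    negPart (laurD K c) = cartanD K P (negPart c) := by
  funext a
  rw [negPart, laurD_apply, cartanD_apply]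
  refine Finset.sum_congr rfl fun l _ => ?_
  congr 2
  funext m
  by_cases hm : m = l
  · subst hm; simp; ring
  · simp [hm]

theorem negPart_laurShift (l : Fin v) (c : (Fin v → ℤ) → P) :
    negPart (laurShift (Pi.single l 1) c) = cartanX l (negPart c) := by
  funext a
  rw [negPart, laurShift_apply, cartanX, negPart]
  congr 1
  funext m
  by_cases hm : m = l
  · subst hm; simp; ring
  · simp [hm]

/-- The component omitting i has nonnegative exponents at i, so no purely negative monomial reaches
the last term. -/
theorem negPart_cechSum {c : Finset (Fin v) → (Fin v → ℤ) → P} {p : Finset (Fin v) → ℤ}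
    (h : ∀ A, IsLaurent 𝒬 A (p A) (c A)) : negPart (cechSum c Finset.univ) = 0 := by
  funext a
  rw [negPart, cechSum_apply]
  refine Finset.sum_eq_zero fun i _ => ?_
  have : c (Finset.univ.erase i) (fun l => -1 - (a l : ℤ)) = 0 := by
    by_contra h0
    have := (h _).nonneg _ h0 i (Finset.notMem_erase i _)
    omega
  simp only [this, smul_zero]

/-- The Čech complex splits by multidegree a. If some a_l ≥ 0, inserting l contracts that piece. If
all a_l are negative, only the full index set contributes, and `h0` removes it. -/
theorem laur_homotopy {c : Finset (Fin v) → (Fin v → ℤ) → P} {p : Finset (Fin v) → ℤ}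
    (h : ∀ A, IsLaurent 𝒬 A (p A) (c A)) (h0 : negPart (c Finset.univ) = 0) (B : Finset (Fin v))
    (a : Fin v → ℤ) : cechSum (laurH c) B a + laurH (cechSum c) B a = c B a := by
  rw [cechSum_apply]
  by_cases ha : ∃ l, 0 ≤ a l
  · have e : ∀ c : Finset (Fin v) → (Fin v → ℤ) → P, ∀ A,
        laurH c A a = cechH ha.choose (fun A => c A a) A := fun c A => dif_pos ha
    rw [show (fun A => laurH c A a) = cechH ha.choose (fun A => c A a) from funext (e c), e,
      show (fun A => cechSum c A a) = cechSum (fun A => c A a) from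
        funext fun A => cechSum_apply c A a]
    exact cech_homotopy _ _ _
  · have e : ∀ c : Finset (Fin v) → (Fin v → ℤ) → P, ∀ A, laurH c A a = 0 := fun c A => dif_neg ha
    rw [show (fun A => laurH c A a) = 0 from funext (e c), e, cechSum_zero, add_zero]
    by_contra hB
    have hu : B = Finset.univ := by
      ext l
      simp only [Finset.mem_univ, iff_true]
      by_contra hl
      exact ha ⟨l, (h B).nonneg a (Ne.symm hB) l hl⟩
    subst hu
    have := congrFun h0 fun l => (-1 - a l).toNat
    rw [negPart] at this
    apply hB
    rw [Pi.zero_apply] at this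
    rw [← this]
    congr 1
    funext l
    have := not_exists.mp ha l
    omega

open Classical in
/-- The Laurent polynomial with the given negative part. -/
def ofNegPart (w : (Fin v → ℕ) → P) : (Fin v → ℤ) → P := fun a =>
  if ∀ l, a l < 0 then w fun l => (-1 - a l).toNat else 0

theorem negPart_ofNegPart (w : (Fin v → ℕ) → P) : negPart (ofNegPart w) = w := by
  funext a
  rw [negPart, ofNegPart, if_pos fun l => by omega]
  congr 1
  funext l
  omega

theorem ofNegPart_ne_zero {w : (Fin v → ℕ) → P} {a : Fin v → ℤ} (h : ofNegPart w a ≠ 0) :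
    ∃ m : Fin v → ℕ, w m ≠ 0 ∧ a = fun l => -1 - (m l : ℤ) := by
  rw [ofNegPart] at h
  split_ifs at h with ha
  · refine ⟨_, h, funext fun l => ?_⟩
    have := ha l
    omega
  · exact absurd rfl h

theorem isLaurent_ofNegPart {w : (Fin v → ℕ) → P} {q p : ℤ} (hw : IsHomog 𝒬 q p w) :
    IsLaurent 𝒬 Finset.univ p (ofNegPart w) where
  finite := by
    refine ((Set.finite_Iic fun _ : Fin v => q.toNat).image
      fun (m : Fin v → ℕ) l => -1 - (m l : ℤ)).subset fun a ha => ?_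
    obtain ⟨m, hm, rfl⟩ := ofNegPart_ne_zero ha
    refine ⟨m, fun l => ?_, rfl⟩
    have h1 := (hw m).2 hm
    have h2 : (m l : ℤ) ≤ ∑ l, (m l : ℤ) :=
      Finset.single_le_sum (f := fun l => (m l : ℤ)) (fun l _ => by positivity) (Finset.mem_univ l)
    simp only
    omega
  nonneg a _ l hl := absurd (Finset.mem_univ l) hl
  mem a := by
    rw [ofNegPart]
    split_ifs
    · exact (hw _).1
    · exact zero_mem _

theorem sum_neg_one_sub (m : Fin v → ℕ) : ∑ l, (-1 - (m l : ℤ)) = -v - ∑ l, (m l : ℤ) := by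
  simp [Finset.sum_sub_distrib]

theorem degIn_ofNegPart {w : (Fin v → ℕ) → P} {q p : ℤ} (hw : IsHomog 𝒬 q p w) :
    DegIn (· = p - v - q) p (ofNegPart w) := by
  intro a ha
  obtain ⟨m, hm, rfl⟩ := ofNegPart_ne_zero ha
  have := (hw m).2 hm
  change _ = _
  rw [sum_neg_one_sub]
  omega

theorem isHomog_negPart {c : (Fin v → ℤ) → P} {A : Finset (Fin v)} {p n : ℤ}
    (hc : IsLaurent 𝒬 A p c) (hd : DegIn (· = n) p c) : IsHomog 𝒬 (p - v - n) p (negPart c) := by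
  refine fun a => ⟨hc.mem _, fun ha => ?_⟩
  have : _ = _ := hd _ ha
  rw [sum_neg_one_sub] at this
  omega

end LaurentCech

/-! ### Comparison of the Čech complex of `M` with the Cartan complex of `P` -/

section CechRel

variable {K : Type*} [Field K] {v : ℕ}
  {M : Type*} [AddCommGroup M] [Module K M] [Module (SymAlg K v) M] [IsScalarTower K (SymAlg K v) M]
  {ℳ : ℤ → Submodule K M} {d : ℤ}
  {P : Type*} [AddCommGroup P] [Module K P] [Module (ExtAlg K v) P] [IsScalarTower K (ExtAlg K v) P]
  {𝒬 : ℤ → Submodule K P} {ε : (SymAlg K v ⊗[K] 𝒬 d) →ₗ[SymAlg K v] M}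

theorem cechDiff_apply (z : Cech (K := K) (v := v) M) (B : Finset (Fin v)) :
    cechDiff M z B = ∑ i ∈ B, cechSign B i • locMap M (B.erase_subset i) (z (B.erase i)) := by
  rw [cechDiff, LinearMap.pi_apply, LinearMap.sum_apply]
  rfl

theorem cechDiff_apply_eq_zero {z : Cech (K := K) (v := v) M} {B : Finset (Fin v)}
    (h : ∀ i ∈ B, z (B.erase i) = 0) : cechDiff M z B = 0 := by
  rw [cechDiff_apply]
  exact Finset.sum_eq_zero fun i hi => by rw [h i hi, map_zero, zsmul_zero]

theorem epsGraph_cechSum {y : Finset (Fin v) → (Fin v → ℤ) → P} {b : Cech (K := K) (v := v) M}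
    {B : Finset (Fin v)} (h : ∀ i ∈ B, (y (B.erase i), b (B.erase i)) ∈ epsGraph ε (B.erase i)) :
    (cechSum y B, cechDiff M b B) ∈ epsGraph ε B := by
  have := sum_mem (S := epsGraph ε B) (t := B)
    (f := fun i => cechSign B i • (y (B.erase i), locMap M (B.erase_subset i) (b (B.erase i))))
    fun i hi => zsmul_mem (epsGraph_locMap _ (h i hi)) _
  rw [cechDiff_apply, cechSum]
  convert this using 1
  ext1 <;> simp [Prod.fst_sum, Prod.snd_sum]

theorem cechSum_congr {N : Type*} [AddCommGroup N] {c c' : Finset (Fin v) → N}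
    {B : Finset (Fin v)} (h : ∀ i ∈ B, c (B.erase i) = c' (B.erase i)) :
    cechSum c B = cechSum c' B :=
  Finset.sum_congr rfl fun i hi => by rw [h i hi]

variable [SetLike.GradedSMul (extGrading K v) 𝒬]

/-- Lifting along the Čech direction, starting from the empty set. -/
theorem exists_ascending_cech (hL : IsLResolution 𝒬 ℳ d ε) (o s : ℤ) {Γ : ℤ → Prop}
    {φ : Finset (Fin v) → (Fin v → ℤ) → P} {b : Cech (K := K) (v := v) M}
    (hφ : ∀ A : Finset (Fin v), IsLaurent 𝒬 A (o + A.card - 1) (φ A))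
    (hφΓ : ∀ A : Finset (Fin v), DegIn Γ (o + A.card - 1) (φ A))
    (hφD : ∀ A, laurD K (φ A) = -(s • cechSum φ A))
    (hb : ∀ A : Finset (Fin v), o + A.card = d →
      ∃ c, IsLaurent 𝒬 A d c ∧ DegIn Γ d c ∧ (c, b A) ∈ epsGraph ε A)
    (hφb : ∀ A : Finset (Fin v), o + A.card = d + 1 →
      (φ A, -(s • cechDiff M b A)) ∈ epsGraph ε A) :
    ∃ y : Finset (Fin v) → (Fin v → ℤ) → P, ∀ A : Finset (Fin v),
      IsLaurent 𝒬 A (o + A.card) (y A) ∧ DegIn Γ (o + A.card) (y A) ∧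
      laurD K (y A) = φ A + s • cechSum y A ∧ (o + A.card = d → (y A, b A) ∈ epsGraph ε A) := by
  have hupd : ∀ (y : Finset (Fin v) → (Fin v → ℤ) → P) (A : Finset (Fin v)) (x),
      cechSum (Function.update y A x) A = cechSum y A := fun y A x =>
    cechSum_congr fun i hi => Function.update_of_ne (fun h => by
      have := congrArg (i ∈ ·) h
      simp [hi] at this) _ _
  have hcard : ∀ (A : Finset (Fin v)), ∀ i ∈ A, (A.erase i).card < A.card := fun A i hi =>
    Finset.card_erase_lt_of_mem hi
  refine exists_family Finset.card (v + 1)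
    (fun A => Nat.lt_succ_of_le (by simpa using A.card_le_univ)) 0 _ ?_ ?_
  · intro y y' A h hA hG
    rw [← hA, ← cechSum_congr fun i hi => h _ (hcard A i hi)]
    exact hG
  · intro y A hG
    have hG' := fun i hi => hG _ (hcard A i hi)
    simp only [hupd, Function.update_self]
    -- The element t has to become D y_A. Its coefficients lie in P_{o+|A|-1}, which decides the
    -- cases below: this group is zero up to o+|A| = d, so that at o+|A| = d a lift of b_A can be
    -- taken. At o+|A| = d+1 one needs ε(t) = 0, and beyond that L(P) is exact.
    set t := φ A + s • cechSum y A with ht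
    have htL : IsLaurent 𝒬 A (o + A.card - 1) t := (hφ A).add ((isLaurent_cechSum fun i hi => by
      have := (hG' i hi).1
      rwa [card_erase_int hi, ← add_sub_assoc] at this).zsmul s)
    have htΓ : DegIn Γ (o + A.card - 1) t := (hφΓ A).add ((degIn_cechSum fun i hi => by
      have := (hG' i hi).2.1
      rwa [card_erase_int hi, ← add_sub_assoc] at this).zsmul s)
    have htD : laurD K t = 0 := by
      rw [ht, map_add, map_zsmul, hφD, ← cechSum_laurD,
        cechSum_congr (c := fun A => laurD K (y A)) (c' := φ + s • cechSum y)
          fun i hi => (hG' i hi).2.2.1, cechSum_add,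
        cechSum_smul, cechSum_cechSum, smul_zero, add_zero, neg_add_cancel]
    rcases lt_trichotomy (o + A.card : ℤ) d with h | h | h
    · refine ⟨0, isLaurent_zero, degIn_zero, ?_, fun h' => absurd h' h.ne⟩
      rw [eq_zero_of_isLaurent hL (by omega) htL, map_zero]
    · obtain ⟨c, h1, h2, h3⟩ := hb A h
      refine ⟨c, h.symm ▸ h1, h.symm ▸ h2, ?_, fun _ => h3⟩
      rw [eq_zero_of_isLaurent hL (by omega) htL,
        eq_zero_of_isLaurent hL (sub_one_lt d) (h1.laurD (sub_add_cancel d 1).symm)]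
    · rcases (Int.add_one_le_iff.mpr h).eq_or_lt with h' | h'
      · have h0 : (t, 0) ∈ epsGraph ε A := by
          have := add_mem (hφb A h'.symm) (zsmul_mem (epsGraph_cechSum (y := y) (b := b) (B := A)
            fun i hi => (hG' i hi).2.2.2 (by rw [card_erase_int hi]; omega)) s)
          convert this using 1
          ext1
          · rfl
          · exact (neg_add_cancel _).symm
        rw [← h', add_sub_cancel_right] at htΓ
        obtain ⟨x, h1, h2, h3⟩ := exists_laurD_of_epsGraph_zero hL htΓ h0
        exact ⟨x, h' ▸ h1, h' ▸ h2, h3, fun h'' => absurd h'' h.ne'⟩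
      · obtain ⟨x, h1, h2, h3⟩ := exists_laurD hL (by omega) htΓ htL htD
        rw [sub_add_cancel] at h1 h2
        exact ⟨x, h1, h2, h3, fun h'' => absurd h'' h.ne'⟩

/-- Lifting against the Čech direction, starting from the set of all indices. -/
theorem exists_descending_cech (o s : ℤ) {Γ : ℤ → Prop}
    {φ : Finset (Fin v) → (Fin v → ℤ) → P} {y0 : (Fin v → ℤ) → P}
    (hφ : ∀ A : Finset (Fin v), IsLaurent 𝒬 A (o + A.card - 1) (φ A))
    (hφΓ : ∀ A : Finset (Fin v), DegIn Γ (o + A.card - 1) (φ A))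
    (hφD : ∀ A, cechSum φ A = -(s • laurD K (φ A)))
    (hy0 : IsLaurent 𝒬 Finset.univ (o + v) y0) (hy0Γ : DegIn Γ (o + v) y0)
    (h0 : negPart (φ Finset.univ + s • laurD K y0) = 0) :
    ∃ y : Finset (Fin v) → (Fin v → ℤ) → P, y Finset.univ = y0 ∧ ∀ A : Finset (Fin v),
      IsLaurent 𝒬 A (o + A.card) (y A) ∧ DegIn Γ (o + A.card) (y A) ∧
      cechSum y A = φ A + s • laurD K (y A) := by
  classical
  let ψ : (Finset (Fin v) → (Fin v → ℤ) → P) → Finset (Fin v) → (Fin v → ℤ) → P :=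
    fun y A => φ A + s • laurD K (y A)
  have hle : ∀ A : Finset (Fin v), A.card ≤ v := fun A => by simpa using A.card_le_univ
  have hlt : ∀ (A : Finset (Fin v)), ∀ l ∉ A, v - (insert l A).card < v - A.card := by
    intro A l hl
    have := hle (insert l A)
    rw [Finset.card_insert_of_notMem hl] at this ⊢
    omega
  have hcard : ∀ (A : Finset (Fin v)), ∀ l ∉ A,
      o + ((insert l A).card : ℤ) - 1 = o + A.card := by
    intro A l hl
    rw [Finset.card_insert_of_notMem hl]
    push_cast
    ring
  have hψL : ∀ (y : Finset (Fin v) → (Fin v → ℤ) → P) (A : Finset (Fin v)),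
      IsLaurent 𝒬 A (o + A.card) (y A) → IsLaurent 𝒬 A (o + A.card - 1) (ψ y A) := fun y A h =>
    (hφ A).add ((h.laurD (sub_add_cancel _ 1).symm).zsmul s)
  have hψΓ : ∀ (y : Finset (Fin v) → (Fin v → ℤ) → P) (A : Finset (Fin v)),
      DegIn Γ (o + A.card) (y A) → DegIn Γ (o + A.card - 1) (ψ y A) := fun y A h =>
    (hφΓ A).add ((h.laurD (sub_add_cancel _ 1).symm).zsmul s)
  -- The recursion runs from large sets to small ones: the homotopy at A uses ψ only at sets A ∪
  -- {l}.
  obtain ⟨y, hy⟩ := exists_family (fun A : Finset (Fin v) => v - A.card) (v + 1)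
    (fun A => by omega) (0 : (Fin v → ℤ) → P)
    (fun y A => (A = Finset.univ → y A = y0) ∧ (A ≠ Finset.univ → y A = laurH (ψ y) A) ∧
      IsLaurent 𝒬 A (o + A.card) (y A) ∧ DegIn Γ (o + A.card) (y A))
    (by
      rintro y y' A h hA ⟨h1, h2, h3⟩
      rw [← hA]
      refine ⟨h1, fun hne => ?_, h3⟩
      rw [h2 hne]
      exact laurH_congr fun l hl => by simp only [ψ]; rw [h _ (hlt A l hl)])
    (by
      intro y A hG
      simp only [Function.update_self]
      by_cases hA : A = Finset.univ
      · subst hA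
        refine ⟨y0, fun _ => rfl, fun h => absurd rfl h, ?_⟩
        simpa using ⟨hy0, hy0Γ⟩
      · refine ⟨laurH (ψ y) A, fun h => absurd h hA, fun _ => laurH_congr fun l hl => ?_, ?_, ?_⟩
        · simp only [ψ]
          rw [Function.update_of_ne]
          exact fun h => hl (h ▸ Finset.mem_insert_self l A)
        · exact isLaurent_laurH fun l hl => by
            rw [← hcard A l hl]
            exact hψL y _ (hG _ (hlt A l hl)).2.2.1
        · exact degIn_laurH fun l hl => by
            rw [← hcard A l hl]
            exact hψΓ y _ (hG _ (hlt A l hl)).2.2.2)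
  have hyu : y Finset.univ = y0 := (hy _).1 rfl
  refine ⟨y, hyu, fun A => ⟨(hy A).2.2.1, (hy A).2.2.2, ?_⟩⟩
  -- By induction, larger sets first, the Čech differential of ψ y vanishes at all B ∪ {l}. Then the
  -- homotopy formula at B reduces to the claim, because y = `laurH` (ψ y) off the full set.
  have key : ∀ n, ∀ B : Finset (Fin v), v - B.card = n → cechSum y B = ψ y B := by
    intro n
    induction n using Nat.strong_induction_on with
    | _ n ih =>
      rintro B rfl
      have h1 := laur_homotopy (fun A => hψL y A (hy A).2.2.1)
        (by simp only [ψ]; rw [hyu]; exact h0) B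
      have h2 : laurH (cechSum (ψ y)) B = 0 := by
        have h3 : laurH (cechSum (ψ y)) B = laurH (0 : Finset (Fin v) → (Fin v → ℤ) → P) B := by
          refine laurH_congr fun l hl => ?_
          have h4 := ih _ (hlt B l hl) (insert l B) rfl
          have h5 : ψ y = φ + s • (fun A => laurD K (y A)) := rfl
          rw [h5, cechSum_add, cechSum_smul, cechSum_laurD, h4, hφD]
          simp only [ψ]
          rw [map_add, map_zsmul, laurD_laurD, smul_zero, add_zero, neg_add_cancel]
          rfl
        rw [h3]
        funext a
        by_contra h
        obtain ⟨l, _, _, h'⟩ := laurH_ne_zero h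
        exact h' rfl
      funext a
      rw [← h1 a, h2, Pi.zero_apply, add_zero]
      refine congrFun (cechSum_congr fun i hi => (hy _).2.1 fun h => ?_) a
      have := Finset.notMem_erase i B
      rw [h] at this
      exact this (Finset.mem_univ i)
  exact key _ A rfl

end CechRel

/-! ### Zigzags in the Čech double complex of `L(P)` -/

section CechRel

variable {K : Type*} [Field K] {v : ℕ}
  {M : Type*} [AddCommGroup M] [Module K M] [Module (SymAlg K v) M] [IsScalarTower K (SymAlg K v) M]
  {ℳ : ℤ → Submodule K M} {d : ℤ}
  {P : Type*} [AddCommGroup P] [Module K P] [Module (ExtAlg K v) P] [IsScalarTower K (ExtAlg K v) P]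
  {𝒬 : ℤ → Submodule K P} {ε : (SymAlg K v ⊗[K] 𝒬 d) →ₗ[SymAlg K v] M}

/-- The relation between Čech cochains `z` of `M` of internal degree `n` and elements
`w ∈ Hom_K(S, P)`, given by the zigzags in the Čech double complex of `L(P)`. -/
def CechRel (ε : (SymAlg K v ⊗[K] 𝒬 d) →ₗ[SymAlg K v] M) (o n : ℤ) (z : Cech (K := K) (v := v) M)
    (w : (Fin v → ℕ) → P) : Prop :=
  ∃ c : Finset (Fin v) → (Fin v → ℤ) → P,
    (∀ A : Finset (Fin v), IsLaurent 𝒬 A (o + A.card) (c A) ∧ DegIn (· = n) (o + A.card) (c A)) ∧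
    (∀ A, cechSum c A = laurD K (c A)) ∧
    (∀ A : Finset (Fin v), o + A.card = d → (c A, z A) ∈ epsGraph ε A) ∧
    (∀ A : Finset (Fin v), o + A.card ≠ d → z A = 0) ∧ negPart (c Finset.univ) = w

namespace CechRel

variable {o n : ℤ} {z z' : Cech (K := K) (v := v) M} {w w' : (Fin v → ℕ) → P}

theorem add (h : CechRel ε o n z w) (h' : CechRel ε o n z' w') :
    CechRel ε o n (z + z') (w + w') := by
  obtain ⟨c, h1, h2, h3, h4, rfl⟩ := h
  obtain ⟨c', h1', h2', h3', h4', rfl⟩ := h'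
  refine ⟨c + c', fun A => ⟨(h1 A).1.add (h1' A).1, (h1 A).2.add (h1' A).2⟩, fun A => ?_,
    fun A hA => add_mem (h3 A hA) (h3' A hA), fun A hA => ?_, rfl⟩
  · rw [cechSum_add, h2, h2', Pi.add_apply, map_add]
  · rw [Pi.add_apply, h4 A hA, h4' A hA, add_zero]

theorem smul (h : CechRel ε o n z w) (k : K) : CechRel ε o n (k • z) (k • w) := by
  obtain ⟨c, h1, h2, h3, h4, rfl⟩ := h
  refine ⟨k • c, fun A => ⟨(h1 A).1.smul k, (h1 A).2.smul k⟩, fun A => ?_,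
    fun A hA => Submodule.smul_mem _ k (h3 A hA), fun A hA => ?_, rfl⟩
  · rw [cechSum_smul, h2, Pi.smul_apply, map_smul]
  · rw [Pi.smul_apply, h4 A hA, smul_zero]

theorem X (h : CechRel ε o n z w) (l : Fin v) :
    CechRel ε o (n + 1) ((MvPolynomial.X l : SymAlg K v) • z) (cartanX l w) := by
  obtain ⟨c, h1, h2, h3, h4, rfl⟩ := h
  refine ⟨fun A => laurShift (Pi.single l 1) (c A), fun A => ⟨(h1 A).1.laurShift _ ?_,
    (h1 A).2.laurShift _ (by simp)⟩, fun A => ?_, fun A hA => epsGraph_X l (h3 A hA),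
    fun A hA => ?_, negPart_laurShift l _⟩
  · intro m _
    by_cases hm : m = l
    · subst hm; simp
    · simp [hm]
  · rw [laurD_laurShift, ← h2]
    funext a
    rw [cechSum_apply, laurShift_apply, cechSum_apply]
    rfl
  · rw [Pi.smul_apply, h4 A hA, smul_zero]

theorem isHomog (h : CechRel ε o n z w) : IsHomog 𝒬 (o - n) (o + v) w := by
  obtain ⟨c, h1, h2, h3, h4, rfl⟩ := h
  have := isHomog_negPart (h1 Finset.univ).1 (h1 Finset.univ).2
  rw [Finset.card_univ, Fintype.card_fin] at this
  convert this using 1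
  ring

theorem cartanD_eq_zero (h : CechRel ε o n z w) : cartanD K P w = 0 := by
  obtain ⟨c, h1, h2, h3, h4, rfl⟩ := h
  rw [← negPart_laurD, ← h2]
  exact negPart_cechSum fun A => (h1 A).1

variable [SetLike.GradedSMul (extGrading K v) 𝒬]

/-- The localized ε commutes with the Čech differential, so ∂z is the image of D c_B, and ε ∘ D = 0.
-/
theorem cechDiff_eq_zero (hL : IsLResolution 𝒬 ℳ d ε) (h : CechRel ε o n z w) :
    cechDiff M z = 0 := by
  obtain ⟨c, h1, h2, h3, h4, rfl⟩ := h
  funext B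
  by_cases hB : o + (B.card : ℤ) = d + 1
  · have e1 : (cechSum c B, cechDiff M z B) ∈ epsGraph ε B := epsGraph_cechSum fun i hi =>
      h3 _ (by rw [card_erase_int hi]; omega)
    rw [h2] at e1
    exact epsGraph_unique e1 (epsGraph_laurD hL (hB ▸ (h1 B).1))
  · exact cechDiff_apply_eq_zero fun i hi => h4 _ (by rw [card_erase_int hi]; omega)

theorem mem_locGrading [SetLike.GradedSMul (symGrading K v) ℳ] (hL : IsLResolution 𝒬 ℳ d ε)
    (h : CechRel ε o n z w) (A : Finset (Fin v)) : z A ∈ locGrading ℳ A n := by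
  obtain ⟨c, h1, h2, h3, h4, rfl⟩ := h
  by_cases hA : o + (A.card : ℤ) = d
  · exact mem_locGrading_of_epsGraph hL (hA ▸ (h1 A).2) (h3 A hA)
  · rw [h4 A hA]; exact zero_mem _

/-- A lift of b extends to y with D y_A = c_A - (∂y)_A, where y has coefficients one degree higher,
hence the offset o + 1. On the full set ∂y has no negative part. No homogeneity is required of b, so
Γ is trivial. -/
theorem exists_boundary_right (hL : IsLResolution 𝒬 ℳ d ε) (h : CechRel ε o n z w)
    {b : Cech (K := K) (v := v) M} (hb : cechDiff M b = z) : ∃ w', cartanD K P w' = w := by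
  obtain ⟨c, h1, h2, h3, h4, rfl⟩ := h
  obtain ⟨y, hy⟩ := exists_ascending_cech hL (o + 1) (-1) (Γ := fun _ => True) (φ := c) (b := b)
    (fun A => by rw [add_right_comm, add_sub_cancel_right]; exact (h1 A).1)
    (fun A _ _ => trivial)
    (fun A => by rw [← h2, neg_one_smul, neg_neg])
    (fun A _ => by
      obtain ⟨c, hc⟩ := exists_lift hL (b A)
      exact ⟨c, hc.1, fun _ _ => trivial, hc.2⟩)
    (fun A hA => by
      rw [hb, neg_one_zsmul, neg_neg]
      exact h3 A (by omega))
  refine ⟨negPart (y Finset.univ), ?_⟩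
  rw [← negPart_laurD, (hy _).2.2.1, neg_one_smul]
  funext a
  have := congrFun (negPart_cechSum fun A => (hy A).1) a
  simp only [negPart, Pi.zero_apply] at this ⊢
  rw [Pi.add_apply, Pi.neg_apply, this, neg_zero, add_zero]

theorem exists_boundary_left (hL : IsLResolution 𝒬 ℳ d ε) {prP : ℤ → P →ₗ[K] P}
    (hP : IsGradedProj 𝒬 prP) (h : CechRel ε o n z w) (hw : ∃ w', cartanD K P w' = w) :
    ∃ b : Cech (K := K) (v := v) M,
      (∀ A : Finset (Fin v), o + 1 + A.card ≠ d → b A = 0) ∧ cechDiff M b = z := by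
  classical
  obtain ⟨w', rfl⟩ := hw
  have hhom := h.isHomog
  obtain ⟨c, h1, h2, h3, h4, h5⟩ := h
  -- The homogeneous part of w' still bounds w. Unlike w', it has finite support, hence comes from a
  -- Laurent polynomial.
  have hw' : cartanD K P (homogProj prP (o - n + 1) (o + v + 1) w') = cartanD K P w' := by
    rw [cartanD_homogProj hP, add_sub_cancel_right, add_sub_cancel_right,
      homogProj_of_isHomog hP hhom]
  have hw'h := isHomog_homogProj hP (o - n + 1) (o + v + 1) w'
  set w'' := homogProj prP (o - n + 1) (o + v + 1) w'
  obtain ⟨y, -, hy⟩ := exists_descending_cech (o + 1) (-1) (Γ := fun _ => True) (φ := c)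
    (y0 := ofNegPart w'') (fun A => by rw [add_right_comm, add_sub_cancel_right]; exact (h1 A).1)
    (fun A _ _ => trivial)
    (fun A => by rw [h2, neg_one_smul, neg_neg])
    (by rw [add_right_comm]; exact isLaurent_ofNegPart hw'h)
    (fun _ _ => trivial)
    (by
      funext a
      have e1 := congrFun h5 a
      have e2 := congrFun (negPart_laurD (K := K) (ofNegPart w'')) a
      rw [negPart_ofNegPart, hw'] at e2
      simp only [negPart, Pi.zero_apply] at e1 e2 ⊢
      rw [Pi.add_apply, Pi.smul_apply, e1, e2, neg_one_smul, add_neg_cancel])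
  choose g hg using fun (A : Finset (Fin v)) (hA : o + 1 + (A.card : ℤ) = d) =>
    exists_epsGraph (ε := ε) (hA ▸ (hy A).1)
  let b : Cech (K := K) (v := v) M := fun A => if hA : o + 1 + (A.card : ℤ) = d then g A hA else 0
  refine ⟨b, fun A hA => dif_neg hA, ?_⟩
  funext B
  by_cases hB : o + (B.card : ℤ) = d
  · have e1 : (cechSum y B, cechDiff M b B) ∈ epsGraph ε B := epsGraph_cechSum fun i hi => by
      have hA : o + 1 + ((B.erase i).card : ℤ) = d := by rw [card_erase_int hi]; omega
      simp only [b, dif_pos hA]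
      exact hg _ hA
    rw [(hy B).2.2] at e1
    have e2 : IsLaurent 𝒬 B (d + 1) (y B) := by
      have := (hy B).1
      rwa [add_right_comm, hB] at this
    have e3 := add_mem (h3 B hB) (zsmul_mem (epsGraph_laurD hL e2) (-1))
    refine epsGraph_unique e1 ?_
    convert e3 using 1
    ext1
    · rfl
    · simp
  · rw [h4 B hB]
    refine cechDiff_apply_eq_zero fun i hi => dif_neg ?_
    rw [card_erase_int hi]
    omega

end CechRel

variable [SetLike.GradedSMul (extGrading K v) 𝒬]

theorem exists_cechRel_right [SetLike.GradedSMul (symGrading K v) ℳ]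
    {pr : ℤ → M →ₗ[K] M} (hM : IsGradedProj ℳ pr) (hL : IsLResolution 𝒬 ℳ d ε) {o n : ℤ}
    {z : Cech (K := K) (v := v) M} (hz : cechDiff M z = 0) (hzn : ∀ A, z A ∈ locGrading ℳ A n)
    (hz0 : ∀ A : Finset (Fin v), o + A.card ≠ d → z A = 0) : ∃ w, CechRel ε o n z w := by
  obtain ⟨y, hy⟩ := exists_ascending_cech hL o 1 (Γ := (· = n))
    (φ := (0 : Finset (Fin v) → (Fin v → ℤ) → P)) (b := z)
    (fun A => isLaurent_zero) (fun A => degIn_zero)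
    (fun A => by rw [cechSum_zero]; simp)
    (fun A _ => exists_lift_of_mem_locGrading hM hL (hzn A))
    (fun A _ => by
      rw [hz, one_zsmul, Pi.zero_apply, Pi.zero_apply, neg_zero]
      exact zero_mem _)
  exact ⟨_, y, fun A => ⟨(hy A).1, (hy A).2.1⟩, fun A => by simp [(hy A).2.2.1],
    fun A => (hy A).2.2.2, hz0, rfl⟩

theorem exists_cechRel_left {o n : ℤ} {w : (Fin v → ℕ) → P}
    (hw : IsHomog 𝒬 (o - n) (o + v) w) (hD : cartanD K P w = 0) :
    ∃ z, CechRel ε o n z w := by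
  classical
  obtain ⟨y, hyu, hy⟩ := exists_descending_cech o 1 (Γ := (· = n))
    (φ := (0 : Finset (Fin v) → (Fin v → ℤ) → P)) (y0 := ofNegPart w)
    (fun A => isLaurent_zero) (fun A => degIn_zero)
    (fun A => by rw [cechSum_zero]; simp)
    (isLaurent_ofNegPart hw)
    (by
      have := degIn_ofNegPart hw
      rwa [show o + v - v - (o - n) = n by ring] at this)
    (by rw [Pi.zero_apply, zero_add, one_smul, negPart_laurD, negPart_ofNegPart, hD])
  choose g hg using fun (A : Finset (Fin v)) (hA : o + (A.card : ℤ) = d) =>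
    exists_epsGraph (ε := ε) (hA ▸ (hy A).1)
  refine ⟨fun A => if hA : o + (A.card : ℤ) = d then g A hA else 0, y,
    fun A => ⟨(hy A).1, (hy A).2.1⟩, fun A => by simp [(hy A).2.2], fun A hA => ?_,
    fun A hA => dif_neg hA, ?_⟩
  · beta_reduce
    rw [dif_pos hA]
    exact hg A hA
  · rw [hyu, negPart_ofNegPart]

end CechRel

/-! ### Comparison of the local cohomology of `M` with the minimal resolution of `P` -/

section LocRel

universe u w

variable {K : Type*} [Field K] {v : ℕ}
  {M : Type*} [AddCommGroup M] [Module K M] [Module (SymAlg K v) M] [IsScalarTower K (SymAlg K v) M]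
  {ℳ : ℤ → Submodule K M} {d : ℤ}
  {P : Type*} [AddCommGroup P] [Module K P] [Module (ExtAlg K v) P] [IsScalarTower K (ExtAlg K v) P]
  {𝒬 : ℤ → Submodule K P} {ε : (SymAlg K v ⊗[K] 𝒬 d) →ₗ[SymAlg K v] M}
  {F : GradedFreeComplex.{u, w} K v} {π : F.X 0 →ₗ[ExtAlg K v] P}

/-- The relation between classes in `H^j_𝔪(M)_{d-j-i}` and elements of `F^{-i} ⊗_E K`. -/
def LocRel (ℳ : ℤ → Submodule K M) (ε : (SymAlg K v ⊗[K] 𝒬 d) →ₗ[SymAlg K v] M)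
    (π : F.X 0 →ₗ[ExtAlg K v] P) (i j : ℕ)
    (y : localCohomologyGrading (v := v) ℳ j (-(i : ℤ) + d - j)) (u : F.I (-(i : ℤ)) →₀ K) : Prop :=
  ∃ (z : cechCocycles (K := K) (v := v) M j) (w : (Fin v → ℕ) → P),
    Submodule.Quotient.mk z = y.1 ∧ CechRel ε (d - j) (-(i : ℤ) + d - j) z.1 w ∧
      GradedFreeComplex.ResRel π i (d - j + v) w u

theorem mk_eq_zero_iff {j : ℕ} (z : cechCocycles (K := K) (v := v) M j) :
    (Submodule.Quotient.mk z : LocalCohomology (K := K) (v := v) M j) = 0 ↔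
      z.1 ∈ cechBoundaries (K := K) (v := v) M j :=
  Submodule.Quotient.mk_eq_zero _

namespace LocRel

variable {i j : ℕ} {y y' : localCohomologyGrading (v := v) ℳ j (-(i : ℤ) + d - j)}
  {u u' : F.I (-(i : ℤ)) →₀ K}

theorem add (h : LocRel ℳ ε π i j y u) (h' : LocRel ℳ ε π i j y' u') :
    LocRel ℳ ε π i j (y + y') (u + u') := by
  obtain ⟨z, w, h1, h2, h3⟩ := h
  obtain ⟨z', w', h1', h2', h3'⟩ := h'
  exact ⟨z + z', w + w', by rw [Submodule.Quotient.mk_add, h1, h1']; rfl, h2.add h2', h3.add h3'⟩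

theorem smul (h : LocRel ℳ ε π i j y u) (k : K) : LocRel ℳ ε π i j (k • y) (k • u) := by
  obtain ⟨z, w, h1, h2, h3⟩ := h
  exact ⟨k • z, k • w, by rw [Submodule.Quotient.mk_smul, h1]; rfl, h2.smul k, h3.smul k⟩

theorem sub (h : LocRel ℳ ε π i j y u) (h' : LocRel ℳ ε π i j y' u') :
    LocRel ℳ ε π i j (y - y') (u - u') := by
  have := h.add (h'.smul (-1))
  have e : (-1 : K) • y' = -y' := neg_one_smul K y'
  rwa [e, neg_one_smul, ← sub_eq_add_neg, ← sub_eq_add_neg] at this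

theorem apply_eq_zero (h : LocRel ℳ ε π i j y u) (b : F.I (-(i : ℤ)))
    (hb : F.deg _ b ≠ -(i : ℤ) + d - j + v) : u b = 0 := by
  obtain ⟨z, w, h1, h2, h3⟩ := h
  exact h3.apply_eq_zero b fun h => hb (h.trans (by ring))

variable [SetLike.GradedSMul (extGrading K v) 𝒬]

theorem eq_zero_right (hL : IsLResolution 𝒬 ℳ d ε) (hmin : F.IsMinimal) (hF : F.IsResolution 𝒬 π)
    (h : LocRel ℳ ε π i j 0 u) : u = 0 := by
  obtain ⟨z, w, h1, h2, h3⟩ := h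
  obtain ⟨b, -, hb⟩ := (mk_eq_zero_iff z).mp h1
  exact h3.eq_zero_of_boundary hmin hF (h2.exists_boundary_right hL hb)

theorem eq_zero_left (hL : IsLResolution 𝒬 ℳ d ε) {prP : ℤ → P →ₗ[K] P}
    (hP : IsGradedProj 𝒬 prP) (hmin : F.IsMinimal) (hF : F.IsResolution 𝒬 π)
    (h : LocRel ℳ ε π i j y 0) : y = 0 := by
  obtain ⟨z, w, h1, h2, h3⟩ := h
  obtain ⟨b, hb0, hb⟩ := h2.exists_boundary_left hL hP (h3.boundary hmin hF)
  refine Subtype.ext (h1.symm.trans ((mk_eq_zero_iff z).mpr ⟨b, fun A hA => hb0 A ?_, hb⟩))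
  omega

/-- The central compatibility: both zigzags may be multiplied by x_l, which is the module structure
on local cohomology at one end and the linear part of the differential of F at the other. -/
theorem X [SetLike.GradedSMul (symGrading K v) ℳ] (hmin : F.IsMinimal)
    {y : localCohomologyGrading (v := v) ℳ j (-((i + 1 : ℕ) : ℤ) + d - j)}
    {u : F.I (-((i + 1 : ℕ) : ℤ)) →₀ K} (h : LocRel ℳ ε π (i + 1) j y u) (l : Fin v)
    (hk : -((i + 1 : ℕ) : ℤ) + 1 = -(i : ℤ))
    (hk' : -((i + 1 : ℕ) : ℤ) + d - j + 1 = -(i : ℤ) + d - j) :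
    LocRel ℳ ε π i j (xMul (localCohomologyGrading (v := v) ℳ j) l hk' y) (F.linPart hk l u) := by
  obtain ⟨z, w, h1, h2, h3⟩ := h
  refine ⟨(MvPolynomial.X l : SymAlg K v) • z, cartanX l w, ?_, ?_, h3.cartanX hmin l hk⟩
  · rw [Submodule.Quotient.mk_smul, h1]; rfl
  · rw [← hk']; exact h2.X l

end LocRel

variable [SetLike.GradedSMul (extGrading K v) 𝒬] [SetLike.GradedSMul (symGrading K v) ℳ]

theorem exists_cechRel_of_mem {pr : ℤ → M →ₗ[K] M} (hM : IsGradedProj ℳ pr)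
    (hL : IsLResolution 𝒬 ℳ d ε) {j : ℕ} {n : ℤ} (y : localCohomologyGrading (v := v) ℳ j n) :
    ∃ (z : cechCocycles (K := K) (v := v) M j) (w : (Fin v → ℕ) → P),
      Submodule.Quotient.mk z = y.1 ∧ CechRel ε (d - j) n z.1 w := by
  obtain ⟨_, z, hz, rfl⟩ := y
  obtain ⟨w, hw⟩ := exists_cechRel_right hM hL (o := d - j) z.2.2 hz
    fun A hA => z.2.1 A (by omega)
  exact ⟨z, w, rfl, hw⟩

theorem exists_locRel_right {pr : ℤ → M →ₗ[K] M} (hM : IsGradedProj ℳ pr)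
    (hL : IsLResolution 𝒬 ℳ d ε) {prP : ℤ → P →ₗ[K] P} (hP : IsGradedProj 𝒬 prP)
    (hF : F.IsResolution 𝒬 π) {i j : ℕ}
    (y : localCohomologyGrading (v := v) ℳ j (-(i : ℤ) + d - j)) : ∃ u, LocRel ℳ ε π i j y u := by
  obtain ⟨z, w, h1, h2⟩ := exists_cechRel_of_mem hM hL y
  have hw := h2.isHomog
  rw [show d - (j : ℤ) - (-(i : ℤ) + d - j) = i by ring] at hw
  obtain ⟨u, hu⟩ := GradedFreeComplex.exists_resRel_right hF hP hw h2.cartanD_eq_zero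
  exact ⟨u, z, w, h1, h2, hu⟩

theorem exists_locRel_left (hL : IsLResolution 𝒬 ℳ d ε) {prP : ℤ → P →ₗ[K] P}
    (hP : IsGradedProj 𝒬 prP) (hmin : F.IsMinimal) (hF : F.IsResolution 𝒬 π) {i j : ℕ}
    (b : F.I (-(i : ℤ))) (hb : F.deg _ b = -(i : ℤ) + d - j + v) :
    ∃ y, LocRel ℳ ε π i j y (Finsupp.single b 1) := by
  obtain ⟨w, hw⟩ := GradedFreeComplex.exists_resRel_left (p := d - j + v) hmin hF hP b
    (hb.trans (by ring))
  have hh := hw.isHomog hF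
  rw [show (i : ℤ) = d - j - (-(i : ℤ) + d - j) by ring] at hh
  obtain ⟨z, hz⟩ := exists_cechRel_left (ε := ε) hh (hw.cartanD_eq_zero hF)
  have hz0 : ∀ A : Finset (Fin v), A.card ≠ j → z A = 0 := by
    obtain ⟨c, _, _, _, h4, _⟩ := hz
    exact fun A hA => h4 A (by omega)
  exact ⟨⟨_, ⟨z, hz0, hz.cechDiff_eq_zero hL⟩, hz.mem_locGrading hL, rfl⟩, _, w, rfl, hz, hw⟩

/-- The degrees of the generators of `F^{-i}`. -/
theorem exists_deg_eq (hL : IsLResolution 𝒬 ℳ d ε) {prP : ℤ → P →ₗ[K] P}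
    (hP : IsGradedProj 𝒬 prP) (hmin : F.IsMinimal) (hF : F.IsResolution 𝒬 π) {i : ℕ}
    (b : F.I (-(i : ℤ))) : ∃ j : ℕ, F.deg _ b = -(i : ℤ) + d - j + v := by
  by_contra! hb
  -- The offset that would equal d-j. If no natural j fits, then o > d and no A satisfies o+|A| = d.
  -- The only Čech cochain in the relation is then zero, which forces the generator to vanish.
  let o : ℤ := F.deg _ b + i - v
  have ho : d < o := by
    by_contra! ho
    exact hb (d - o).toNat (by omega)
  obtain ⟨w, hw⟩ := GradedFreeComplex.exists_resRel_left (p := o + v) hmin hF hP b (by omega)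
  have hh := hw.isHomog hF
  rw [show (i : ℤ) = o - (o - i) by ring] at hh
  obtain ⟨z, hz⟩ := exists_cechRel_left (ε := ε) hh (hw.cartanD_eq_zero hF)
  have hz0 : z = 0 := by
    obtain ⟨c, _, _, _, h4, _⟩ := hz
    exact funext fun A => h4 A (by omega)
  have := hw.eq_zero_of_boundary hmin hF (hz.exists_boundary_right hL (b := 0) (by simp [hz0]))
  simp at this

/-- For n > d-j the corresponding Cartan element would live on monomials of negative degree d-j-n.
This matches the vanishing of F^k for k > 0. -/
theorem localCohomologyGrading_subsingleton {pr : ℤ → M →ₗ[K] M} (hM : IsGradedProj ℳ pr)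
    (hL : IsLResolution 𝒬 ℳ d ε) {prP : ℤ → P →ₗ[K] P} (hP : IsGradedProj 𝒬 prP) {j : ℕ} {n : ℤ}
    (hn : d - j < n) : Subsingleton (localCohomologyGrading (v := v) ℳ j n) := by
  refine subsingleton_of_forall_eq 0 fun y => ?_
  obtain ⟨z, w, h1, h2⟩ := exists_cechRel_of_mem hM hL y
  have hw := GradedFreeComplex.eq_zero_of_isHomog_of_neg (by omega) h2.isHomog
  obtain ⟨b, hb0, hb⟩ := h2.exists_boundary_left hL hP ⟨0, by rw [map_zero, hw]⟩
  exact Subtype.ext (h1.symm.trans ((mk_eq_zero_iff z).mpr ⟨b, fun A hA => hb0 A (by omega), hb⟩))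

theorem isEmpty_of_subsingleton {k : ℤ} (h : Subsingleton (F.X k)) : IsEmpty (F.I k) := by
  refine ⟨fun b => ?_⟩
  have h1 : (F.basis k).repr (F.basis k b) b = (0 : ExtAlg K v) := by
    rw [Subsingleton.elim (F.basis k b) 0]; simp
  simp at h1

end LocRel

/-! ### Linear comparison maps from F ⊗_E K to local cohomology -/

section Comparison

universe u w

variable {K : Type*} [Field K] {v : ℕ}
  {M : Type*} [AddCommGroup M] [Module K M] [Module (SymAlg K v) M] [IsScalarTower K (SymAlg K v) M]

/-- Families of maps from `F^k ⊗_E K` to the local cohomology of `M`. -/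
abbrev CompMap (F : GradedFreeComplex.{u, w} K v) (ℳ : ℤ → Submodule K M) (d k : ℤ) :=
  ∀ j : ℕ, (F.I k →₀ K) →ₗ[K] localCohomologyGrading (v := v) ℳ j (k + d - j)

/-- A family of maps that identifies the local cohomology of `M` with the pieces of `F ⊗_E K`,
compatibly with the linear part of the differential. -/
structure IsComparison (F : GradedFreeComplex.{u, w} K v) (ℳ : ℤ → Submodule K M)
    [SetLike.GradedSMul (symGrading K v) ℳ] (d : ℤ)
    (Θ : ∀ k : ℤ, CompMap F ℳ d k) : Prop where
  eq_zero : ∀ (k : ℤ) (j : ℕ) (b : F.I k), F.deg k b ≠ k + d - j + v → Θ k j (Finsupp.single b 1) = 0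
  injective : ∀ (k : ℤ) (j : ℕ) (u : F.I k →₀ K), (∀ b, F.deg k b ≠ k + d - j + v → u b = 0) →
    Θ k j u = 0 → u = 0
  surjective : ∀ (k : ℤ) (j : ℕ) (y : localCohomologyGrading (v := v) ℳ j (k + d - j)),
    ∃ u : F.I k →₀ K, (∀ b, F.deg k b ≠ k + d - j + v → u b = 0) ∧ Θ k j u = y
  exists_deg : ∀ (k : ℤ) (b : F.I k), ∃ j : ℕ, F.deg k b = k + d - j + v
  comm : ∀ (k l : ℤ) (h : k + 1 = l) (j : ℕ) (h' : k + d - j + 1 = l + d - j) (m : Fin v)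
    (u : F.I k →₀ K),
    Θ l j (F.linPart h m u) = xMul (localCohomologyGrading (v := v) ℳ j) m h' (Θ k j u)

variable {ℳ : ℤ → Submodule K M} {d : ℤ}
  {P : Type*} [AddCommGroup P] [Module K P] [Module (ExtAlg K v) P] [IsScalarTower K (ExtAlg K v) P]
  {𝒬 : ℤ → Submodule K P} {ε : (SymAlg K v ⊗[K] 𝒬 d) →ₗ[SymAlg K v] M}
  {F : GradedFreeComplex.{u, w} K v} {π : F.X 0 →ₗ[ExtAlg K v] P}

theorem map_eq_zero_of_off_support {k : ℤ} {j : ℕ} {Θ : CompMap F ℳ d k}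
    (h : ∀ b, F.deg k b ≠ k + d - j + v → Θ j (Finsupp.single b 1) = 0) {u : F.I k →₀ K}
    (hu : ∀ b, F.deg k b = k + d - j + v → u b = 0) : Θ j u = 0 := by
  rw [← Finsupp.sum_single u, Finsupp.sum, map_sum]
  refine Finset.sum_eq_zero fun b _ => ?_
  by_cases hb : F.deg k b = k + d - j + v
  · rw [hu b hb, Finsupp.single_zero, map_zero]
  · rw [← mul_one (u b), ← smul_eq_mul, ← Finsupp.smul_single, map_smul, h b hb, smul_zero]

variable [SetLike.GradedSMul (extGrading K v) 𝒬] [SetLike.GradedSMul (symGrading K v) ℳ]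

theorem exists_compMap_neg {pr : ℤ → M →ₗ[K] M} (hM : IsGradedProj ℳ pr)
    (hL : IsLResolution 𝒬 ℳ d ε) {prP : ℤ → P →ₗ[K] P} (hP : IsGradedProj 𝒬 prP)
    (hmin : F.IsMinimal) (hF : F.IsResolution 𝒬 π) (i j : ℕ) :
    ∃ Θ : (F.I (-(i : ℤ)) →₀ K) →ₗ[K] localCohomologyGrading (v := v) ℳ j (-(i : ℤ) + d - j),
      (∀ b, F.deg _ b ≠ -(i : ℤ) + d - j + v → Θ (Finsupp.single b 1) = 0) ∧
      ∀ u : F.I (-(i : ℤ)) →₀ K, (∀ b, F.deg _ b ≠ -(i : ℤ) + d - j + v → u b = 0) →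
        LocRel ℳ ε π i j (Θ u) u := by
  classical
  choose g hg using fun (b : F.I (-(i : ℤ))) (hb : F.deg _ b = -(i : ℤ) + d - j + v) =>
    exists_locRel_left (ℳ := ℳ) hL hP hmin hF b hb
  let Θ : (F.I (-(i : ℤ)) →₀ K) →ₗ[K] localCohomologyGrading (v := v) ℳ j (-(i : ℤ) + d - j) :=
    Finsupp.linearCombination K
    fun b => if hb : F.deg _ b = -(i : ℤ) + d - j + v then g b hb else 0
  have hΘ : ∀ b, Θ (Finsupp.single b 1) =
      if hb : F.deg _ b = -(i : ℤ) + d - j + v then g b hb else 0 := fun b => by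
    rw [Finsupp.linearCombination_single, one_smul]
  refine ⟨Θ, fun b hb => by rw [hΘ, dif_neg hb], fun u hu => ?_⟩
  induction u using Finsupp.induction with
  | zero =>
    -- Zero is related to zero: scale any related pair by 0.
    obtain ⟨u, hu⟩ := exists_locRel_right hM hL hP hF
      (0 : localCohomologyGrading (v := v) ℳ j (-(i : ℤ) + d - j))
    have := hu.smul 0
    rw [smul_zero, zero_smul] at this
    rwa [map_zero]
  | single_add b x f hb hx ih =>
    have hbf : f b = 0 := Finsupp.notMem_support_iff.mp hb
    have hdeg : F.deg _ b = -(i : ℤ) + d - j + v := by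
      by_contra h
      have := hu b h
      rw [Finsupp.add_apply, Finsupp.single_eq_same, hbf, add_zero] at this
      exact hx this
    have h1 := (hg b hdeg).smul x
    rw [map_add, ← mul_one x, ← smul_eq_mul, ← Finsupp.smul_single, map_smul, hΘ, dif_pos hdeg]
    refine h1.add (ih fun b' hb' => ?_)
    have := hu b' hb'
    rwa [Finsupp.add_apply, Finsupp.single_eq_of_ne (by rintro rfl; exact hb' hdeg),
      zero_add] at this

/-- The transport along k = -i allows one family indexed by all integers, taken to be zero for k >
0. -/
theorem exists_compMap {pr : ℤ → M →ₗ[K] M} (hM : IsGradedProj ℳ pr)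
    (hL : IsLResolution 𝒬 ℳ d ε) {prP : ℤ → P →ₗ[K] P} (hP : IsGradedProj 𝒬 prP)
    (hmin : F.IsMinimal) (hF : F.IsResolution 𝒬 π) (k : ℤ) :
    ∃ Θ : CompMap F ℳ d k, (∀ (j : ℕ) (b : F.I k), F.deg k b ≠ k + d - j + v → Θ j (Finsupp.single b 1) = 0) ∧
      ∀ (i : ℕ) (h : k = -(i : ℤ)) (j : ℕ) (u : F.I (-(i : ℤ)) →₀ K),
        (∀ b, F.deg _ b ≠ -(i : ℤ) + d - j + v → u b = 0) →
        LocRel ℳ ε π i j ((h ▸ Θ : CompMap F ℳ d (-(i : ℤ))) j u) u := by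
  rcases le_or_gt k 0 with hk | hk
  · obtain ⟨i, rfl⟩ : ∃ i : ℕ, k = -(i : ℤ) := ⟨(-k).toNat, by omega⟩
    choose Θ h1 h2 using exists_compMap_neg (ℳ := ℳ) (ε := ε) hM hL hP hmin hF i
    refine ⟨Θ, h1, fun i' h j => ?_⟩
    obtain rfl : i = i' := by omega
    exact h2 j
  · exact ⟨0, fun _ _ _ => rfl, fun i h => by omega⟩

theorem exists_isComparison {pr : ℤ → M →ₗ[K] M} (hM : IsGradedProj ℳ pr)
    (hL : IsLResolution 𝒬 ℳ d ε) {prP : ℤ → P →ₗ[K] P} (hP : IsGradedProj 𝒬 prP)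
    (hmin : F.IsMinimal) (hF : F.IsResolution 𝒬 π) : ∃ Θ, IsComparison F ℳ d Θ := by
  choose Θ hΘ0 hΘ using exists_compMap (F := F) (π := π) hM hL hP hmin hF
  replace hΘ : ∀ (i j : ℕ) (u : F.I (-(i : ℤ)) →₀ K),
      (∀ b, F.deg _ b ≠ -(i : ℤ) + d - j + v → u b = 0) →
      LocRel ℳ ε π i j (Θ _ j u) u := fun i j => hΘ _ i rfl j
  have hI : ∀ k > 0, IsEmpty (F.I k) := fun k hk => isEmpty_of_subsingleton (hF.eq_zero k hk)
  have hH : ∀ k > 0, ∀ j : ℕ, Subsingleton (localCohomologyGrading (v := v) ℳ j (k + d - j)) :=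
    fun k hk j => localCohomologyGrading_subsingleton hM hL hP (by omega)
  have hneg : ∀ k : ℤ, k > 0 ∨ ∃ i : ℕ, k = -(i : ℤ) := fun k => by
    rcases le_or_gt k 0 with hk | hk
    · exact Or.inr ⟨(-k).toNat, by omega⟩
    · exact Or.inl hk
  refine ⟨Θ, hΘ0, fun k j u hu h0 => ?_, fun k j y => ?_, fun k b => ?_, fun k l h j h' m u => ?_⟩
  · rcases hneg k with hk | ⟨i, rfl⟩
    · have := hI k hk
      exact Subsingleton.elim _ _
    · have := hΘ i j u hu
      rw [h0] at this
      exact this.eq_zero_right hL hmin hF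
  · rcases hneg k with hk | ⟨i, rfl⟩
    · have := hH k hk j
      exact ⟨0, fun _ _ => rfl, Subsingleton.elim _ _⟩
    · obtain ⟨u, hu⟩ := exists_locRel_right hM hL hP hF y
      have hsupp := fun b => hu.apply_eq_zero b
      have h1 := (hΘ i j u hsupp).sub hu
      rw [sub_self] at h1
      exact ⟨u, hsupp, sub_eq_zero.mp (h1.eq_zero_left hL hP hmin hF)⟩
  · rcases hneg k with hk | ⟨i, rfl⟩
    · exact (hI k hk).elim b
    · exact exists_deg_eq hL hP hmin hF b
  · subst h
    rcases hneg (k + 1) with hk | ⟨i, hi⟩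
    · have := hH _ hk j
      exact Subsingleton.elim _ _
    · have hk : k = -((i + 1 : ℕ) : ℤ) := by push_cast; omega
      -- The index l is freed so that -i can be substituted in the types depending on it.
      suffices h : ∀ (l : ℤ) (h : k + 1 = l) (h' : k + d - j + 1 = l + d - j), l = -(i : ℤ) →
          Θ l j (F.linPart h m u) = xMul (localCohomologyGrading (v := v) ℳ j) m h' (Θ k j u) from
        h _ rfl h' hi
      rintro _ h h' rfl
      subst hk
      induction u using Finsupp.induction_linear with
      | zero => simp only [map_zero]
      | add u u' hu hu' => simp only [map_add, hu, hu']
      | single b x =>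
        rw [← mul_one x, ← smul_eq_mul, ← Finsupp.smul_single]
        simp only [map_smul]
        congr 1
        -- For a generator of the right degree, both sides are related to the same element of F^{-i}
        -- ⊗_E K, hence equal. Otherwise both vanish, because a linear entry joins only generators
        -- whose degrees differ by one.
        by_cases hb : F.deg _ b = -((i + 1 : ℕ) : ℤ) + d - j + v
        · have h1 := (hΘ (i + 1) j (Finsupp.single b 1) fun b' hb' =>
            Finsupp.single_eq_of_ne (by rintro rfl; exact hb' hb)).X hmin m h h'
          have h2 := (hΘ i j _ fun b => h1.apply_eq_zero b).sub h1
          rw [sub_self] at h2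
          exact sub_eq_zero.mp (h2.eq_zero_left hL hP hmin hF)
        · rw [hΘ0 _ _ _ hb, map_zero]
          refine map_eq_zero_of_off_support (hΘ0 _ j) fun b' hb' => ?_
          rw [F.linPart_single]
          refine linCoord_eq_zero _ (F.isGradedProj _) _ (F.basis_mem _) m
            (F.d_mem h _ _ (F.basis_mem _ b)) b' ?_
          omega

end Comparison

/-! ### Free modules as sums of modules `Hom_K(E, D)` -/

section FreeModule

variable {K : Type*} [Field K] {v : ℕ} {N : Type*} [AddCommGroup N] [Module K N]
  [Module (ExtAlg K v) N] [IsScalarTower K (ExtAlg K v) N] {I : Type*}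
  (B : Module.Basis I (ExtAlg K v) N)

theorem HomE.ext {D : Type*} [AddCommGroup D] [Module K D] {α β : HomE K v D}
    (h : ∀ e, α e = β e) : α = β := LinearMap.ext h

theorem HomE.add_apply {D : Type*} [AddCommGroup D] [Module K D] (α β : HomE K v D)
    (e : ExtAlg K v) : (α + β) e = α e + β e := rfl

theorem HomE.zero_apply {D : Type*} [AddCommGroup D] [Module K D]
    (e : ExtAlg K v) : (0 : HomE K v D) e = 0 := rfl

/-- The map `e ↦ φ(e) y`. -/
def HomE.rankOne {D : Type*} [AddCommGroup D] [Module K D] (φ : ExtAlg K v →ₗ[K] K) (y : D) :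
    HomE K v D := φ.smulRight y

theorem HomE.rankOne_apply {D : Type*} [AddCommGroup D] [Module K D] (φ : ExtAlg K v →ₗ[K] K)
    (y : D) (e : ExtAlg K v) : rankOne φ y e = φ e • y := rfl

theorem HomE.rankOne_zero {D : Type*} [AddCommGroup D] [Module K D] (φ : ExtAlg K v →ₗ[K] K) :
    rankOne φ (0 : D) = 0 :=
  HomE.ext fun e => by rw [rankOne_apply, smul_zero, zero_apply]

theorem HomE.rankOne_add {D : Type*} [AddCommGroup D] [Module K D] (φ : ExtAlg K v →ₗ[K] K)
    (y y' : D) : rankOne φ (y + y') = rankOne φ y + rankOne φ y' :=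
  HomE.ext fun e => by
    rw [rankOne_apply, smul_add, add_apply, rankOne_apply, rankOne_apply]

theorem HomE.eq_sum_rankOne {D : Type*} [AddCommGroup D] [Module K D] (α : HomE K v D) :
    α = ∑ i, rankOne ((Module.finBasis K (ExtAlg K v)).coord i)
      (α (Module.finBasis K (ExtAlg K v) i)) := by
  have h : ∀ β : ExtAlg K v →ₗ[K] D, β = ∑ i, ((Module.finBasis K (ExtAlg K v)).coord i).smulRight
      (β (Module.finBasis K (ExtAlg K v) i)) := by
    intro β
    refine LinearMap.ext fun e => ?_
    conv_lhs => rw [← (Module.finBasis K (ExtAlg K v)).sum_repr e, map_sum]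
    rw [LinearMap.sum_apply]
    exact Finset.sum_congr rfl fun i _ => map_smul β _ _
  exact h α

/-- The map `e ↦ (top coefficients of e x_b)_b`. -/
def coordTop (x : N) : ExtAlg K v →ₗ[K] (I →₀ K) where
  toFun e := (B.repr x).mapRange (fun a => topCoeff K v (e * a)) (by simp)
  map_add' e e' := by ext b; simp [add_mul]
  map_smul' k e := by ext b; simp

theorem coordTop_apply (x : N) (e : ExtAlg K v) (b : I) :
    coordTop B x e b = topCoeff K v (e * B.repr x b) := rfl

theorem coordTop_smul_self (a e : ExtAlg K v) (b : I) :
    coordTop B (a • B b) e = Finsupp.single b (topCoeff K v (e * a)) := by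
  classical
  ext b'
  rw [coordTop_apply, map_smul, B.repr_self, Finsupp.smul_single, smul_eq_mul, mul_one,
    Finsupp.single_apply, Finsupp.single_apply]
  split_ifs <;> simp

theorem coordTop_self (e : ExtAlg K v) (b : I) :
    coordTop B (B b) e = topCoeff K v e • Finsupp.single b 1 := by
  have := coordTop_smul_self B 1 e b
  rw [one_smul, mul_one] at this
  rw [this, Finsupp.smul_single, smul_eq_mul, mul_one]

/-- The `E`-linear map `N → Hom_K(E, D)` attached to a map `N ⊗_E K → D`. -/
def compHom {D : Type*} [AddCommGroup D] [Module K D] (θ : (I →₀ K) →ₗ[K] D) (s : K) :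
    N →ₗ[ExtAlg K v] HomE K v D where
  toFun x := (s • θ ∘ₗ coordTop B x : ExtAlg K v →ₗ[K] D)
  map_add' x y := by
    refine HomE.ext fun e => ?_
    have : coordTop B (x + y) e = coordTop B x e + coordTop B y e := by
      ext b; simp [coordTop_apply, mul_add]
    change s • θ (coordTop B (x + y) e) = s • θ (coordTop B x e) + s • θ (coordTop B y e)
    rw [this, map_add, smul_add]
  map_smul' a x := by
    refine HomE.ext fun e => ?_
    have : coordTop B (a • x) e = coordTop B x (e * a) := by
      ext b; simp [coordTop_apply, mul_assoc]
    change s • θ (coordTop B (a • x) e) = s • θ (coordTop B x (e * a))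
    rw [this]

theorem compHom_apply {D : Type*} [AddCommGroup D] [Module K D] (θ : (I →₀ K) →ₗ[K] D) (s : K)
    (x : N) (e : ExtAlg K v) : compHom B θ s x e = s • θ (coordTop B x e) := rfl

theorem topCoeff_mul_extProj {s r : ℤ} (h : s + r = -v) {e : ExtAlg K v}
    (he : e ∈ extGrading K v s) (a : ExtAlg K v) :
    topCoeff K v (e * extProj K v r a) = topCoeff K v (e * a) := by
  induction a using isGradedProj_extGrading.induction with
  | zero => simp
  | add a a' ha ha' => rw [map_add, mul_add, mul_add, map_add, map_add, ha, ha']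
  | mem t a ha =>
    by_cases ht : t = r
    · subst ht
      rw [isGradedProj_extGrading.eq_self _ _ ha]
    · rw [isGradedProj_extGrading.eq_zero _ _ _ ha ht, mul_zero, map_zero,
        topCoeff_eq_zero_of_mem (s := s + t) (by omega) (mul_mem_extGrading he ha)]

variable {D : ℕ → Type*} [iD : ∀ j, AddCommGroup (D j)] [mD : ∀ j, Module K (D j)]
  {θ : ∀ j, (I →₀ K) →ₗ[K] D j} {deg : I → ℤ} {ν : ℕ → ℤ}

/-- Each generator has a nonzero image for at most one j, as ν is injective, so the components
assemble into the direct sum. The shift by v is the degree of `topCoeff` in Hom_K(E, K), which it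
generates. -/
theorem exists_directSum_hom (hν : Function.Injective ν)
    (h0 : ∀ j b, deg b ≠ ν j + v → θ j (Finsupp.single b 1) = 0)
    (hdeg : ∀ b, ∃ j, deg b = ν j + v) (s : K) :
    ∃ f : N →ₗ[ExtAlg K v] ⨁ j, HomE K v (D j), ∀ x j, f x j = compHom B (θ j) s x := by
  classical
  choose J hJ using hdeg
  let f : N →ₗ[ExtAlg K v] ⨁ j, HomE K v (D j) := B.constr ℕ fun b =>
    DirectSum.lof (ExtAlg K v) ℕ (fun j => HomE K v (D j)) (J b) (compHom B (θ (J b)) s (B b))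
  refine ⟨f, fun x j => ?_⟩
  have key : (DirectSum.component (ExtAlg K v) ℕ (fun j => HomE K v (D j)) j).comp f =
      compHom B (θ j) s := by
    refine B.ext fun b => ?_
    rw [LinearMap.comp_apply, B.constr_basis]
    by_cases hj : J b = j
    · subst hj
      exact DirectSum.component.lof_self _ _ _
    · rw [DirectSum.component.of, dif_neg hj]
      refine HomE.ext fun e => ?_
      rw [compHom_apply, coordTop_self, map_smul, h0, smul_zero, smul_zero]
      · rfl
      · intro h
        exact hj (hν (by have := hJ b; omega))
  exact LinearMap.congr_fun key x

variable {f : N →ₗ[ExtAlg K v] ⨁ j, HomE K v (D j)} {s : K}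

/-- The map θ_j ignores generators of the wrong degree and is injective on the others, so the top
coefficients at the latter can be recovered. -/
theorem coordTop_eq_zero_of_apply (hs : s ≠ 0) (h0 : ∀ j b, deg b ≠ ν j + v → θ j (Finsupp.single b 1) = 0)
    (hinj : ∀ j (u : I →₀ K), (∀ b, deg b ≠ ν j + v → u b = 0) → θ j u = 0 → u = 0)
    {x : N} {e : ExtAlg K v} {j : ℕ} (h : compHom B (θ j) s x e = 0) (b : I)
    (hb : deg b = ν j + v) : topCoeff K v (e * B.repr x b) = 0 := by
  classical
  rw [compHom_apply, smul_eq_zero_iff_right hs] at h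
  set u := coordTop B x e
  have h1 : θ j (u.filter fun b => deg b = ν j + v) = 0 := by
    rw [← h]
    conv_rhs => rw [← u.filter_add_filter_not fun b => deg b = ν j + v, map_add]
    rw [left_eq_add, ← Finsupp.sum_single (u.filter _), Finsupp.sum, map_sum]
    refine Finset.sum_eq_zero fun b hb => ?_
    rw [← mul_one (Finsupp.filter _ _ b), ← smul_eq_mul, ← Finsupp.smul_single, map_smul, h0,
      smul_zero]
    intro hb'
    exact (Finsupp.mem_support_iff.mp hb) (Finsupp.filter_apply_neg _ _ (not_not.mpr hb'))
  have h2 := hinj j _ (fun b hb => Finsupp.filter_apply_neg _ _ hb) h1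
  have h3 := DFunLike.congr_fun h2 b
  exact (Finsupp.filter_apply_pos (fun b => deg b = ν j + v) u hb).symm.trans h3

theorem directSum_hom_injective (hf : ∀ x j, f x j = compHom B (θ j) s x) (hs : s ≠ 0)
    (h0 : ∀ j b, deg b ≠ ν j + v → θ j (Finsupp.single b 1) = 0)
    (hinj : ∀ j (u : I →₀ K), (∀ b, deg b ≠ ν j + v → u b = 0) → θ j u = 0 → u = 0)
    (hdeg : ∀ b, ∃ j, deg b = ν j + v) : Function.Injective f := by
  rw [injective_iff_map_eq_zero]
  intro x hx
  refine B.repr.injective (Finsupp.ext fun b => ?_)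
  obtain ⟨j, hj⟩ := hdeg b
  rw [map_zero, Finsupp.zero_apply]
  refine eq_zero_of_topCoeff_mul _ fun e => coordTop_eq_zero_of_apply B hs h0 hinj ?_ b hj
  rw [← hf, hx]
  rfl

/-- As E is finite-dimensional, the maps e ↦ φ(e) y span Hom_K(E, D). Those with y the image of a
generator are hit by multiples of that generator, because every φ is represented by the Frobenius
pairing. -/
theorem directSum_hom_surjective (hf : ∀ x j, f x j = compHom B (θ j) s x) (hs : s ≠ 0)
    (hν : Function.Injective ν)
    (h0 : ∀ j b, deg b ≠ ν j + v → θ j (Finsupp.single b 1) = 0)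
    (hsurj : ∀ j, Function.Surjective (θ j)) : Function.Surjective f := by
  classical
  rw [← LinearMap.range_eq_top, eq_top_iff]
  rintro y -
  have key : ∀ (j : ℕ) (φ : ExtAlg K v →ₗ[K] K) (y : D j),
      DirectSum.of (fun j => HomE K v (D j)) j (HomE.rankOne φ y) ∈ LinearMap.range f := by
    intro j φ y
    obtain ⟨u, rfl⟩ := hsurj j y
    induction u using Finsupp.induction_linear with
    | zero =>
      rw [map_zero, HomE.rankOne_zero, map_zero]
      exact zero_mem _
    | add u u' hu hu' =>
      rw [map_add, HomE.rankOne_add, map_add]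
      exact add_mem hu hu'
    | single b k =>
      have hk : θ j (Finsupp.single b k) = k • θ j (Finsupp.single b 1) := by
        rw [← map_smul, Finsupp.smul_single, smul_eq_mul, mul_one]
      by_cases hb : deg b = ν j + v
      · obtain ⟨a, ha⟩ := exists_topCoeff_mul_eq ((s⁻¹ * k) • φ)
        have h1 : ∀ j' e, compHom B (θ j') s (a • B b) e =
            (φ e * k) • θ j' (Finsupp.single b 1) := by
          intro j' e
          rw [compHom_apply, coordTop_smul_self, ha, LinearMap.smul_apply, smul_eq_mul,
            ← mul_one (s⁻¹ * k * φ e), ← smul_eq_mul (s⁻¹ * k * φ e),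
            ← Finsupp.smul_single, map_smul, smul_smul]
          congr 1
          field_simp
        refine ⟨a • B b, DFinsupp.ext fun j' => ?_⟩
        change f (a • B b) j' = _
        rw [hf]
        refine HomE.ext fun e => ?_
        rw [h1]
        by_cases hj : j' = j
        · subst hj
          refine Eq.trans ?_ (congrArg (fun α : HomE K v (D j') => α e)
            (DirectSum.of_eq_same j' _)).symm
          change _ = HomE.rankOne φ (θ j' (Finsupp.single b k)) e
          rw [HomE.rankOne_apply, hk, smul_smul]
        · refine Eq.trans ?_ (congrArg (fun α : HomE K v (D j') => α e)
            (DirectSum.of_eq_of_ne j j' _ hj)).symm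
          change _ = (0 : HomE K v (D j')) e
          rw [h0 j' b fun h => hj (hν (by omega)), smul_zero, HomE.zero_apply]
      · rw [hk, h0 j b hb, smul_zero, HomE.rankOne_zero, map_zero]
        exact zero_mem _
  induction y using DirectSum.induction_on with
  | zero => exact zero_mem _
  | add y y' hy hy' => exact add_mem hy hy'
  | of j α =>
    rw [HomE.eq_sum_rankOne α, map_sum]
    exact sum_mem fun i _ => key j _ _

/-- Conversely, the components of x outside degree t pair to zero with every homogeneous e: either
the degrees do not add up to -v, or the hypothesis on f x applies. Nondegeneracy then makes them
vanish. -/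
theorem mem_iff_directSum_hom {gr : ℤ → Submodule K N} [SetLike.GradedSMul (extGrading K v) gr]
    {pr : ℤ → N →ₗ[K] N} (hpr : IsGradedProj gr pr) (hB : ∀ b, B b ∈ gr (deg b))
    (hf : ∀ x j, f x j = compHom B (θ j) s x) (hs : s ≠ 0)
    (h0 : ∀ j b, deg b ≠ ν j + v → θ j (Finsupp.single b 1) = 0)
    (hinj : ∀ j (u : I →₀ K), (∀ b, deg b ≠ ν j + v → u b = 0) → θ j u = 0 → u = 0)
    (hdeg : ∀ b, ∃ j, deg b = ν j + v) (t : ℤ) (x : N) :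
    x ∈ gr t ↔ ∀ j, f x j ∈ HomE.grading (ν j) t := by
  constructor
  · intro hx j r hr e he
    rw [hf, compHom_apply]
    rw [← Finsupp.sum_single (coordTop B x e), Finsupp.sum, map_sum, Finset.sum_eq_zero, smul_zero]
    intro b _
    rw [← mul_one (coordTop B x e b), ← smul_eq_mul, ← Finsupp.smul_single, map_smul]
    by_cases hb : deg b = ν j + v
    · rw [coordTop_apply, topCoeff_eq_zero_of_mem (s := r + (t - deg b)) (by omega)
        (mul_mem_extGrading he (repr_mem B hpr deg hB hx b)), zero_smul]
    · rw [h0 _ _ hb, smul_zero]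
  · intro hx
    have h1 : x - pr t x = 0 := by
      refine hpr.eq_zero_of_pr _ fun t' => ?_
      by_cases ht : t = t'
      · subst ht
        rw [map_sub, hpr.eq_self t _ (hpr.mem t x), sub_self]
      · rw [map_sub, hpr.eq_zero _ _ _ (hpr.mem t x) ht, sub_zero]
        refine B.repr.injective (Finsupp.ext fun b => ?_)
        rw [map_zero, Finsupp.zero_apply]
        refine eq_zero_of_topCoeff_mul _ fun e => ?_
        rw [repr_pr B hpr deg hB]
        induction e using isGradedProj_extGrading.induction with
        | zero => simp
        | add e e' he he' => rw [add_mul, map_add, he, he', add_zero]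
        | mem r e he =>
          by_cases hr : r + (t' - deg b) = -v
          · obtain ⟨j, hj⟩ := hdeg b
            rw [topCoeff_mul_extProj hr he]
            refine coordTop_eq_zero_of_apply B hs h0 hinj ?_ b hj
            rw [← hf]
            exact hx j r (by omega) e he
          · exact topCoeff_eq_zero_of_mem hr
              (mul_mem_extGrading he (isGradedProj_extGrading.mem _ _))
    rw [sub_eq_zero.mp h1]
    exact hpr.mem t x

end FreeModule

/-! ### The linear part of the differential and the final isomorphism -/

section LinearPart

universe u w

variable {K : Type*} [Field K] {v : ℕ}

theorem topCoeff_mul_linElt {a : ExtAlg K v} (ha : aug K a = 0) (e : ExtAlg K v) :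
    topCoeff K v (e * linElt K v a) =
      (-1 : K) ^ (v + 1) * ∑ m, topCoeff K v (extVar K m * e) * linCoeff m a := by
  rw [linElt_eq, ha, map_zero, zero_add, Finset.mul_sum, map_sum, Finset.mul_sum]
  refine Finset.sum_congr rfl fun m _ => ?_
  rw [mul_smul_comm, map_smul, topCoeff_mul_extVar, smul_eq_mul]
  ring

variable {F : GradedFreeComplex.{u, w} K v}

theorem coordTop_linD (hmin : F.IsMinimal) {k l : ℤ} (h : k + 1 = l) (b : F.I k)
    (e : ExtAlg K v) : coordTop (F.basis l) (F.linD h (F.basis k b)) e =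
      (-1 : K) ^ (v + 1) •
        ∑ m, topCoeff K v (extVar K m * e) • F.linPart h m (Finsupp.single b 1) := by
  ext b'
  rw [coordTop_apply, GradedFreeComplex.linD, Module.Basis.constr_basis, LinearEquiv.apply_symm_apply,
    Finsupp.mapRange_apply, topCoeff_mul_linElt (hmin h b b'), Finsupp.smul_apply,
    Finsupp.finsetSum_apply, smul_eq_mul]
  refine congrArg _ (Finset.sum_congr rfl fun m _ => ?_)
  rw [Finsupp.smul_apply, F.linPart_single, linCoord_apply, smul_eq_mul]

variable {M : Type*} [AddCommGroup M] [Module K M] [Module (SymAlg K v) M]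
  [IsScalarTower K (SymAlg K v) M] {ℳ : ℤ → Submodule K M}
  [SetLike.GradedSMul (symGrading K v) ℳ] {d : ℤ}

/-- Pairing e with a linear entry moves e_m from the right of e to its left at the cost of
(-1)^{v+1}. What remains is the sum over m of x_m applied to the value at e_m e, the differential of
R. -/
theorem compHom_linD (hmin : F.IsMinimal) {Θ : ∀ k : ℤ, CompMap F ℳ d k}
    (hΘ : IsComparison F ℳ d Θ) {k l : ℤ} (h : k + 1 = l) (j : ℕ)
    (h' : k + d - j + 1 = l + d - j) {s s' : K} (hs : s' * (-1) ^ (v + 1) = s) (x : F.X k) :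
    compHom (F.basis l) (Θ l j) s' (F.linD h x) =
      RDiff (localCohomologyGrading (v := v) ℳ j) h' (compHom (F.basis k) (Θ k j) s x) := by
  suffices hE : (compHom (F.basis l) (Θ l j) s').comp (F.linD h) =
      (RDiff (localCohomologyGrading (v := v) ℳ j) h').comp (compHom (F.basis k) (Θ k j) s) from
    LinearMap.congr_fun hE x
  refine (F.basis k).ext fun b => HomE.ext fun e => ?_
  have h1 : compHom (F.basis l) (Θ l j) s' (F.linD h (F.basis k b)) e =
      ∑ m, s • topCoeff K v (extVar K m * e) • Θ l j (F.linPart h m (Finsupp.single b 1)) := by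
    rw [compHom_apply, coordTop_linD hmin, map_smul, map_sum, smul_smul, hs, Finset.smul_sum]
    exact Finset.sum_congr rfl fun m _ => by rw [map_smul]
  refine h1.trans (Eq.symm ?_)
  refine (RDiff_apply _ h' _ e).trans (Finset.sum_congr rfl fun m _ => ?_)
  rw [hΘ.comm k l h j h']
  refine (congrArg (xMul (localCohomologyGrading (v := v) ℳ j) m h') ((compHom_apply _ _ _ _ _).trans
    (congrArg (fun u => s • Θ k j u) (coordTop_self (F.basis k) (extVar K m * e) b)))).trans ?_
  exact (map_smul _ s _).trans (congrArg (s • ·)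
    ((congrArg _ (map_smul (Θ k j) _ _)).trans (map_smul _ _ _)))

/-- Needed because -i + d - j and d - j - i are equal only propositionally, while the direct sum
depends on the expression. -/
theorem exists_equiv_of_eq {N : Type*} [AddCommGroup N] [Module K N]
    [Module (ExtAlg K v) N] (gr : ℤ → Submodule K N) {ν ν' : ℕ → ℤ} (h : ν = ν')
    (hg : ∃ g : N ≃ₗ[ExtAlg K v] ⨁ j : ℕ, HomE K v (localCohomologyGrading (v := v) ℳ j (ν j)),
      ∀ (t : ℤ) (x : N), x ∈ gr t ↔ ∀ j : ℕ, g x j ∈ HomE.grading (ν j) t) :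
    ∃ g : N ≃ₗ[ExtAlg K v] ⨁ j : ℕ, HomE K v (localCohomologyGrading (v := v) ℳ j (ν' j)),
      ∀ (t : ℤ) (x : N), x ∈ gr t ↔ ∀ j : ℕ, g x j ∈ HomE.grading (ν' j) t := by
  subst h
  exact hg

theorem exists_linD_equiv (hmin : F.IsMinimal) {Θ : ∀ k : ℤ, CompMap F ℳ d k}
    (hΘ : IsComparison F ℳ d Θ) :
    ∃ f : ∀ k : ℤ, F.X k ≃ₗ[ExtAlg K v] RLocTerm (v := v) ℳ d k,
      (∀ (k t : ℤ) (x : F.X k), x ∈ F.gr k t ↔ f k x ∈ RLocGrading ℳ d k t) ∧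
      ∀ (k l : ℤ) (h : k + 1 = l) (x : F.X k),
        f l (F.linD h x) = RLocDiff (v := v) ℳ d h (f k x) := by
  -- Rescaling in cohomological degree k absorbs the sign (-1)^{v+1}: since it squares to one,
  -- s_{k+1} (-1)^{v+1} = s_k.
  let s : ℤ → K := fun k => ((-1) ^ (v + 1)) ^ k
  have hσ : ((-1 : K) ^ (v + 1)) ≠ 0 := pow_ne_zero _ (neg_ne_zero.mpr one_ne_zero)
  have hs : ∀ k, s k ≠ 0 := fun k => zpow_ne_zero k hσ
  have hν : ∀ k : ℤ, Function.Injective fun j : ℕ => k + d - j := fun k j j' hj => by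
    have : k + d - (j : ℤ) = k + d - j' := hj
    omega
  have hex : ∀ k : ℤ, ∃ f : F.X k →ₗ[ExtAlg K v] RLocTerm (v := v) ℳ d k,
      ∀ x j, f x j = compHom (F.basis k) (Θ k j) (s k) x := fun k =>
    exists_directSum_hom (D := fun j : ℕ => localCohomologyGrading (v := v) ℳ j (k + d - j))
      (iD := fun j => inferInstance) (mD := fun j => inferInstance) (θ := Θ k) (F.basis k) (hν k) (hΘ.eq_zero k) (hΘ.exists_deg k) (s k)
  choose f hf using hex
  have hbij : ∀ k, Function.Bijective (f k) := fun k =>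
    ⟨directSum_hom_injective (D := fun j : ℕ => localCohomologyGrading (v := v) ℳ j (k + d - j))
      (iD := fun j => inferInstance) (mD := fun j => inferInstance) (F.basis k) (hf k) (hs k) (hΘ.eq_zero k) (hΘ.injective k)
      (hΘ.exists_deg k),
    directSum_hom_surjective (D := fun j : ℕ => localCohomologyGrading (v := v) ℳ j (k + d - j))
      (iD := fun j => inferInstance) (mD := fun j => inferInstance) (F.basis k) (hf k) (hs k) (hν k) (hΘ.eq_zero k) fun j y =>
      (hΘ.surjective k j y).imp fun _ h => h.2⟩
  refine ⟨fun k => LinearEquiv.ofBijective (f k) (hbij k), fun k t x =>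
    mem_iff_directSum_hom (D := fun j : ℕ => localCohomologyGrading (v := v) ℳ j (k + d - j))
      (iD := fun j => inferInstance) (mD := fun j => inferInstance) (F.basis k) (F.isGradedProj k) (F.basis_mem k) (hf k) (hs k)
      (hΘ.eq_zero k) (hΘ.injective k) (hΘ.exists_deg k) t x, fun k l h x => ?_⟩
  refine DFinsupp.ext fun j => ?_
  change f l (F.linD h x) j = RDiff (localCohomologyGrading (v := v) ℳ j) _ (f k x j)
  rw [hf, hf]
  refine compHom_linD hmin hΘ h j _ ?_ x
  subst h
  simp only [s]
  rw [zpow_add_one₀ hσ, mul_assoc, ← pow_add, Even.neg_one_pow ⟨v + 1, rfl⟩, mul_one]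

end LinearPart

end BGG

end

set_option maxHeartbeats 1000000 in
theorem theorem4p3 {K : Type*} [Field K] {v : ℕ}
    -- a graded `S`-module `M`, generated in degree `d`
    {M : Type*} [AddCommGroup M] [Module K M] [Module (BGG.SymAlg K v) M]
    [IsScalarTower K (BGG.SymAlg K v) M]
    (ℳ : ℤ → Submodule K M) [SetLike.GradedSMul (BGG.symGrading K v) ℳ]
    (hℳ : DirectSum.IsInternal ℳ) (d : ℤ)
    (hgen : Submodule.span (BGG.SymAlg K v) (ℳ d : Set M) = ⊤)
    -- a graded `E`-module `P` such that `L(P)` is a free resolution of `M`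
    {P : Type*} [AddCommGroup P] [Module K P] [Module (BGG.ExtAlg K v) P]
    [IsScalarTower K (BGG.ExtAlg K v) P]
    (𝒬 : ℤ → Submodule K P) [SetLike.GradedSMul (BGG.extGrading K v) 𝒬]
    (h𝒬 : DirectSum.IsInternal 𝒬)
    (hL : ∃ ε, BGG.IsLResolution (v := v) 𝒬 ℳ d ε)
    -- the minimal free resolution `F` of `P`
    (F : BGG.GradedFreeComplex K v) (hmin : F.IsMinimal)
    (hF : ∃ π, F.IsResolution 𝒬 π) :
    -- `lin(F) ≅ (⨁_j R(H^j(M)))⟨d⟩` as complexes of graded `E`-modules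
    (∃ f : ∀ k : ℤ, F.X k ≃ₗ[BGG.ExtAlg K v] BGG.RLocTerm (v := v) ℳ d k,
      (∀ (k t : ℤ) (x : F.X k), x ∈ F.gr k t ↔ f k x ∈ BGG.RLocGrading ℳ d k t) ∧
      ∀ (k l : ℤ) (h : k + 1 = l) (x : F.X k),
        f l (F.linD h x) = BGG.RLocDiff (v := v) ℳ d h (f k x)) ∧
    -- in particular `F^{-i} ≅ ⨁_j Hom_K(E, H^j(M)_{d-j-i})` as graded `E`-modules
    ∀ i : ℕ, ∃ g : F.X (-i) ≃ₗ[BGG.ExtAlg K v]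
        ⨁ j : ℕ, BGG.HomE K v (BGG.localCohomologyGrading (v := v) ℳ j (d - j - i)),
      ∀ (t : ℤ) (x : F.X (-i)),
        x ∈ F.gr (-i) t ↔ ∀ j : ℕ, g x j ∈ BGG.HomE.grading (d - j - i) t := by
  obtain ⟨ε, hL⟩ := hL
  obtain ⟨π, hF⟩ := hF
  obtain ⟨pr, hM⟩ := BGG.exists_isGradedProj hℳ
  obtain ⟨prP, hP⟩ := BGG.exists_isGradedProj h𝒬
  obtain ⟨Θ, hΘ⟩ := BGG.exists_isComparison hM hL hP hmin hF
  have hf := BGG.exists_linD_equiv hmin hΘ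
  refine ⟨hf, fun i => ?_⟩
  obtain ⟨f, hgr, -⟩ := hf
  have hν : (fun j : ℕ => -(i : ℤ) + d - j) = fun j : ℕ => d - j - i := by funext j; ring
  exact BGG.exists_equiv_of_eq (F.gr (-i)) hν
    ⟨f (-i), fun t x => hgr (-i) t x⟩
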